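/- Let $N\ge 3$ and $R>0$, let $B_R$ be the open ball of radius $R$ centered at the origin of $\mathbb{R}^N$, and put $a=\frac{N-2}{2}$, $2^*=\frac{2N}{N-2}$ and $$S(N)=\frac{N(N-2)}{4}\,|\mathbb{S}_N|^{2/N},\qquad |\mathbb{S}_N|=\frac{2\pi^{(N+1)/2}}{\Gamma\left(\frac{N+1}{2}\right)},\qquad J(u)=\left(\int_{B_R}|u|^{2^*}\left(-\log\frac{|x|}{R}\right)^{-\frac{2(N-1)}{N-2}}dx\right)^{\frac{N-2}{N}} .$$ Consider, for a real constant $C$, the inequalities $$\text{(HS1)}\qquad \int_{B_R}|\nabla u|^2dx\ \ge\ a^2\int_{B_R}\frac{u^2}{|x|^2}dx+C\,J(u)$$ for radially symmetric $u\in C_c^\infty(B_R\setminus\{0\})$, and $$\text{(eq6)}\qquad \int_{\mathbb{R}^N}|\nabla w|^2\,dy\ \ge\ (N-2)^{\frac{2(N-1)}{N}}\,C\left(\int_{\mathbb{R}^N}|w|^{2^*}dy\right)^{\frac{N-2}{N}} .$$ (i) The transformation $w(t)=|x|^{a}u(|x|)$, $t=\left(-\log(|x|/R)\right)^{-1/(N-2)}$,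 is a bijection between the radially symmetric functions of $C_c^\infty(B_R\setminus\{0\})$ and those of $C_c^\infty(\mathbb{R}^N\setminus\{0\})$, and, for every $C$, (HS1) holds for $u$ if and only if (eq6) holds for $w$. Moreover, for every $C$, (HS1) holds for all radially symmetric $u\in C_c^\infty(B_R\setminus\{0\})$ if and only if (eq6), the Sobolev inequality in $\mathbb{R}^N$, holds for all $w\in C_c^\infty(\mathbb{R}^N)$. (ii) The best (largest) constant in (HS1) is $C_{HS}=S(N)\,(N-2)^{-2(N-1)/N}$. (iii) Let $H(B_R)$ be the completion, realized in $L^2(B_R)$, of $\{|x|^{-a}\varphi:\varphi\in C_c^\infty(B_R)\}$ under the norm $$\|u\|_H^2=\int_{B_R}\left(|\nabla u|^2-a^2\frac{u^2}{|x|^2}\right)dx-L(u)^2,\qquad L(u)=\left(\frac{N(N-2)}{2}\,\omega_N\right)^{1/2}\lim_{r\to0}r^{a}u_r(r),$$ where $u_r(r)$ is the mean of $u$ over $\partial B_r$ and $\omega_N$ is the volume of the unit ball, and let $H_r(B_R)$ be its subspace of radially symmetric functions. For every $u\in H_r(B_R)$ the integral in $J(u)$ is finite and $\|u\|_H^2\ge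 C_{HS}\,J(u)$. Equality holds for the functions $$u_{m,n}(x)=|x|^{-a}\left(m^2+n^2\left(-\log\frac{|x|}{R}\right)^{-\frac{2}{N-2}}\right)^{-a},\qquad m\ne0,\ n\ne0,$$ which belong to $H_r(B_R)$ and vanish continuously on $\partial B_R$. The minimizers of $\|u\|_H^2/J(u)$ over $H_r(B_R)\setminus\{0\}$ are exactly the functions $\pm u_{m,n}$, $m\ne0$, $n\ne0$ (up to equality almost everywhere). -/

import Mathlib

open MeasureTheory Filter Topology
open scoped ContDiff

/-- The Euclidean space of dimension `N`. -/
abbrev Euc (N : ℕ) : Type := EuclideanSpace ℝ (Fin N)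

/-- `φ ∈ C_c^∞(Ω)`, for `φ` defined on the whole space. -/
def IsTest {N : ℕ} (Ω : Set (Euc N)) (φ : Euc N → ℝ) : Prop :=
  ContDiff ℝ ∞ φ ∧ HasCompactSupport φ ∧ tsupport φ ⊆ Ω

/-- `u` is a radially symmetric function. -/
def IsRadial {N : ℕ} (u : Euc N → ℝ) : Prop :=
  ∀ x y : Euc N, ‖x‖ = ‖y‖ → u x = u y

/-- Lebesgue measure restricted to the ball `B_R` centered at the origin. -/
noncomputable def ballMeasure (N : ℕ) (R : ℝ) : Measure (Euc N) :=
  volume.restrict (Metric.ball 0 R)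

/-- `u` coincides almost everywhere on the ball `B_R` with a radially symmetric function. -/
def IsRadialAE {N : ℕ} (R : ℝ) (u : Euc N → ℝ) : Prop :=
  ∃ g : ℝ → ℝ, u =ᵐ[ballMeasure N R] fun x => g ‖x‖

/-- The density `|u|^{2N/(N-2)} (-log (|x|/R))^{-2(N-1)/(N-2)}`. -/
noncomputable def hsDensity {N : ℕ} (R : ℝ) (u : Euc N → ℝ) (x : Euc N) : ℝ :=
  |u x| ^ (2 * (N : ℝ) / ((N : ℝ) - 2)) *
    (-Real.log (‖x‖ / R)) ^ (-(2 * ((N : ℝ) - 1) / ((N : ℝ) - 2)))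

/-- `(∫_{B_R} |u|^{2N/(N-2)} (-log (|x|/R))^{-2(N-1)/(N-2)} dx)^{(N-2)/N}`. -/
noncomputable def hsTerm {N : ℕ} (R : ℝ) (u : Euc N → ℝ) : ℝ :=
  (∫ x, hsDensity R u x ∂(ballMeasure N R)) ^ (((N : ℝ) - 2) / (N : ℝ))

/-- The improved Hardy-Sobolev inequality on `B_R` with constant `C`, for the function `u`. -/
def HardySobolevIneq {N : ℕ} (R C : ℝ) (u : Euc N → ℝ) : Prop :=
  ∫ x, ‖fderiv ℝ u x‖ ^ 2 ∂(ballMeasure N R) ≥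
    (((N : ℝ) - 2) / 2) ^ 2 * (∫ x, u x ^ 2 / ‖x‖ ^ 2 ∂(ballMeasure N R)) + C * hsTerm R u

/-- The Sobolev inequality on the whole space with constant `(N-2)^{2(N-1)/N} C`,
for the function `w`. -/
def SobolevIneq {N : ℕ} (C : ℝ) (w : Euc N → ℝ) : Prop :=
  ∫ y, ‖fderiv ℝ w y‖ ^ 2 ≥
    ((N : ℝ) - 2) ^ (2 * ((N : ℝ) - 1) / (N : ℝ)) * C *
      (∫ y, |w y| ^ (2 * (N : ℝ) / ((N : ℝ) - 2))) ^ (((N : ℝ) - 2) / (N : ℝ))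

/-- The new radial variable `t = (-log (r/R))^{-1/(N-2)}`, for `0 < r < R`. -/
noncomputable def tVar (N : ℕ) (R r : ℝ) : ℝ :=
  (-Real.log (r / R)) ^ (-(1 / ((N : ℝ) - 2)))

/-- `u` on `B_R \ {0}` and `w` on the whole space without the origin are related by
`w(t) = |x|^{(N-2)/2} u(|x|)`, `t = (-log (|x|/R))^{-1/(N-2)}`. -/
def IsTransform {N : ℕ} (R : ℝ) (u w : Euc N → ℝ) : Prop :=
  ∀ x y : Euc N, 0 < ‖x‖ → ‖x‖ < R → ‖y‖ = tVar N R ‖x‖ →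
    w y = ‖x‖ ^ (((N : ℝ) - 2) / 2) * u x

/-- `S(N) = (N(N-2)/4) |𝕊_N|^{2/N}`, where `|𝕊_N| = 2 π^{(N+1)/2} / Γ((N+1)/2)` is the area of
the `N`-dimensional unit sphere (the one in dimension `N + 1`). -/
noncomputable def sobolevConst (N : ℕ) : ℝ :=
  (N : ℝ) * ((N : ℝ) - 2) / 4 *
    (2 * Real.pi ^ (((N : ℝ) + 1) / 2) / Real.Gamma (((N : ℝ) + 1) / 2)) ^ (2 / (N : ℝ))

/-- `C_HS = S(N) (N-2)^{-2(N-1)/N}`. -/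
noncomputable def hsConst (N : ℕ) : ℝ :=
  sobolevConst N * ((N : ℝ) - 2) ^ (-(2 * ((N : ℝ) - 1) / (N : ℝ)))

/-- The Talenti profile `ψ_{m,n}(t) = (m² + n² t²)^{-(N-2)/2}`. -/
noncomputable def talenti (N : ℕ) (m n t : ℝ) : ℝ :=
  (m ^ 2 + n ^ 2 * t ^ 2) ^ (-(((N : ℝ) - 2) / 2))

/-- `|x|^{-(N-2)/2} φ(x)`. -/
noncomputable def singularMul {N : ℕ} (φ : Euc N → ℝ) (x : Euc N) : ℝ :=
  ‖x‖ ^ (-(((N : ℝ) - 2) / 2)) * φ x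

/-- `u_{m,n}(x) = |x|^{-(N-2)/2} ψ_{m,n}((-log (|x|/R))^{-1/(N-2)})`. -/
noncomputable def hsExtremal (N : ℕ) (R m n : ℝ) : Euc N → ℝ :=
  singularMul fun x => talenti N m n (tVar N R ‖x‖)

/-- The mean of `u` over the sphere of radius `r` centered at the origin. -/
noncomputable def sphericalMean {N : ℕ} (u : Euc N → ℝ) (r : ℝ) : ℝ :=
  ⨍ y : Metric.sphere (0 : Euc N) 1, u (r • (y : Euc N)) ∂((volume : Measure (Euc N)).toSphere)

/-- `L(u) = (N(N-2) ω_N / 2)^{1/2} lim_{r → 0} r^{(N-2)/2} u_r(r)`, with `u_r` the spherical mean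
of `u` and `ω_N` the volume of the unit ball. -/
noncomputable def hardyL {N : ℕ} (u : Euc N → ℝ) : ℝ :=
  Real.sqrt ((N : ℝ) * ((N : ℝ) - 2) / 2 * volume.real (Metric.ball (0 : Euc N) 1)) *
    limUnder (𝓝[>] (0 : ℝ)) fun r => r ^ (((N : ℝ) - 2) / 2) * sphericalMean u r

/-- The squared norm of `H(B_R)` on functions `u = |x|^{-(N-2)/2} φ`, `φ ∈ C_c^∞(B_R)`:
`∫ (|∇u|² - ((N-2)/2)² u²/|x|²) dx - L(u)²`. The two terms of the integrand are not integrable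
one by one if `φ(0) ≠ 0`, but their difference is. -/
noncomputable def hForm {N : ℕ} (R : ℝ) (u : Euc N → ℝ) : ℝ :=
  (∫ x, (‖fderiv ℝ u x‖ ^ 2 - (((N : ℝ) - 2) / 2) ^ 2 * (u x ^ 2 / ‖x‖ ^ 2))
    ∂(ballMeasure N R)) - hardyL u ^ 2

/-- `u ∈ H(B_R)` and `‖u‖²_H = e`, where `H(B_R)` is the completion of
`{|x|^{-(N-2)/2} φ : φ ∈ C_c^∞(B_R)}` under the norm `hForm ^ (1/2)`, realized in `L²(B_R)`:
`u` is the `L²(B_R)`-limit of a sequence of such functions that is Cauchy in this norm, and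
`e` is the limit of their squared norms. -/
def HasHNormSq {N : ℕ} (R : ℝ) (u : Euc N → ℝ) (e : ℝ) : Prop :=
  AEStronglyMeasurable u (ballMeasure N R) ∧
  ∃ φ : ℕ → Euc N → ℝ,
    (∀ k, IsTest (Metric.ball 0 R) (φ k)) ∧
    (∀ ε > 0, ∃ K, ∀ k ≥ K, ∀ l ≥ K, hForm R (singularMul (φ k - φ l)) < ε) ∧
    Tendsto (fun k => eLpNorm (singularMul (φ k) - u) 2 (ballMeasure N R)) atTop (𝓝 0) ∧
    Tendsto (fun k => hForm R (singularMul (φ k))) atTop (𝓝 e)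

/-- `u` is a nonzero radial element of `H(B_R)` with `‖u‖²_H = e`. -/
def IsNonzeroRadialH {N : ℕ} (R : ℝ) (u : Euc N → ℝ) (e : ℝ) : Prop :=
  IsRadialAE R u ∧ HasHNormSq R u e ∧ ¬ u =ᵐ[ballMeasure N R] 0

/-- `u` minimizes the quotient `‖z‖²_H / hsTerm z` among the nonzero radial `z ∈ H(B_R)`. -/
def IsHSMinimizer {N : ℕ} (R : ℝ) (u : Euc N → ℝ) : Prop :=
  ∃ e, IsNonzeroRadialH R u e ∧
    ∀ (z : Euc N → ℝ) (e' : ℝ), IsNonzeroRadialH R z e' → e / hsTerm R u ≤ e' / hsTerm R z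

/-! Write u(x) = |x|^{-a} V(s) with s = -log(|x|/R), and w(y) = V(s) with s = |y|^{-(N-2)}. Since t
= s^{-1/(N-2)}, the functions u and w correspond to each other exactly when they have the same
profile V. In the variable s the Hardy term splits off: the Dirichlet integrand becomes (aV + V')²,
where a²V² is the Hardy integrand and 2aVV' integrates to zero. What remains of (HS1), and also of
(eq6) once the powers of N - 2 cancel, is one inequality on (0, ∞) between ∫ V'² and the integral of
|V|^{2*} s^{-2(N-1)/(N-2)}: Bliss's inequality.

Bliss's inequality and its equality cases follow an argument of Nagy. Put h = V', y = V/√s, p = 2*,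
and normalise max |y| = 1. Completing a square (`nagy_pointwise`) writes h² as |y|^p/(4s), plus a
nonnegative defect, plus an exact derivative. The sign inside the square changes at the maximum
point, so the exact part contributes 4Φ(1) with Φ = `nagyPot p` (`nagy_identity`), and Bernoulli's
inequality converts the resulting sum into the product form (`bliss_inequality`). In the case of
equality the defect vanishes, which is a first order ODE; its solutions are solitons, possibly with
a plateau at height 1, and equality of the masses excludes the plateau. Solitons are the Talenti
profiles in the variable s (`talenti_eq_soliton`), so their mass is known from a Gamma integral
(`talentiMass_eq_solitonMass`), and Φ(1) never has to be computed.

For non-radial w, (eq6) is proved by mass transport and not by symmetrization: the triangular Knothe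
map (`exists_knothe_map`) carries |w|^p + ε on a cube to a multiple of the Talenti density on
another cube. The inequality of arithmetic and geometric means for its Jacobian, integration by
parts and Young's inequality give `sobolev_cube_dual`; then ε → 0 and the second cube grows
(`sobolev_inequality`).

For H(B_R), the substitution u = |x|^{-a} φ gives ‖u‖² = ∫ |x|^{2-N} |∇φ|², the term L(u)² being the
boundary term at the origin (`hForm_singularMul`). By Jensen, spherical means increase neither this
energy nor the L² distance to a radial function, so a radial element of H(B_R) has a profile with h
∈ L² and energy at most ‖u‖² (`HasHNormSq.exists_profile`), and Bliss's inequality applies.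
Conversely, the extremals lie in H(B_R), being approximated by cutting off their profiles in s. -/

/-! ### Knothe transport between cubes -/

/-- The cube `[-L, L]^n`. -/
def cube (n : ℕ) (L : ℝ) : Set (Fin n → ℝ) := Set.Icc (fun _ => -L) (fun _ => L)

lemma measurableSet_cube (n : ℕ) (L : ℝ) : MeasurableSet (cube n L) := measurableSet_Icc

lemma mem_cube_iff {n : ℕ} {L : ℝ} {x : Fin n → ℝ} : x ∈ cube n L ↔ ∀ k, x k ∈ Set.Icc (-L) L := by
  simp only [cube, Set.mem_Icc, Pi.le_def]
  exact ⟨fun h k => ⟨h.1 k, h.2 k⟩, fun h => ⟨fun k => (h k).1, fun k => (h k).2⟩⟩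

/-- Fubini on a cube, isolating the coordinate `k`. -/
lemma integral_cube_succ {n : ℕ} {L : ℝ} (hL : 0 ≤ L) (k : Fin (n + 1))
    {f : (Fin (n + 1) → ℝ) → ℝ} (hf : Continuous f) :
    ∫ x in cube (n + 1) L, f x =
      ∫ x in cube n L, ∫ s in (-L)..L, f (k.insertNth s x) := by
  set e : ℝ × (Fin n → ℝ) ≃ᵐ (Fin (n + 1) → ℝ) :=
    (MeasurableEquiv.piFinSuccAbove (fun _ => ℝ) k).symm with he
  have hem : MeasurePreserving e :=
    (volume_preserving_piFinSuccAbove (fun _ : Fin (n + 1) => ℝ) k).symm _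
  have hpre : e ⁻¹' (cube (n + 1) L) = Set.Icc (-L) L ×ˢ cube n L := by
    have := ((Fin.insertNthOrderIso (fun _ => ℝ) k).preimage_Icc (fun _ => -L) (fun _ => L))
    exact this.trans (Set.Icc_prod_eq _ _)
  have hint : IntegrableOn (fun z : ℝ × (Fin n → ℝ) => f (e z)) (Set.Icc (-L) L ×ˢ cube n L)
      (volume.prod volume) := by
    rw [← hpre, ← Measure.volume_eq_prod]
    exact (hem.integrableOn_comp_preimage e.measurableEmbedding).2
      (hf.integrableOn_Icc)
  rw [← hem.map_eq, setIntegral_map_equiv, hpre, Measure.volume_eq_prod,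
    ← setIntegral_prod_swap, setIntegral_prod]
  · refine setIntegral_congr_fun (measurableSet_cube n L) fun x _ => ?_
    rw [intervalIntegral.integral_of_le (by linarith), ← integral_Icc_eq_integral_Ioc]
    rfl
  · rw [IntegrableOn, ← Measure.prod_restrict] at hint ⊢
    exact hint.swap

lemma integral_cube_cons {n : ℕ} {L : ℝ} (hL : 0 ≤ L)
    {f : (Fin (n + 1) → ℝ) → ℝ} (hf : Continuous f) :
    ∫ x in cube (n + 1) L, f x =
      ∫ x in cube n L, ∫ s in (-L)..L, f (Fin.cons s x) := by
  simpa only [Fin.insertNth_zero'] using integral_cube_succ hL 0 hf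

section Inverse

variable {Y : Type*} [TopologicalSpace Y]

lemma strictMono_primitive {g : ℝ → ℝ} (hg : Continuous g) (hpos : ∀ t, 0 < g t) (L : ℝ) :
    StrictMono fun τ => ∫ t in L..τ, g t := by
  intro a b hab
  have h := intervalIntegral.integral_interval_sub_left (hg.intervalIntegrable L b)
    (hg.intervalIntegrable (μ := volume) L a)
  have h2 := intervalIntegral.intervalIntegral_pos_of_pos (hg.intervalIntegrable (μ := volume) a b)
    hpos hab
  simp only
  linarith

/-- The inverse of the primitive of a positive continuous function depending on a parameter. -/
lemma exists_inverse_primitive {g : Y → ℝ → ℝ} (hg : Continuous (Function.uncurry g))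
    (hpos : ∀ y t, 0 < g y t) {L : ℝ} (hL : 0 < L) :
    ∃ I : Y → ℝ → ℝ, Continuous (Function.uncurry I) ∧ (∀ y c, I y c ∈ Set.Icc (-L) L) ∧
      (∀ y c, 0 ≤ c → c ≤ ∫ t in (-L)..L, g y t → ∫ t in (-L)..(I y c), g y t = c) := by
  set A : Y → ℝ → ℝ := fun y τ => ∫ t in (-L)..τ, g y t with hA
  have hgy : ∀ y, Continuous (g y) := fun y => hg.uncurry_left y
  have hAc : ∀ τ, Continuous fun y => A y τ := fun τ =>
    intervalIntegral.continuous_parametric_intervalIntegral_of_continuous' hg _ _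
  have hmono : ∀ y, StrictMono (A y) := fun y => strictMono_primitive (hgy y) (hpos y) (-L)
  have hcont : ∀ y, Continuous (A y) := fun y =>
    intervalIntegral.continuous_primitive (fun a b => (hgy y).intervalIntegrable a b) _
  have hA0 : ∀ y, A y (-L) = 0 := fun y => by simp [hA]
  have hAL : ∀ y, 0 < A y L := fun y => by rw [← hA0 y]; exact hmono y (by linarith)
  -- The level c is clamped to the range of A y on [-L, L], which makes the inverse defined, and
  -- continuous, for every real c.
  have hex : ∀ y c, ∃ τ ∈ Set.Icc (-L) L, A y τ = max 0 (min c (A y L)) := by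
    intro y c
    have := intermediate_value_Icc (show -L ≤ L by linarith) (hcont y).continuousOn
    have h2 : max 0 (min c (A y L)) ∈ Set.Icc (A y (-L)) (A y L) := by
      rw [hA0]; exact ⟨le_max_left _ _, max_le (hAL y).le (min_le_right _ _)⟩
    exact this h2
  choose I hI hAI using hex
  refine ⟨I, ?_, hI, fun y c h0 h1 => ?_⟩
  -- Since A y is strictly increasing, I y c > a means that A y a lies below the clamped level.
  -- Preimages of rays are therefore open as soon as A is continuous in y for each fixed endpoint.
  · rw [OrderTopology.continuous_iff]
    have hcc : ∀ τ, Continuous fun p : Y × ℝ => A p.1 τ := fun τ => (hAc τ).comp continuous_fst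
    have hC : Continuous fun p : Y × ℝ => max 0 (min p.2 (A p.1 L)) :=
      continuous_const.max (continuous_snd.min (hcc L))
    intro a
    constructor
    · have : Function.uncurry I ⁻¹' Set.Ioi a = {p | A p.1 a < max 0 (min p.2 (A p.1 L))} := by
        ext p
        simp only [Set.mem_preimage, Set.mem_Ioi, Set.mem_ofPred_eq, ← hAI, (hmono p.1).lt_iff_lt]
        rfl
      rw [this]
      exact isOpen_lt (hcc a) hC
    · have : Function.uncurry I ⁻¹' Set.Iio a = {p | max 0 (min p.2 (A p.1 L)) < A p.1 a} := by
        ext p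
        simp only [Set.mem_preimage, Set.mem_Iio, Set.mem_ofPred_eq, ← hAI, (hmono p.1).lt_iff_lt]
        rfl
      rw [this]
      exact isOpen_lt hC (hcc a)
  · have := hAI y c
    rw [min_eq_left h1, max_eq_right h0] at this
    exact this

end Inverse

/-- The Knothe map: a triangular map that transports the density `F` on a cube to the density `G`
on another cube; `D x k` is the partial derivative of its `k`-th component in the direction `k`. -/
theorem exists_knothe_map {M L : ℝ} (hM : 0 < M) (hL : 0 < L) : ∀ (n : ℕ)
    (F G : (Fin n → ℝ) → ℝ), Continuous F → Continuous G → (∀ x, 0 < F x) → (∀ x, 0 < G x) →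
    ∫ x in cube n M, F x = ∫ y in cube n L, G y →
    ∃ T D : (Fin n → ℝ) → (Fin n → ℝ), Continuous T ∧ Continuous D ∧
      (∀ x, T x ∈ cube n L) ∧ (∀ x k, 0 < D x k) ∧
      (∀ x, G (T x) * ∏ k, D x k = F x) ∧
      (∀ x k, x k ∈ Set.Ioo (-M) M →
        HasDerivAt (fun s => T (Function.update x k s) k) (D x k) (x k)) ∧
      ∀ h : (Fin n → ℝ) → ℝ, Continuous h →
        ∫ x in cube n M, h (T x) * F x = ∫ y in cube n L, h y * G y
  | 0, F, G, _, _, _, _, hm => by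
      have hc : ∀ K, cube 0 K = Set.univ := fun K => by
        ext x; simp [mem_cube_iff]
      have hs : ∀ (f : (Fin 0 → ℝ) → ℝ) K, ∫ x in cube 0 K, f x = f default := by
        intro f K
        rw [hc, Measure.restrict_univ, Measure.volume_pi_eq_dirac default, integral_dirac]
      have hD : ∀ x : Fin 0 → ℝ, x = default := fun x => Subsingleton.elim _ _
      rw [hs, hs] at hm
      refine ⟨id, id, continuous_id, continuous_id, fun x => by simp [mem_cube_iff],
        fun x k => k.elim0, fun x => ?_, fun x k => k.elim0, fun h _ => ?_⟩
      · rw [hD (id x), hD x, Finset.univ_eq_empty, Finset.prod_empty, mul_one]; exact hm.symm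
      · rw [hs, hs, hm]; rfl
  | n + 1, F, G, hF, hG, hF0, hG0, hm => by
      have hcons : Continuous fun p : (Fin n → ℝ) × ℝ => (Fin.cons p.2 p.1 : Fin (n + 1) → ℝ) :=
        Continuous.finCons (A := fun _ => ℝ) continuous_snd continuous_fst
      have htail : Continuous fun x : Fin (n + 1) → ℝ => (Fin.tail x : Fin n → ℝ) :=
        continuous_pi fun j => continuous_apply j.succ
      set f : (Fin n → ℝ) → ℝ → ℝ := fun x s => F (Fin.cons s x) with hf
      set g : (Fin n → ℝ) → ℝ → ℝ := fun x s => G (Fin.cons s x) with hg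
      have hfc : Continuous (Function.uncurry f) := hF.comp hcons
      have hgc : Continuous (Function.uncurry g) := hG.comp hcons
      have hfx : ∀ x, Continuous (f x) := fun x => hfc.uncurry_left x
      have hgx : ∀ x, Continuous (g x) := fun x => hgc.uncurry_left x
      -- The marginals in the last n coordinates are transported by induction; on each fibre the
      -- conditional densities are then matched by monotone rearrangement in coordinate 0.
      set F' : (Fin n → ℝ) → ℝ := fun x => ∫ s in (-M)..M, f x s with hF'
      set G' : (Fin n → ℝ) → ℝ := fun y => ∫ s in (-L)..L, g y s with hG'
      have hF'c : Continuous F' :=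
        intervalIntegral.continuous_parametric_intervalIntegral_of_continuous' hfc _ _
      have hG'c : Continuous G' :=
        intervalIntegral.continuous_parametric_intervalIntegral_of_continuous' hgc _ _
      have hF'0 : ∀ x, 0 < F' x := fun x => intervalIntegral.intervalIntegral_pos_of_pos
        ((hfx x).intervalIntegrable _ _) (fun s => hF0 _) (by linarith)
      have hG'0 : ∀ x, 0 < G' x := fun x => intervalIntegral.intervalIntegral_pos_of_pos
        ((hgx x).intervalIntegrable _ _) (fun s => hG0 _) (by linarith)
      obtain ⟨T', D', hT'c, hD'c, hT'm, hD'0, hjac, hder, htr⟩ :=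
        exists_knothe_map hM hL n F' G' hF'c hG'c hF'0 hG'0 (by
          rw [← integral_cube_cons hM.le hF, ← integral_cube_cons hL.le hG, hm])
      obtain ⟨I, hIc, hIm, hI⟩ := exists_inverse_primitive hgc (fun y t => hG0 _) hL
      -- The mass of the fibre over x up to s, rescaled so that its total becomes that of the target
      -- fibre over T' x.
      set B : (Fin n → ℝ) → ℝ → ℝ := fun x s =>
        (∫ σ in (-M)..s, f x σ) * (G' (T' x) / F' x) with hB
      have hBc : Continuous (Function.uncurry B) := by
        refine Continuous.mul ?_ ((hG'c.comp (hT'c.comp continuous_fst)).div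
          (hF'c.comp continuous_fst) (fun p => (hF'0 _).ne'))
        exact intervalIntegral.continuous_parametric_primitive_of_continuous hfc
      have hBm : ∀ x, StrictMono (B x) := fun x a b hab =>
        mul_lt_mul_of_pos_right (strictMono_primitive (hfx x) (fun s => hF0 _) (-M) hab)
          (div_pos (hG'0 _) (hF'0 _))
      have hB0 : ∀ x, B x (-M) = 0 := fun x => by simp [hB]
      have hB1 : ∀ x, B x M = G' (T' x) := fun x => by
        have := (hF'0 x).ne'
        simp only [hB]
        change F' x * _ = _
        field_simp
      set t : (Fin n → ℝ) → ℝ → ℝ := fun x s => I (T' x) (B x s) with ht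
      have htc : Continuous (Function.uncurry t) :=
        hIc.comp ((hT'c.comp continuous_fst).prodMk hBc)
      have htx : ∀ x, Continuous (t x) := fun x => htc.uncurry_left x
      have hts : ∀ x s, s ∈ Set.Icc (-M) M → ∫ τ in (-L)..(t x s), g (T' x) τ = B x s := by
        intro x s hs
        refine hI _ _ ?_ ?_
        · rw [← hB0 x]; exact (hBm x).monotone hs.1
        · rw [show ∫ t in (-L)..L, g (T' x) t = B x M from (hB1 x).symm]
          exact (hBm x).monotone hs.2
      have hginj : ∀ y, Function.Injective fun τ => ∫ s in (-L)..τ, g y s := fun y =>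
        (strictMono_primitive (hgx y) (fun s => hG0 _) (-L)).injective
      have ht0 : ∀ x, t x (-M) = -L := fun x => by
        apply hginj (T' x)
        simp only
        rw [hts x (-M) ⟨le_rfl, by linarith⟩, hB0]; simp
      have ht1 : ∀ x, t x M = L := fun x => by
        apply hginj (T' x)
        simp only
        rw [hts x M ⟨by linarith, le_rfl⟩, hB1]
      -- The value dictated by g(t) ∂t = ∂B. The formula is continuous and positive everywhere, but
      -- it is the derivative of t only inside (-M, M), because `I` is clamped.
      set d : (Fin n → ℝ) → ℝ → ℝ := fun x s =>
        f x s * (G' (T' x) / F' x) / g (T' x) (t x s) with hd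
      have hdc : Continuous (Function.uncurry d) := by
        refine Continuous.div (Continuous.mul hfc ((hG'c.comp (hT'c.comp continuous_fst)).div
          (hF'c.comp continuous_fst) (fun p => (hF'0 _).ne'))) ?_ (fun p => (hG0 _).ne')
        exact hgc.comp ((hT'c.comp continuous_fst).prodMk htc)
      have hd0 : ∀ x s, 0 < d x s := fun x s =>
        div_pos (mul_pos (hF0 _) (div_pos (hG'0 _) (hF'0 _))) (hG0 _)
      have htd : ∀ x s, s ∈ Set.Ioo (-M) M → HasDerivAt (t x) (d x s) s := by
        intro x s hs
        have hBd : HasDerivAt (B x) (f x s * (G' (T' x) / F' x)) s :=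
          (((hfx x).integral_hasStrictDerivAt (-M) s).hasDerivAt).mul_const _
        have hmem : B x s ∈ Set.Ioo 0 (∫ t in (-L)..L, g (T' x) t) := by
          refine ⟨?_, ?_⟩
          · rw [← hB0 x]; exact hBm x hs.1
          · rw [show ∫ t in (-L)..L, g (T' x) t = B x M from (hB1 x).symm]
            exact hBm x hs.2
        have hId : HasDerivAt (I (T' x)) (g (T' x) (t x s))⁻¹ (B x s) := by
          refine HasDerivAt.of_local_left_inverse (f := fun τ => ∫ r in (-L)..τ, g (T' x) r)
            (hIc.uncurry_left (T' x)).continuousAt ?_ (hG0 _).ne' ?_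
          · exact ((hgx (T' x)).integral_hasStrictDerivAt (-L) _).hasDerivAt
          · filter_upwards [isOpen_Ioo.mem_nhds hmem] with c hc
            exact hI _ _ hc.1.le hc.2.le
        have := hId.comp s hBd
        rw [← div_eq_inv_mul] at this
        exact this
      refine ⟨fun x => Fin.cons (t (Fin.tail x) (x 0)) (T' (Fin.tail x)),
        fun x => Fin.cons (d (Fin.tail x) (x 0)) (D' (Fin.tail x)), ?_, ?_, ?_, ?_, ?_, ?_, ?_⟩
      · exact (htc.comp (htail.prodMk (continuous_apply 0))).finCons (hT'c.comp htail)
      · exact (hdc.comp (htail.prodMk (continuous_apply 0))).finCons (hD'c.comp htail)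
      · intro x
        rw [mem_cube_iff]
        intro k
        refine Fin.cases ?_ (fun j => ?_) k
        · simpa using hIm _ _
        · simpa using mem_cube_iff.1 (hT'm (Fin.tail x)) j
      · intro x k
        refine Fin.cases ?_ (fun j => ?_) k
        · simpa using hd0 _ _
        · simpa using hD'0 _ _
      · intro x
        rw [Fin.prod_univ_succ]
        simp only [Fin.cons_zero, Fin.cons_succ]
        have h1 := hjac (Fin.tail x)
        have h2 : f (Fin.tail x) (x 0) = F x := by simp [hf, Fin.cons_self_tail]
        have h3 : g (T' (Fin.tail x)) (t (Fin.tail x) (x 0)) ≠ 0 := (hG0 _).ne'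
        simp only [hd, h2]
        change g (T' (Fin.tail x)) (t (Fin.tail x) (x 0)) * _ = _
        have h4 := (hF'0 (Fin.tail x)).ne'
        field_simp
        rw [mul_assoc, h1]
      · intro x k
        refine Fin.cases (fun hk => ?_) (fun j hk => ?_) k
        · simpa [Fin.tail_update_zero] using htd (Fin.tail x) (x 0) hk
        · have := hder (Fin.tail x) j hk
          simp only [Fin.tail_update_succ, Fin.cons_succ]
          exact this
      · intro h hh
        have hTc : Continuous fun x : Fin (n + 1) → ℝ =>
            (Fin.cons (t (Fin.tail x) (x 0)) (T' (Fin.tail x)) : Fin (n + 1) → ℝ) :=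
          (htc.comp (htail.prodMk (continuous_apply 0))).finCons (hT'c.comp htail)
        have hhT : Continuous fun x : Fin (n + 1) → ℝ =>
            h (Fin.cons (t (Fin.tail x) (x 0)) (T' (Fin.tail x))) * F x := (hh.comp hTc).mul hF
        have hhG : Continuous fun y => h y * G y := hh.mul hG
        rw [integral_cube_cons hL.le hhG]
        refine (integral_cube_cons hM.le hhT).trans ?_
        simp only [Fin.tail_cons, Fin.cons_zero]
        set H : (Fin n → ℝ) → ℝ := fun y => ∫ τ in (-L)..L, h (Fin.cons τ y) * g y τ with hH
        have hHc : Continuous H := by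
          refine intervalIntegral.continuous_parametric_intervalIntegral_of_continuous' ?_ _ _
          exact (hh.comp hcons).mul hgc
        -- The substitution τ = t x s turns the fibre integral over x into the one over T' x up to
        -- the factor F'/G', so the induction hypothesis is applied to H/G'.
        have hin : ∀ x, ∫ s in (-M)..M, h (Fin.cons (t x s) (T' x)) * F (Fin.cons s x) =
            H (T' x) / G' (T' x) * F' x := by
          intro x
          have hsub := intervalIntegral.integral_comp_mul_deriv'' (a := -M) (b := M) (f := t x)
            (f' := d x) (g := fun τ => h (Fin.cons τ (T' x)) * g (T' x) τ)
            (htx x).continuousOn (fun s hs => (htd x s (by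
              rwa [min_eq_left (by linarith), max_eq_right (by linarith)] at hs)).hasDerivWithinAt)
            (hdc.uncurry_left x).continuousOn
            ((hh.comp (hcons.comp (continuous_const.prodMk continuous_id))).mul
              (hgx _)).continuousOn
          rw [ht0, ht1] at hsub
          change _ = H (T' x) at hsub
          rw [← hsub, div_mul_eq_mul_div, mul_div_assoc, ← intervalIntegral.integral_mul_const]
          refine intervalIntegral.integral_congr fun s _ => ?_
          have h3 : g (T' x) (t x s) ≠ 0 := (hG0 _).ne'
          have h4 := (hF'0 x).ne'
          have h5 := (hG'0 (T' x)).ne'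
          simp only [Function.comp, hd]
          field_simp
          rfl
        simp only [hin]
        rw [htr (fun y => H y / G' y) (hHc.div hG'c fun y => (hG'0 y).ne')]
        refine setIntegral_congr_fun (measurableSet_cube n L) fun y _ => ?_
        rw [div_mul_cancel₀ _ (hG'0 y).ne']

/-! ### The dual Sobolev inequality on cubes -/

lemma continuous_insertNth {m : ℕ} (k : Fin (m + 1)) (x : Fin m → ℝ) :
    Continuous fun s : ℝ => (k.insertNth s x : Fin (m + 1) → ℝ) :=
  Continuous.finInsertNth (A := fun _ => ℝ) k continuous_id continuous_const

lemma volume_real_cube (m : ℕ) {M : ℝ} (hM : 0 ≤ M) : volume.real (cube m M) = (2 * M) ^ m := by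
  rw [cube, measureReal_def, Real.volume_Icc_pi_toReal (fun _ => by linarith)]
  simp only [Finset.prod_const, Finset.card_univ, Fintype.card_fin]
  ring_nf

lemma Continuous.integrableOn_cube {m : ℕ} {M : ℝ} {f : (Fin m → ℝ) → ℝ} (hf : Continuous f) :
    IntegrableOn f (cube m M) := hf.integrableOn_Icc

/-- Integration by parts on a cube in the coordinate `k`, for a function `φ` that is constant on
the two faces orthogonal to `k`, against a bounded function. -/
lemma integral_cube_mul_deriv_le {m : ℕ} {M L c : ℝ} (hM : 0 < M) (hc : 0 ≤ c)
    (k : Fin (m + 1)) {φ φ' T D : (Fin (m + 1) → ℝ) → ℝ} (hφ : Continuous φ) (hφ' : Continuous φ')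
    (hT : Continuous T) (hD : Continuous D) (hTL : ∀ x, |T x| ≤ L)
    (hdφ : ∀ x, HasDerivAt (fun s => φ (Function.update x k s)) (φ' x) (x k))
    (hdT : ∀ x, x k ∈ Set.Ioo (-M) M →
      HasDerivAt (fun s => T (Function.update x k s)) (D x) (x k))
    (hb : ∀ x, x k = M ∨ x k = -M → φ x = c) :
    ∫ x in cube (m + 1) M, φ x * D x ≤
      c * (2 * L) * (2 * M) ^ m - ∫ x in cube (m + 1) M, φ' x * T x := by
  have hφD : Continuous fun x => φ x * D x := hφ.mul hD
  have hφT : Continuous fun x => φ' x * T x := hφ'.mul hT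
  have hφs : Continuous fun x => φ' x * T x + φ x * D x := hφT.add hφD
  have hins : Continuous fun z : (Fin m → ℝ) × ℝ => (k.insertNth z.2 z.1 : Fin (m + 1) → ℝ) :=
    Continuous.finInsertNth (A := fun _ => ℝ) k continuous_snd continuous_fst
  have hsum : ∫ x in cube (m + 1) M, (φ' x * T x + φ x * D x) ≤ c * (2 * L) * (2 * M) ^ m := by
    rw [integral_cube_succ hM.le k hφs]
    have hin : ∀ x : Fin m → ℝ, ∫ s in (-M)..M, (φ' (k.insertNth s x) * T (k.insertNth s x) +
        φ (k.insertNth s x) * D (k.insertNth s x)) ≤ c * (2 * L) := by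
      intro x
      have hI := continuous_insertNth k x
      have := intervalIntegral.integral_eq_sub_of_hasDerivAt_of_le (a := -M) (b := M)
        (f := fun s => φ (k.insertNth s x) * T (k.insertNth s x))
        (f' := fun s => φ' (k.insertNth s x) * T (k.insertNth s x) +
          φ (k.insertNth s x) * D (k.insertNth s x)) (by linarith)
        ((hφ.comp hI).mul (hT.comp hI)).continuousOn (fun s hs => by
          have h1 := hdφ (k.insertNth s x)
          have h2 := hdT (k.insertNth s x) (by simpa using hs)
          simp only [Fin.update_insertNth, Fin.insertNth_apply_same] at h1 h2
          exact h1.mul h2)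
        ((hφs.comp hI).intervalIntegrable _ _)
      -- As φ has the same value c on both faces, only the difference of the values of T enters, and
      -- it is at most 2L.
      rw [this, hb _ (Or.inl (by simp)), hb _ (Or.inr (by simp)), ← mul_sub]
      refine mul_le_mul_of_nonneg_left ?_ hc
      have h1 := (abs_le.1 (hTL (k.insertNth M x))).2
      have h2 := (abs_le.1 (hTL (k.insertNth (-M) x))).1
      linarith
    calc _ ≤ ∫ x in cube m M, c * (2 * L) := by
          refine setIntegral_mono (Continuous.integrableOn_cube ?_)
            continuous_const.integrableOn_cube hin
          exact intervalIntegral.continuous_parametric_intervalIntegral_of_continuous'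
            (f := fun x s => φ' (k.insertNth s x) * T (k.insertNth s x) +
              φ (k.insertNth s x) * D (k.insertNth s x)) (hφs.comp hins) _ _
      _ = _ := by
          rw [setIntegral_const, volume_real_cube m hM.le, smul_eq_mul]; ring
  rw [integral_add hφT.integrableOn_cube hφD.integrableOn_cube] at hsum
  linarith

/-- The inequality between the geometric and the arithmetic mean for the Jacobian of a triangular
map that transports `F` to `G`. -/
lemma rpow_transport_le {m : ℕ} {F G : ℝ} (hF : 0 < F) (hG : 0 < G) {D : Fin (m + 1) → ℝ}
    (hD : ∀ k, 0 < D k) (h : G * ∏ k, D k = F) :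
    ((m : ℝ) + 1) * (G ^ (-(1 / ((m : ℝ) + 1))) * F) ≤
      F ^ (1 - 1 / ((m : ℝ) + 1)) * ∑ k, D k := by
  have hn : (0 : ℝ) < (m : ℝ) + 1 := by positivity
  have hprod : 0 < ∏ k, D k := Finset.prod_pos fun k _ => hD k
  have ham := Real.geom_mean_le_arith_mean_weighted Finset.univ (fun _ => 1 / ((m : ℝ) + 1)) D
    (fun _ _ => by positivity) (by simp; field_simp) (fun k _ => (hD k).le)
  rw [Real.finsetProd_rpow _ _ (fun k _ => (hD k).le), ← Finset.mul_sum] at ham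
  -- Substituting G = F/∏D isolates the geometric mean of the D k.
  have hGe : G ^ (-(1 / ((m : ℝ) + 1))) * F =
      F ^ (1 - 1 / ((m : ℝ) + 1)) * (∏ k, D k) ^ (1 / ((m : ℝ) + 1)) := by
    have hGq : G = F / ∏ k, D k := by rw [← h]; field_simp
    rw [hGq, Real.div_rpow hF.le hprod.le, Real.rpow_neg hprod.le, sub_eq_add_neg,
      Real.rpow_add hF, Real.rpow_one]
    field_simp
  rw [hGe]
  have h0 : 0 ≤ F ^ (1 - 1 / ((m : ℝ) + 1)) := by positivity
  calc _ = F ^ (1 - 1 / ((m : ℝ) + 1)) *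
        (((m : ℝ) + 1) * (∏ k, D k) ^ (1 / ((m : ℝ) + 1))) := by ring
    _ ≤ F ^ (1 - 1 / ((m : ℝ) + 1)) *
        (((m : ℝ) + 1) * (1 / ((m : ℝ) + 1) * ∑ k, D k)) := by gcongr
    _ = _ := by field_simp

/-- The derivative of `(|f|^p + ε)^{1-1/n}` along a line, `p = 2n/(n-2)`, with the bound that
results from it, `n = m + 1`. -/
lemma hasDerivAt_rpow_density {m : ℕ} (hm : 2 ≤ m) {ε : ℝ} (hε : 0 < ε) {f : ℝ → ℝ} {f' s : ℝ}
    (hf : HasDerivAt f f' s) :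
    HasDerivAt (fun s => (|f s| ^ (2 * ((m : ℝ) + 1) / ((m : ℝ) - 1)) + ε) ^
      (1 - 1 / ((m : ℝ) + 1)))
      ((1 - 1 / ((m : ℝ) + 1)) * (|f s| ^ (2 * ((m : ℝ) + 1) / ((m : ℝ) - 1)) + ε) ^
        (-(1 / ((m : ℝ) + 1))) * ((2 * ((m : ℝ) + 1) / ((m : ℝ) - 1)) *
          |f s| ^ (2 * ((m : ℝ) + 1) / ((m : ℝ) - 1) - 2) * f s * f')) s := by
  have hm' : (2 : ℝ) ≤ m := by exact_mod_cast hm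
  have hp : 1 < 2 * ((m : ℝ) + 1) / ((m : ℝ) - 1) := by
    rw [lt_div_iff₀ (by linarith)]; linarith
  have h1 := ((hasDerivAt_abs_rpow (f s) hp).comp s hf).add_const ε
  have h2 := h1.rpow_const (p := 1 - 1 / ((m : ℝ) + 1)) (Or.inl (by
    have : 0 ≤ |f s| ^ (2 * ((m : ℝ) + 1) / ((m : ℝ) - 1)) := by positivity
    simp only [Function.comp]
    linarith))
  refine h2.congr_deriv ?_
  simp only [Function.comp]
  rw [show 1 - 1 / ((m : ℝ) + 1) - 1 = -(1 / ((m : ℝ) + 1)) by ring]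
  ring

/-- The exponents balance: with F = |v|^p + ε and n = m + 1, |v|^{p-1} ≤ F^{(p-1)/p} and (p-1)/p -
1/n = 1/2. The resulting √F is what pairs with √F |T| in Young's inequality. -/
lemma abs_rpow_density_deriv_le {m : ℕ} (hm : 2 ≤ m) {ε : ℝ} (hε : 0 < ε) (v v' : ℝ) :
    |(1 - 1 / ((m : ℝ) + 1)) * (|v| ^ (2 * ((m : ℝ) + 1) / ((m : ℝ) - 1)) + ε) ^
        (-(1 / ((m : ℝ) + 1))) * ((2 * ((m : ℝ) + 1) / ((m : ℝ) - 1)) *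
          |v| ^ (2 * ((m : ℝ) + 1) / ((m : ℝ) - 1) - 2) * v * v')| ≤
      2 * m / ((m : ℝ) - 1) *
        (√(|v| ^ (2 * ((m : ℝ) + 1) / ((m : ℝ) - 1)) + ε) * |v'|) := by
  have hm' : (2 : ℝ) ≤ m := by exact_mod_cast hm
  have hm1 : (0 : ℝ) < (m : ℝ) - 1 := by linarith
  have hm2 : (0 : ℝ) < (m : ℝ) + 1 := by linarith
  set p : ℝ := 2 * ((m : ℝ) + 1) / ((m : ℝ) - 1) with hp
  have hp2 : 2 < p := by rw [hp, lt_div_iff₀ hm1]; linarith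
  set F : ℝ := |v| ^ p + ε with hF
  have hF0 : 0 < F := by positivity
  have hc : (1 - 1 / ((m : ℝ) + 1)) * p = 2 * m / ((m : ℝ) - 1) := by rw [hp]; field_simp; ring
  have hc0 : 0 ≤ 2 * m / ((m : ℝ) - 1) := by positivity
  have hv : |v| ^ (p - 2) * |v| ≤ F ^ ((p - 1) / p) := by
    have h1 : |v| ^ (p - 2) * |v| = (|v| ^ p) ^ ((p - 1) / p) := by
      rw [← Real.rpow_mul (abs_nonneg v), mul_div_cancel₀ _ (by linarith : p ≠ 0)]
      rcases eq_or_lt_of_le (abs_nonneg v) with h | h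
      · rw [← h, Real.zero_rpow (by linarith), Real.zero_rpow (by linarith)]; simp
      · rw [show p - 1 = (p - 2) + 1 by ring, Real.rpow_add h, Real.rpow_one]
    rw [h1]
    refine Real.rpow_le_rpow (by positivity) (by rw [hF]; linarith) ?_
    exact div_nonneg (by linarith) (by linarith)
  have hsq : F ^ (-(1 / ((m : ℝ) + 1))) * F ^ ((p - 1) / p) = √F := by
    rw [← Real.rpow_add hF0, Real.sqrt_eq_rpow]
    congr 1
    rw [hp]; field_simp; ring
  calc _ = 2 * m / ((m : ℝ) - 1) * (F ^ (-(1 / ((m : ℝ) + 1))) * (|v| ^ (p - 2) * |v|) * |v'|) := by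
        rw [show (1 - 1 / ((m : ℝ) + 1)) * F ^ (-(1 / ((m : ℝ) + 1))) * (p * |v| ^ (p - 2) * v * v')
          = 2 * m / ((m : ℝ) - 1) * (F ^ (-(1 / ((m : ℝ) + 1))) * (|v| ^ (p - 2) * v) * v') by
            rw [← hc]; ring]
        simp only [abs_mul, abs_of_nonneg hc0, abs_of_pos (Real.rpow_pos_of_pos hF0 _),
          abs_of_nonneg (Real.rpow_nonneg (abs_nonneg v) _)]
    _ ≤ 2 * m / ((m : ℝ) - 1) * (F ^ (-(1 / ((m : ℝ) + 1))) * F ^ ((p - 1) / p) * |v'|) := by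
        gcongr
    _ = _ := by rw [hsq]

/-- The Sobolev inequality on cubes in its dual form, obtained from the Knothe map. -/
theorem sobolev_cube_dual {m : ℕ} (hm : 2 ≤ m) {M L ε θ : ℝ} (hM : 0 < M) (hL : 0 < L)
    (hε : 0 < ε) (hθ : 0 < θ) {f : (Fin (m + 1) → ℝ) → ℝ}
    {f' : Fin (m + 1) → (Fin (m + 1) → ℝ) → ℝ} (hf : Continuous f) (hf' : ∀ k, Continuous (f' k))
    (hd : ∀ k x, HasDerivAt (fun s => f (Function.update x k s)) (f' k x) (x k))
    (hb : ∀ k x, x k = M ∨ x k = -M → f x = 0)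
    {G : (Fin (m + 1) → ℝ) → ℝ} (hG : Continuous G) (hG0 : ∀ y, 0 < G y)
    (hmass : ∫ x in cube (m + 1) M, (|f x| ^ (2 * ((m : ℝ) + 1) / ((m : ℝ) - 1)) + ε) =
      ∫ y in cube (m + 1) L, G y) :
    ((m : ℝ) + 1) * ∫ y in cube (m + 1) L, G y ^ (1 - 1 / ((m : ℝ) + 1)) ≤
      ((m : ℝ) + 1) * (ε ^ (1 - 1 / ((m : ℝ) + 1)) * (2 * L) * (2 * M) ^ m) +
      m / ((m : ℝ) - 1) * (θ * (∫ x in cube (m + 1) M, ∑ k, f' k x ^ 2) +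
        θ⁻¹ * ∫ y in cube (m + 1) L, (∑ k, y k ^ 2) * G y) := by
  have hm' : (2 : ℝ) ≤ m := by exact_mod_cast hm
  have hm1 : (0 : ℝ) < (m : ℝ) - 1 := by linarith
  have hm2 : (0 : ℝ) < (m : ℝ) + 1 := by linarith
  set p : ℝ := 2 * ((m : ℝ) + 1) / ((m : ℝ) - 1) with hp
  have hp2 : 2 < p := by rw [hp, lt_div_iff₀ hm1]; linarith
  set q : ℝ := 1 - 1 / ((m : ℝ) + 1) with hq
  set F : (Fin (m + 1) → ℝ) → ℝ := fun x => |f x| ^ p + ε with hF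
  have hFc : Continuous F := (hf.abs.rpow_const fun _ => Or.inr (by linarith)).add continuous_const
  have hF0 : ∀ x, 0 < F x := fun x => by simp only [hF]; positivity
  obtain ⟨T, D, hT, hD, hTm, hD0, hjac, hder, htr⟩ :=
    exists_knothe_map hM hL (m + 1) F G hFc hG hF0 hG0 hmass
  set φ : (Fin (m + 1) → ℝ) → ℝ := fun x => F x ^ q with hφ
  have hφc : Continuous φ := hFc.rpow_const fun x => Or.inl (hF0 x).ne'
  set φ' : Fin (m + 1) → (Fin (m + 1) → ℝ) → ℝ := fun k x =>
    q * F x ^ (-(1 / ((m : ℝ) + 1))) * (p * |f x| ^ (p - 2) * f x * f' k x) with hφ'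
  have hφ'c : ∀ k, Continuous (φ' k) := fun k => by
    refine (continuous_const.mul (hFc.rpow_const fun x => Or.inl (hF0 x).ne')).mul
      (((continuous_const.mul (hf.abs.rpow_const fun _ => Or.inr (by linarith))).mul hf).mul
        (hf' k))
  have hTk : ∀ k, Continuous fun x => T x k := fun k => (continuous_apply k).comp hT
  have hDk : ∀ k, Continuous fun x => D x k := fun k => (continuous_apply k).comp hD
  have hdφ : ∀ k x, HasDerivAt (fun s => φ (Function.update x k s)) (φ' k x) (x k) := by
    intro k x
    have := hasDerivAt_rpow_density hm hε (hd k x)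
    rw [Function.update_eq_self] at this
    exact this
  -- The shift by ε keeps F positive, as the Knothe map requires. Since f vanishes on the faces, φ
  -- equals ε^q there.
  have hparts : ∀ k, ∫ x in cube (m + 1) M, φ x * D x k ≤
      ε ^ q * (2 * L) * (2 * M) ^ m - ∫ x in cube (m + 1) M, φ' k x * T x k := by
    intro k
    refine integral_cube_mul_deriv_le hM (by positivity) k hφc (hφ'c k) (hTk k) (hDk k)
      (fun x => abs_le.2 (mem_cube_iff.1 (hTm x) k)) (hdφ k) (fun x hx => hder x k hx) ?_
    intro x hx
    simp only [hφ, hF, hb k x hx, abs_zero]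
    rw [Real.zero_rpow (by linarith), zero_add]
  -- Young's inequality for |∂ₖf| against √F |Tₖ|, with a weight θ left free for a later
  -- optimisation.
  have hyoung : ∀ x, -∑ k, φ' k x * T x k ≤
      m / ((m : ℝ) - 1) * (θ * (∑ k, f' k x ^ 2) + θ⁻¹ * ((∑ k, T x k ^ 2) * F x)) := by
    intro x
    rw [← Finset.sum_neg_distrib, Finset.mul_sum, Finset.sum_mul, Finset.mul_sum,
      ← Finset.sum_add_distrib, Finset.mul_sum]
    refine Finset.sum_le_sum fun k _ => ?_
    have h1 := abs_rpow_density_deriv_le hm hε (f x) (f' k x)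
    have h2 : -(φ' k x * T x k) ≤ |φ' k x| * |T x k| := by
      rw [← abs_mul]; exact neg_le_abs _
    have hs : √(F x) ^ 2 = F x := Real.sq_sqrt (hF0 x).le
    have h3 : 2 * (|f' k x| * (√(F x) * |T x k|)) ≤
        θ * f' k x ^ 2 + θ⁻¹ * (T x k ^ 2 * F x) := by
      rw [← sq_abs (f' k x), ← sq_abs (T x k)]
      have h4 : 0 ≤ θ⁻¹ * (θ * |f' k x| - √(F x) * |T x k|) ^ 2 := by positivity
      have h5 : θ⁻¹ * (θ * |f' k x| - √(F x) * |T x k|) ^ 2 =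
          θ * |f' k x| ^ 2 - 2 * (|f' k x| * (√(F x) * |T x k|)) +
            θ⁻¹ * (|T x k| ^ 2 * √(F x) ^ 2) := by field_simp; ring
      rw [hs] at h5
      linarith
    calc _ ≤ |φ' k x| * |T x k| := h2
      _ ≤ 2 * m / ((m : ℝ) - 1) * (√(F x) * |f' k x|) * |T x k| := by gcongr
      _ = m / ((m : ℝ) - 1) * (2 * (|f' k x| * (√(F x) * |T x k|))) := by ring
      _ ≤ _ := by gcongr
  -- The transport formula for the test function G^{-1/n}, with n = m + 1.
  have hGq : ∫ y in cube (m + 1) L, G y ^ q =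
      ∫ x in cube (m + 1) M, G (T x) ^ (-(1 / ((m : ℝ) + 1))) * F x := by
    rw [htr (fun y => G y ^ (-(1 / ((m : ℝ) + 1)))) (hG.rpow_const fun y => Or.inl (hG0 y).ne')]
    refine setIntegral_congr_fun (measurableSet_cube _ L) fun y _ => ?_
    simp only [hq]
    rw [sub_eq_add_neg, Real.rpow_add (hG0 y), Real.rpow_one, mul_comm]
  have hsq : ∫ y in cube (m + 1) L, (∑ k, y k ^ 2) * G y =
      ∫ x in cube (m + 1) M, (∑ k, T x k ^ 2) * F x :=
    (htr (fun y => ∑ k, y k ^ 2) (by fun_prop)).symm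
  have hφT : ∀ k, Continuous fun x => φ' k x * T x k := fun k => (hφ'c k).mul (hTk k)
  have hφD : ∀ k, Continuous fun x => φ x * D x k := fun k => hφc.mul (hDk k)
  have hc1 : Continuous fun x => G (T x) ^ (-(1 / ((m : ℝ) + 1))) * F x :=
    ((hG.comp hT).rpow_const fun y => Or.inl (hG0 _).ne').mul hFc
  have hc2 : Continuous fun x => φ x * ∑ k, D x k :=
    hφc.mul (continuous_finsetSum _ fun k _ => hDk k)
  have hc3 : Continuous fun x => -∑ k, φ' k x * T x k :=
    (continuous_finsetSum _ fun k _ => (hφ'c k).mul (hTk k)).neg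
  have hc4 : Continuous fun x => ∑ k, f' k x ^ 2 :=
    continuous_finsetSum _ fun k _ => (hf' k).pow 2
  have hc5 : Continuous fun x => (∑ k, T x k ^ 2) * F x :=
    (continuous_finsetSum _ fun k _ => (hTk k).pow 2).mul hFc
  have hc4' : Continuous fun x => θ * ∑ k, f' k x ^ 2 := continuous_const.mul hc4
  have hc5' : Continuous fun x => θ⁻¹ * ((∑ k, T x k ^ 2) * F x) := continuous_const.mul hc5
  have hc6 : Continuous fun x =>
      m / ((m : ℝ) - 1) * (θ * (∑ k, f' k x ^ 2) + θ⁻¹ * ((∑ k, T x k ^ 2) * F x)) :=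
    continuous_const.mul (hc4'.add hc5')
  rw [hGq, hsq, ← integral_const_mul]
  calc _ ≤ ∫ x in cube (m + 1) M, φ x * ∑ k, D x k := by
        refine setIntegral_mono (continuous_const.mul hc1).integrableOn_cube
          hc2.integrableOn_cube fun x => ?_
        exact rpow_transport_le (hF0 x) (hG0 _) (hD0 x) (hjac x)
    _ = ∑ k, ∫ x in cube (m + 1) M, φ x * D x k := by
        simp_rw [Finset.mul_sum]
        exact integral_finsetSum _ fun k _ => (hφD k).integrableOn_cube
    _ ≤ ∑ k : Fin (m + 1), (ε ^ q * (2 * L) * (2 * M) ^ m -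
          ∫ x in cube (m + 1) M, φ' k x * T x k) := Finset.sum_le_sum fun k _ => hparts k
    _ = ((m : ℝ) + 1) * (ε ^ q * (2 * L) * (2 * M) ^ m) +
          ∫ x in cube (m + 1) M, -∑ k, φ' k x * T x k := by
        rw [Finset.sum_sub_distrib, integral_neg,
          integral_finsetSum _ fun k _ => (hφT k).integrableOn_cube]
        simp only [Finset.sum_const, Finset.card_univ, Fintype.card_fin, nsmul_eq_mul]
        push_cast
        ring
    _ ≤ ((m : ℝ) + 1) * (ε ^ q * (2 * L) * (2 * M) ^ m) + ∫ x in cube (m + 1) M,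
          m / ((m : ℝ) - 1) * (θ * (∑ k, f' k x ^ 2) + θ⁻¹ * ((∑ k, T x k ^ 2) * F x)) := by
        refine add_le_add le_rfl ?_
        exact setIntegral_mono hc3.integrableOn_cube hc6.integrableOn_cube hyoung
    _ = _ := by
        rw [integral_const_mul, integral_add hc4'.integrableOn_cube hc5'.integrableOn_cube, integral_const_mul, integral_const_mul]

/-! ### Integrals of the Talenti function -/

section TalentiIntegrals

variable {N : ℕ}

lemma integrable_one_add_norm_sq_rpow {q : ℝ} (hq : (N : ℝ) < 2 * q) :
    Integrable fun y : Euc N => (1 + ‖y‖ ^ 2) ^ (-q) := by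
  have := integrable_rpow_neg_one_add_norm_sq (E := Euc N) (μ := volume) (r := 2 * q)
    (by simpa using hq)
  simpa [neg_div] using this

/-- Γ(q) b^{-q} is the integral of t^{q-1} e^{-bt}. With b = 1 + |y|², Fubini leaves a Gaussian
integral in y and then another Gamma integral in t. -/
theorem integral_one_add_norm_sq_rpow {q : ℝ} (hq0 : 0 < q) (hq : (N : ℝ) < 2 * q) :
    ∫ y : Euc N, (1 + ‖y‖ ^ 2) ^ (-q) =
      Real.pi ^ ((N : ℝ) / 2) * Real.Gamma (q - N / 2) / Real.Gamma q := by
  have hΓ : 0 < Real.Gamma q := Real.Gamma_pos_of_pos hq0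
  set k : Euc N → ℝ → ℝ := fun y t => t ^ (q - 1) * Real.exp (-((1 + ‖y‖ ^ 2) * t)) with hk
  have hkint : ∀ y, ∫ t in Set.Ioi (0 : ℝ), k y t = Real.Gamma q * (1 + ‖y‖ ^ 2) ^ (-q) := by
    intro y
    have hy : 0 < 1 + ‖y‖ ^ 2 := by positivity
    rw [Real.integral_rpow_mul_exp_neg_mul_Ioi hq0 hy, one_div, Real.inv_rpow hy.le,
      Real.rpow_neg hy.le]
    ring
  -- A non-integrable function would have integral 0 by default, whereas the value just found is
  -- positive.
  have hkI : ∀ y, IntegrableOn (k y) (Set.Ioi 0) := fun y => by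
    by_contra h
    have h0 := hkint y
    rw [integral_undef h] at h0
    have hy : 0 < 1 + ‖y‖ ^ 2 := by positivity
    exact (mul_pos hΓ (Real.rpow_pos_of_pos hy (-q))).ne h0
  have hprod : Integrable (Function.uncurry k)
      ((volume : Measure (Euc N)).prod (volume.restrict (Set.Ioi (0 : ℝ)))) := by
    have hmeas : Measurable (Function.uncurry k) := by
      simp only [hk, Function.uncurry_def]
      fun_prop
    rw [integrable_prod_iff hmeas.aestronglyMeasurable]
    refine ⟨Eventually.of_forall fun y => hkI y, ?_⟩
    have : (fun y : Euc N => ∫ t in Set.Ioi (0 : ℝ), ‖Function.uncurry k (y, t)‖) =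
        fun y => Real.Gamma q * (1 + ‖y‖ ^ 2) ^ (-q) := by
      ext y
      rw [← hkint y]
      refine setIntegral_congr_fun measurableSet_Ioi fun t ht => ?_
      have ht' : (0 : ℝ) < t := ht
      exact Real.norm_of_nonneg (by simp only [hk, Function.uncurry]; positivity)
    rw [this]
    exact (integrable_one_add_norm_sq_rpow hq).const_mul _
  have hswap := integral_integral_swap hprod
  simp only [hkint] at hswap
  rw [integral_const_mul] at hswap
  have hinner : ∀ t ∈ Set.Ioi (0 : ℝ), ∫ y : Euc N, k y t =
      Real.pi ^ ((N : ℝ) / 2) * (t ^ ((q - N / 2) - 1) * Real.exp (-(1 * t))) := by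
    intro t ht
    have ht' : (0 : ℝ) < t := ht
    have h1 : ∀ y : Euc N, k y t = t ^ (q - 1) * Real.exp (-t) * Real.exp (-t * ‖y‖ ^ 2) := by
      intro y
      rw [mul_assoc, ← Real.exp_add]
      simp only [hk]
      ring_nf
    simp only [h1]
    rw [integral_const_mul, GaussianFourier.integral_rexp_neg_mul_sq_norm ht',
      finrank_euclideanSpace_fin, Real.div_rpow Real.pi_pos.le ht'.le,
      show q - (N : ℝ) / 2 - 1 = (q - 1) - N / 2 by ring, Real.rpow_sub ht' (q - 1) (N / 2), one_mul]
    ring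
  rw [setIntegral_congr_fun measurableSet_Ioi hinner, integral_const_mul,
    Real.integral_rpow_mul_exp_neg_mul_Ioi (by linarith) one_pos] at hswap
  rw [eq_div_iff hΓ.ne', mul_comm, hswap]
  simp

/-- The `L^{2N/(N-2)}` integral of the Talenti function `(1 + |y|²)^{-(N-2)/2}`. -/
noncomputable def talentiMass (N : ℕ) : ℝ := ∫ y : Euc N, (1 + ‖y‖ ^ 2) ^ (-(N : ℝ))

lemma talentiMass_eq (hN : 3 ≤ N) :
    talentiMass N = Real.pi ^ ((N : ℝ) / 2) * Real.Gamma ((N : ℝ) / 2) / Real.Gamma N := by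
  have hN' : (3 : ℝ) ≤ N := by exact_mod_cast hN
  rw [talentiMass, integral_one_add_norm_sq_rpow (by linarith) (by linarith)]
  congr 3
  ring

lemma talentiMass_pos (hN : 3 ≤ N) : 0 < talentiMass N := by
  have hN' : (3 : ℝ) ≤ N := by exact_mod_cast hN
  rw [talentiMass_eq hN]
  have h1 := Real.Gamma_pos_of_pos (show (0 : ℝ) < N / 2 by linarith)
  have h2 := Real.Gamma_pos_of_pos (show (0 : ℝ) < N by linarith)
  have := Real.pi_pos
  positivity

lemma integral_one_add_norm_sq_rpow_sub_one (hN : 3 ≤ N) :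
    ∫ y : Euc N, (1 + ‖y‖ ^ 2) ^ (-((N : ℝ) - 1)) =
      2 * ((N : ℝ) - 1) / ((N : ℝ) - 2) * talentiMass N := by
  have hN' : (3 : ℝ) ≤ N := by exact_mod_cast hN
  rw [talentiMass_eq hN, integral_one_add_norm_sq_rpow (by linarith) (by linarith)]
  have h1 : Real.Gamma ((N : ℝ) / 2) = ((N : ℝ) / 2 - 1) * Real.Gamma ((N : ℝ) / 2 - 1) := by
    rw [← Real.Gamma_add_one (by linarith)]; congr 1; ring
  have h2 : Real.Gamma (N : ℝ) = ((N : ℝ) - 1) * Real.Gamma ((N : ℝ) - 1) := by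
    rw [← Real.Gamma_add_one (by linarith)]; congr 1; ring
  have h3 := Real.Gamma_pos_of_pos (show (0 : ℝ) < N - 1 by linarith)
  have h4 : (N : ℝ) - 1 ≠ 0 := by linarith
  have h5 : (N : ℝ) - 2 ≠ 0 := by linarith
  rw [h1, h2, show (N : ℝ) - 1 - N / 2 = N / 2 - 1 by ring]
  field_simp

lemma norm_sq_mul_talenti_eq (y : Euc N) : ‖y‖ ^ 2 * (1 + ‖y‖ ^ 2) ^ (-(N : ℝ)) =
    (1 + ‖y‖ ^ 2) ^ (-((N : ℝ) - 1)) - (1 + ‖y‖ ^ 2) ^ (-(N : ℝ)) := by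
  have hy : 0 < 1 + ‖y‖ ^ 2 := by positivity
  rw [show -((N : ℝ) - 1) = 1 + -(N : ℝ) by ring, Real.rpow_add hy, Real.rpow_one]
  ring

lemma integrable_norm_sq_mul_talenti (hN : 3 ≤ N) :
    Integrable fun y : Euc N => ‖y‖ ^ 2 * (1 + ‖y‖ ^ 2) ^ (-(N : ℝ)) := by
  have hN' : (3 : ℝ) ≤ N := by exact_mod_cast hN
  simp only [norm_sq_mul_talenti_eq]
  exact (integrable_one_add_norm_sq_rpow (by linarith)).sub
    (integrable_one_add_norm_sq_rpow (by linarith))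

lemma integral_norm_sq_mul_talenti (hN : 3 ≤ N) :
    ∫ y : Euc N, ‖y‖ ^ 2 * (1 + ‖y‖ ^ 2) ^ (-(N : ℝ)) =
      (N : ℝ) / ((N : ℝ) - 2) * talentiMass N := by
  have hN' : (3 : ℝ) ≤ N := by exact_mod_cast hN
  simp only [norm_sq_mul_talenti_eq]
  rw [integral_sub (integrable_one_add_norm_sq_rpow (by linarith))
    (integrable_one_add_norm_sq_rpow (by linarith)), integral_one_add_norm_sq_rpow_sub_one hN,
    ← talentiMass]
  have h5 : (N : ℝ) - 2 ≠ 0 := by linarith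
  field_simp
  ring

/-- Legendre's duplication formula gives |𝕊_N| = 2^N `talentiMass N`, and (2^N)^{2/N} = 4 absorbs
the factor 1/4. -/
lemma sobolevConst_eq (hN : 3 ≤ N) :
    sobolevConst N = (N : ℝ) * ((N : ℝ) - 2) * talentiMass N ^ (2 / (N : ℝ)) := by
  have hN' : (3 : ℝ) ≤ N := by exact_mod_cast hN
  have hN0 : (N : ℝ) ≠ 0 := by linarith
  have hdup := Real.Gamma_mul_Gamma_add_half ((N : ℝ) / 2)
  have g1 := Real.Gamma_pos_of_pos (show (0 : ℝ) < N / 2 by linarith)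
  have g2 := Real.Gamma_pos_of_pos (show (0 : ℝ) < ((N : ℝ) + 1) / 2 by linarith)
  have g3 := Real.Gamma_pos_of_pos (show (0 : ℝ) < (N : ℝ) by linarith)
  rw [show (N : ℝ) / 2 + 1 / 2 = ((N : ℝ) + 1) / 2 by ring, mul_div_cancel₀ _ two_ne_zero,
    Real.rpow_sub two_pos, Real.rpow_one] at hdup
  have h2N : (0 : ℝ) < 2 ^ (N : ℝ) := by positivity
  have hA : 2 * Real.pi ^ (((N : ℝ) + 1) / 2) / Real.Gamma (((N : ℝ) + 1) / 2) =
      2 ^ (N : ℝ) * talentiMass N := by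
    rw [talentiMass_eq hN, show ((N : ℝ) + 1) / 2 = N / 2 + 1 / 2 by ring,
      Real.rpow_add Real.pi_pos, ← Real.sqrt_eq_rpow,
      show (N : ℝ) / 2 + 1 / 2 = ((N : ℝ) + 1) / 2 by ring]
    have h0 : Real.Gamma ((N : ℝ) / 2) * Real.Gamma (((N : ℝ) + 1) / 2) * 2 ^ (N : ℝ) =
        Real.Gamma N * 2 * √Real.pi := by
      rw [hdup]; field_simp
    rw [div_eq_iff g2.ne']
    field_simp
    linear_combination -h0
  rw [sobolevConst, hA, Real.mul_rpow h2N.le (talentiMass_pos hN).le, ← Real.rpow_mul two_pos.le,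
    mul_div_cancel₀ _ hN0]
  norm_num
  ring

end TalentiIntegrals

/-! ### The sharp Sobolev inequality on the whole space -/

lemma tendsto_setIntegral_cube {n : ℕ} {g : (Fin n → ℝ) → ℝ} (hg : Integrable g) :
    Tendsto (fun L : ℝ => ∫ y in cube n L, g y) atTop (𝓝 (∫ y, g y)) := by
  refine AECover.integral_tendsto_of_countably_generated (aecover_Icc ?_ ?_) hg
  · refine tendsto_atBot.2 fun b => ?_
    filter_upwards [eventually_all.2 fun i => eventually_ge_atTop (-(b i))] with L hL i
    linarith [hL i]
  · exact tendsto_atTop.2 fun b => eventually_all.2 fun i => eventually_ge_atTop (b i)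

lemma integral_toLp {N : ℕ} (g : Euc N → ℝ) :
    ∫ y : Fin N → ℝ, g (WithLp.toLp 2 y) = ∫ y, g y :=
  (PiLp.volume_preserving_toLp (Fin N)).integral_comp
    (MeasurableEquiv.toLp 2 (Fin N → ℝ)).measurableEmbedding g

lemma integrable_toLp {N : ℕ} {g : Euc N → ℝ} (hg : Integrable g) :
    Integrable fun y : Fin N → ℝ => g (WithLp.toLp 2 y) :=
  (PiLp.volume_preserving_toLp (Fin N)).integrable_comp_of_integrable hg

lemma norm_sq_dual_eq_sum {N : ℕ} (ℓ : Euc N →L[ℝ] ℝ) :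
    ‖ℓ‖ ^ 2 = ∑ k, ℓ (EuclideanSpace.single k 1) ^ 2 := by
  obtain ⟨v, rfl⟩ := (InnerProductSpace.toDual ℝ (Euc N)).surjective ℓ
  rw [LinearIsometryEquiv.norm_map, EuclideanSpace.real_norm_sq_eq]
  simp [EuclideanSpace.inner_single_right]

lemma toLp_update_eq {N : ℕ} (x : Fin N → ℝ) (k : Fin N) (s : ℝ) :
    (WithLp.toLp 2 (Function.update x k s) : Euc N) =
      WithLp.toLp 2 x + (s - x k) • EuclideanSpace.single k 1 := by
  ext j
  by_cases h : j = k
  · subst h; simp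
  · simp [h]

/-- The passage to the limit in the Sobolev inequality on cubes. -/
lemma sobolev_dual {m : ℕ} (hm : 2 ≤ m) {w : Euc (m + 1) → ℝ} (hw : ContDiff ℝ 1 w)
    (hc : HasCompactSupport w) {θ : ℝ} (hθ : 0 < θ) :
    ((m : ℝ) + 1) * ((∫ y, |w y| ^ (2 * ((m : ℝ) + 1) / ((m : ℝ) - 1))) / talentiMass (m + 1)) ^
        (1 - 1 / ((m : ℝ) + 1)) * (2 * m / ((m : ℝ) - 1) * talentiMass (m + 1)) ≤
      m / ((m : ℝ) - 1) * (θ * (∫ y, ‖fderiv ℝ w y‖ ^ 2) + θ⁻¹ *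
        ((∫ y, |w y| ^ (2 * ((m : ℝ) + 1) / ((m : ℝ) - 1))) / talentiMass (m + 1) *
          (((m : ℝ) + 1) / ((m : ℝ) - 1) * talentiMass (m + 1)))) := by
  have hm' : (2 : ℝ) ≤ m := by exact_mod_cast hm
  have hm1 : (0 : ℝ) < (m : ℝ) - 1 := by linarith
  have hm2 : (0 : ℝ) < (m : ℝ) + 1 := by linarith
  have hcast : ((m + 1 : ℕ) : ℝ) = (m : ℝ) + 1 := by push_cast; ring
  set p : ℝ := 2 * ((m : ℝ) + 1) / ((m : ℝ) - 1) with hp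
  have hp2 : 2 < p := by rw [hp, lt_div_iff₀ hm1]; linarith
  set q : ℝ := 1 - 1 / ((m : ℝ) + 1) with hq
  have hq0 : 0 < q := by
    have : 1 / ((m : ℝ) + 1) < 1 := by rw [div_lt_one hm2]; linarith
    linarith
  set f : (Fin (m + 1) → ℝ) → ℝ := fun x => w (WithLp.toLp 2 x) with hf
  set f' : Fin (m + 1) → (Fin (m + 1) → ℝ) → ℝ := fun k x =>
    fderiv ℝ w (WithLp.toLp 2 x) (EuclideanSpace.single k 1) with hf'
  have hLp : Continuous fun x : Fin (m + 1) → ℝ => (WithLp.toLp 2 x : Euc (m + 1)) :=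
    PiLp.continuous_toLp 2 _
  have hfc : Continuous f := hw.continuous.comp hLp
  have hf'c : ∀ k, Continuous (f' k) := fun k =>
    ((hw.continuous_fderiv (by norm_num)).clm_apply continuous_const).comp hLp
  have hd : ∀ k x, HasDerivAt (fun s => f (Function.update x k s)) (f' k x) (x k) := by
    intro k x
    simp only [hf, toLp_update_eq]
    have h1 : HasDerivAt (fun s : ℝ => (WithLp.toLp 2 x : Euc (m + 1)) +
        (s - x k) • EuclideanSpace.single k (1 : ℝ)) (EuclideanSpace.single k (1 : ℝ)) (x k) := by
      have := (((hasDerivAt_id (x k)).sub_const (x k)).smul_const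
        (EuclideanSpace.single k (1 : ℝ) : Euc (m + 1))).const_add (WithLp.toLp 2 x : Euc (m + 1))
      simpa using this
    have h2 : HasFDerivAt w (fderiv ℝ w (WithLp.toLp 2 x)) ((WithLp.toLp 2 x : Euc (m + 1)) +
        (x k - x k) • EuclideanSpace.single k (1 : ℝ)) := by
      simpa using (hw.differentiable (by norm_num) (WithLp.toLp 2 x)).hasFDerivAt
    exact h2.comp_hasDerivAt (x k) h1
  obtain ⟨M, hM, hMw⟩ : ∃ M : ℝ, 0 < M ∧ ∀ y : Euc (m + 1), M ≤ ‖y‖ → w y = 0 := by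
    obtain ⟨r, hr⟩ := hc.isCompact.isBounded.subset_closedBall 0
    refine ⟨max r 0 + 1, by positivity, fun y hy => ?_⟩
    by_contra h
    have h1 := hr (subset_tsupport w h)
    rw [mem_closedBall_zero_iff] at h1
    linarith [le_max_left r 0]
  have hMf : ∀ x : Fin (m + 1) → ℝ, (∃ k, M ≤ |x k|) → f x = 0 := by
    rintro x ⟨k, hk⟩
    refine hMw _ (hk.trans ?_)
    simpa using PiLp.norm_apply_le (WithLp.toLp 2 x : Euc (m + 1)) k
  have hb : ∀ k x, x k = M ∨ x k = -M → f x = 0 := by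
    intro k x hx
    refine hMf x ⟨k, ?_⟩
    rcases hx with h | h <;> rw [h] <;> simp [abs_of_pos hM]
  have hout : ∀ x, x ∉ cube (m + 1) M → ∃ k, M < |x k| := by
    intro x hx
    rw [mem_cube_iff] at hx
    push Not at hx
    obtain ⟨k, hk⟩ := hx
    refine ⟨k, ?_⟩
    by_contra h
    exact hk (abs_le.1 (not_lt.1 h))
  have hPeq : ∫ x in cube (m + 1) M, |f x| ^ p = ∫ y, |w y| ^ p := by
    rw [← integral_toLp, setIntegral_eq_integral_of_forall_compl_eq_zero]
    intro x hx
    obtain ⟨k, hk⟩ := hout x hx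
    rw [hMf x ⟨k, hk.le⟩, abs_zero, Real.zero_rpow (by linarith)]
  have hAeq : ∫ x in cube (m + 1) M, ∑ k, f' k x ^ 2 = ∫ y, ‖fderiv ℝ w y‖ ^ 2 := by
    rw [← integral_toLp]
    simp only [norm_sq_dual_eq_sum]
    rw [setIntegral_eq_integral_of_forall_compl_eq_zero]
    intro x hx
    obtain ⟨k, hk⟩ := hout x hx
    have h0 : fderiv ℝ w (WithLp.toLp 2 x) = 0 := by
      have : w =ᶠ[𝓝 (WithLp.toLp 2 x)] fun _ => 0 := by
        have hk' : M < ‖(WithLp.toLp 2 x : Euc (m + 1))‖ :=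
          hk.trans_le (by simpa using PiLp.norm_apply_le (WithLp.toLp 2 x : Euc (m + 1)) k)
        filter_upwards [continuous_norm.continuousAt.eventually_const_lt hk'] with y hy
        exact hMw y hy.le
      rw [this.fderiv_eq]; simp
    simp [hf', h0]
  set P : ℝ := ∫ y, |w y| ^ p with hP
  have hP0 : 0 ≤ P := integral_nonneg fun y => by positivity
  set A : ℝ := ∫ y, ‖fderiv ℝ w y‖ ^ 2 with hA
  set ρ : (Fin (m + 1) → ℝ) → ℝ := fun y => 1 + ∑ k, y k ^ 2 with hρ
  have hρ0 : ∀ y, 0 < ρ y := fun y => by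
    have : 0 ≤ ∑ k, y k ^ 2 := Finset.sum_nonneg fun k _ => sq_nonneg _
    simp only [hρ]; linarith
  have hρc : Continuous ρ := by simp only [hρ]; fun_prop
  have hρn : ∀ y : Fin (m + 1) → ℝ, ρ y = 1 + ‖(WithLp.toLp 2 y : Euc (m + 1))‖ ^ 2 := by
    intro y; rw [EuclideanSpace.real_norm_sq_eq]
  set g : (Fin (m + 1) → ℝ) → ℝ := fun y => ρ y ^ (-((m : ℝ) + 1)) with hg
  have hgc : Continuous g := hρc.rpow_const fun y => Or.inl (hρ0 y).ne'
  have hg0 : ∀ y, 0 < g y := fun y => Real.rpow_pos_of_pos (hρ0 y) _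
  have hgq : ∀ y, g y ^ q = ρ y ^ (-(m : ℝ)) := by
    intro y
    simp only [hg]
    rw [← Real.rpow_mul (hρ0 y).le]
    congr 1
    rw [hq]; field_simp; ring
  set J0 : ℝ → ℝ := fun L => ∫ y in cube (m + 1) L, g y with hJ0
  set J1 : ℝ → ℝ := fun L => ∫ y in cube (m + 1) L, g y ^ q with hJ1
  set J2 : ℝ → ℝ := fun L => ∫ y in cube (m + 1) L, (∑ k, y k ^ 2) * g y with hJ2
  have hJ0pos : ∀ L, 0 < L → 0 < J0 L := by
    intro L hL
    have h1 : 0 < volume (cube (m + 1) L) := by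
      have h := volume_real_cube (m + 1) hL.le
      have h' : 0 < volume.real (cube (m + 1) L) := by rw [h]; positivity
      exact (ENNReal.toReal_pos_iff.1 h').1
    rw [hJ0]
    simp only
    rw [setIntegral_pos_iff_support_of_nonneg_ae (Eventually.of_forall fun y => (hg0 y).le)
      hgc.integrableOn_cube]
    have : Function.support g = Set.univ := Set.eq_univ_of_forall fun y => (hg0 y).ne'
    rwa [this, Set.univ_inter]
  have hstep : ∀ L, 0 < L → ((m : ℝ) + 1) * ((P / J0 L) ^ q * J1 L) ≤
      m / ((m : ℝ) - 1) * (θ * A + θ⁻¹ * (P / J0 L * J2 L)) := by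
    intro L hL
    -- The target density is the Talenti density g times the factor that makes the two masses equal.
    set lam : ℝ → ℝ := fun ε => (P + ε * (2 * M) ^ (m + 1)) / J0 L with hlam
    have hε : ∀ ε : ℝ, 0 < ε → ((m : ℝ) + 1) * (lam ε ^ q * J1 L) ≤
        ((m : ℝ) + 1) * (ε ^ q * (2 * L) * (2 * M) ^ m) +
        m / ((m : ℝ) - 1) * (θ * A + θ⁻¹ * (lam ε * J2 L)) := by
      intro ε hε
      have hl : 0 < lam ε := div_pos (by positivity) (hJ0pos L hL)
      have hfp : Continuous fun x => |f x| ^ p :=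
        hfc.abs.rpow_const fun _ => Or.inr (by linarith)
      have := sobolev_cube_dual hm hM hL hε hθ hfc hf'c hd hb (G := fun y => lam ε * g y)
        (continuous_const.mul hgc) (fun y => mul_pos hl (hg0 y)) (by
          rw [integral_const_mul, integral_add hfp.integrableOn_cube
            continuous_const.integrableOn_cube, hPeq, setIntegral_const,
            volume_real_cube _ hM.le, smul_eq_mul, hlam]
          simp only
          change _ = _ / J0 L * J0 L
          rw [div_mul_cancel₀ _ (hJ0pos L hL).ne', mul_comm ε])
      rw [hAeq] at this
      have e1 : ∀ y, (lam ε * g y) ^ q = lam ε ^ q * g y ^ q := fun y =>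
        Real.mul_rpow hl.le (hg0 y).le
      have e2 : ∀ y : Fin (m + 1) → ℝ, (∑ k, y k ^ 2) * (lam ε * g y) =
          lam ε * ((∑ k, y k ^ 2) * g y) := fun y => by ring
      simp only [← hq, e1, e2] at this
      rwa [integral_const_mul, integral_const_mul] at this
    have hl0 : lam 0 = P / J0 L := by simp [hlam]
    have hlc : Continuous lam := by simp only [hlam]; fun_prop
    -- The limit ε → 0 is taken at fixed L, before L → ∞, because the boundary term is of the order
    -- ε^q L.
    have t1 : Tendsto (fun ε => ((m : ℝ) + 1) * (lam ε ^ q * J1 L)) (𝓝[>] 0)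
        (𝓝 (((m : ℝ) + 1) * ((P / J0 L) ^ q * J1 L))) := by
      rw [← hl0]
      refine ((continuous_const.mul ((hlc.rpow_const fun _ => Or.inr hq0.le).mul
        continuous_const)).tendsto 0).mono_left nhdsWithin_le_nhds
    have t2 : Tendsto (fun ε : ℝ => ((m : ℝ) + 1) * (ε ^ q * (2 * L) * (2 * M) ^ m) +
        m / ((m : ℝ) - 1) * (θ * A + θ⁻¹ * (lam ε * J2 L))) (𝓝[>] 0)
        (𝓝 (m / ((m : ℝ) - 1) * (θ * A + θ⁻¹ * (P / J0 L * J2 L)))) := by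
      have hcont : Continuous fun ε : ℝ => ((m : ℝ) + 1) * (ε ^ q * (2 * L) * (2 * M) ^ m) +
          m / ((m : ℝ) - 1) * (θ * A + θ⁻¹ * (lam ε * J2 L)) := by
        have : Continuous fun ε : ℝ => ε ^ q := continuous_id.rpow_const fun _ => Or.inr hq0.le
        fun_prop
      have h := (hcont.tendsto 0).mono_left (nhdsWithin_le_nhds (s := Set.Ioi 0))
      simpa [Real.zero_rpow hq0.ne', hl0] using h
    exact le_of_tendsto_of_tendsto t1 t2 (by
      filter_upwards [self_mem_nhdsWithin] with ε h using hε ε h)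
  have hI0 : Tendsto J0 atTop (𝓝 (talentiMass (m + 1))) := by
    have hi := integrable_one_add_norm_sq_rpow (N := m + 1) (q := (m : ℝ) + 1)
      (by rw [hcast]; linarith)
    have h := tendsto_setIntegral_cube (integrable_toLp hi)
    have hv : talentiMass (m + 1) = ∫ y : Euc (m + 1), (1 + ‖y‖ ^ 2) ^ (-((m : ℝ) + 1)) := by
      rw [talentiMass, hcast]
    rw [integral_toLp (fun y : Euc (m + 1) => (1 + ‖y‖ ^ 2) ^ (-((m : ℝ) + 1))), ← hv] at h
    simp only [← hρn] at h
    exact h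
  have hI1 : Tendsto J1 atTop (𝓝 (2 * m / ((m : ℝ) - 1) * talentiMass (m + 1))) := by
    have hi := integrable_one_add_norm_sq_rpow (N := m + 1) (q := (m : ℝ))
      (by rw [hcast]; linarith)
    have h := tendsto_setIntegral_cube (integrable_toLp hi)
    have hv := integral_one_add_norm_sq_rpow_sub_one (N := m + 1) (by omega)
    rw [hcast, show (m : ℝ) + 1 - 1 = m by ring, show (m : ℝ) + 1 - 2 = m - 1 by ring] at hv
    rw [integral_toLp (fun y : Euc (m + 1) => (1 + ‖y‖ ^ 2) ^ (-(m : ℝ))), hv] at h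
    simp only [← hρn, ← hgq] at h
    exact h
  have hI2 : Tendsto J2 atTop (𝓝 (((m : ℝ) + 1) / ((m : ℝ) - 1) * talentiMass (m + 1))) := by
    have hi := integrable_norm_sq_mul_talenti (N := m + 1) (by omega)
    have h := tendsto_setIntegral_cube (integrable_toLp hi)
    have hv := integral_norm_sq_mul_talenti (N := m + 1) (by omega)
    rw [hcast, show (m : ℝ) + 1 - 2 = m - 1 by ring] at hv
    rw [hcast, integral_toLp
      (fun y : Euc (m + 1) => ‖y‖ ^ 2 * (1 + ‖y‖ ^ 2) ^ (-((m : ℝ) + 1))), hv] at h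
    simp only [EuclideanSpace.real_norm_sq_eq] at h
    exact h
  have hT := talentiMass_pos (N := m + 1) (by omega)
  have hPJ : Tendsto (fun L => P / J0 L) atTop (𝓝 (P / talentiMass (m + 1))) :=
    tendsto_const_nhds.div hI0 hT.ne'
  have u1 := (tendsto_const_nhds (x := (m : ℝ) + 1)).mul
    ((hPJ.rpow_const (p := q) (Or.inr hq0.le)).mul hI1)
  have u2 := (tendsto_const_nhds (x := (m : ℝ) / ((m : ℝ) - 1))).mul
    ((tendsto_const_nhds (x := θ * A)).add ((tendsto_const_nhds (x := θ⁻¹)).mul (hPJ.mul hI2)))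
  have := le_of_tendsto_of_tendsto u1 u2 (by
    filter_upwards [eventually_gt_atTop 0] with L hL using hstep L hL)
  rw [mul_assoc]
  exact this

/-- The sharp Sobolev inequality. -/
theorem sobolev_inequality {N : ℕ} (hN : 3 ≤ N) {w : Euc N → ℝ} (hw : ContDiff ℝ 1 w)
    (hc : HasCompactSupport w) :
    sobolevConst N * (∫ y, |w y| ^ (2 * (N : ℝ) / ((N : ℝ) - 2))) ^ (((N : ℝ) - 2) / N) ≤
      ∫ y, ‖fderiv ℝ w y‖ ^ 2 := by
  obtain ⟨m, rfl⟩ : ∃ m, N = m + 1 := ⟨N - 1, by omega⟩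
  have hm : 2 ≤ m := by omega
  have hm' : (2 : ℝ) ≤ m := by exact_mod_cast hm
  have hm1 : (0 : ℝ) < (m : ℝ) - 1 := by linarith
  have hm2 : (0 : ℝ) < (m : ℝ) + 1 := by linarith
  have hcast : ((m + 1 : ℕ) : ℝ) = (m : ℝ) + 1 := by push_cast; ring
  have hT := talentiMass_pos hN
  rw [sobolevConst_eq hN, hcast, show (m : ℝ) + 1 - 2 = m - 1 by ring]
  have key := fun θ : ℝ => fun hθ : 0 < θ => sobolev_dual hm hw hc hθ
  set P : ℝ := ∫ y, |w y| ^ (2 * ((m : ℝ) + 1) / ((m : ℝ) - 1)) with hP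
  have hP0 : 0 ≤ P := integral_nonneg fun y => by positivity
  set A : ℝ := ∫ y, ‖fderiv ℝ w y‖ ^ 2 with hA
  have hA0 : 0 ≤ A := integral_nonneg fun y => by positivity
  set I := talentiMass (m + 1) with hI
  rcases hP0.eq_or_lt with h | hPpos
  · rw [← h, Real.zero_rpow (by positivity)]; simpa using hA0
  set lam := P / I with hlam
  have hl : 0 < lam := by positivity
  -- This θ makes the last term on the right exactly half of the left side, so what is left bounds
  -- that half by θ times the Dirichlet integral.
  have hθ : 0 < lam ^ (1 / ((m : ℝ) + 1)) / ((m : ℝ) - 1) := by positivity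
  have h1 := key _ hθ
  have hs : lam ^ (1 - 1 / ((m : ℝ) + 1)) = lam / lam ^ (1 / ((m : ℝ) + 1)) := by
    rw [Real.rpow_sub hl, Real.rpow_one]
  have hPl : P = lam * I := by rw [hlam]; field_simp
  have hexp : I ^ (2 / ((m : ℝ) + 1)) * P ^ (((m : ℝ) - 1) / ((m : ℝ) + 1)) =
      I * lam / (lam ^ (1 / ((m : ℝ) + 1)) * lam ^ (1 / ((m : ℝ) + 1))) := by
    rw [hPl, Real.mul_rpow hl.le hT.le, ← Real.rpow_add hl, eq_div_iff (by positivity),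
      show I ^ (2 / ((m : ℝ) + 1)) * (lam ^ (((m : ℝ) - 1) / ((m : ℝ) + 1)) *
        I ^ (((m : ℝ) - 1) / ((m : ℝ) + 1))) *
        lam ^ (1 / ((m : ℝ) + 1) + 1 / ((m : ℝ) + 1)) =
        (I ^ (2 / ((m : ℝ) + 1)) * I ^ (((m : ℝ) - 1) / ((m : ℝ) + 1))) *
        (lam ^ (((m : ℝ) - 1) / ((m : ℝ) + 1)) *
          lam ^ (1 / ((m : ℝ) + 1) + 1 / ((m : ℝ) + 1))) by ring,
      ← Real.rpow_add hl, ← Real.rpow_add hT]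
    have a1 : 2 / ((m : ℝ) + 1) + ((m : ℝ) - 1) / ((m : ℝ) + 1) = 1 := by field_simp; ring
    have a2 : ((m : ℝ) - 1) / ((m : ℝ) + 1) + (1 / ((m : ℝ) + 1) + 1 / ((m : ℝ) + 1)) = 1 := by
      field_simp; ring
    rw [a1, a2, Real.rpow_one, Real.rpow_one]
  rw [mul_assoc, hexp]
  rw [hs] at h1
  set Λ := lam ^ (1 / ((m : ℝ) + 1)) with hΛ
  have hΛ0 : 0 < Λ := by positivity
  have hmpos : (0 : ℝ) < m := by linarith
  have h2 : ((m : ℝ) + 1) * (lam / Λ) * (2 * m / ((m : ℝ) - 1) * I) =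
      m / ((m : ℝ) - 1) * (2 * (((m : ℝ) + 1) * I * lam / Λ)) := by ring
  rw [h2] at h1
  have h3 := le_of_mul_le_mul_left h1 (by positivity)
  have h4 : (Λ / ((m : ℝ) - 1))⁻¹ * (lam * (((m : ℝ) + 1) / ((m : ℝ) - 1) * I)) =
      ((m : ℝ) + 1) * I * lam / Λ := by field_simp
  rw [h4] at h3
  have h5 : ((m : ℝ) + 1) * I * lam / Λ ≤ Λ / ((m : ℝ) - 1) * A := by linarith
  have h6 : ((m : ℝ) + 1) * ((m : ℝ) - 1) * (I * lam / (Λ * Λ)) =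
      (((m : ℝ) + 1) * I * lam / Λ) * (((m : ℝ) - 1) / Λ) := by field_simp
  rw [h6]
  calc _ ≤ (Λ / ((m : ℝ) - 1) * A) * (((m : ℝ) - 1) / Λ) := by gcongr
    _ = A := by field_simp

/-! ### Primitives of square integrable functions -/

/-- Serves the chain rule for Ψ(V(s)/√s), where V is only absolutely continuous and Ψ is C¹, hence
Lipschitz on bounded sets. -/
lemma AbsolutelyContinuousOnInterval.lipschitzOn_comp {f g : ℝ → ℝ} {a b : ℝ} {K : NNReal}
    {S : Set ℝ} (hg : LipschitzOnWith K g S) (hf : AbsolutelyContinuousOnInterval f a b)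
    (hS : ∀ x ∈ Set.uIcc a b, f x ∈ S) : AbsolutelyContinuousOnInterval (fun x => g (f x)) a b := by
  rw [absolutelyContinuousOnInterval_iff] at hf ⊢
  intro ε hε
  obtain ⟨δ, hδ, h⟩ := hf (ε / (K + 1)) (by positivity)
  refine ⟨δ, hδ, fun E hE hd => ?_⟩
  have h1 := h E hE hd
  have hmem : ∀ i ∈ Finset.range E.1, (E.2 i).1 ∈ Set.uIcc a b ∧ (E.2 i).2 ∈ Set.uIcc a b := by
    intro i hi
    exact hE.1 i hi
  calc _ ≤ ∑ i ∈ Finset.range E.1, K * dist (f (E.2 i).1) (f (E.2 i).2) := by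
        refine Finset.sum_le_sum fun i hi => ?_
        exact hg.dist_le_mul _ (hS _ (hmem i hi).1) _ (hS _ (hmem i hi).2)
    _ = K * ∑ i ∈ Finset.range E.1, dist (f (E.2 i).1) (f (E.2 i).2) := by rw [Finset.mul_sum]
    _ ≤ K * (ε / (K + 1)) := by gcongr
    _ < ε := by
        have : (0 : ℝ) < K + 1 := by positivity
        rw [mul_div_assoc', div_lt_iff₀ this]
        nlinarith

section Primitive

variable {h : ℝ → ℝ} (hh : MemLp h 2 volume)
include hh

lemma MeasureTheory.MemLp.intervalIntegrable_two (α β : ℝ) : IntervalIntegrable h volume α β := by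
  have := (hh.locallyIntegrable (by norm_num)).integrableOn_isCompact (isCompact_uIcc (a := α) (b := β))
  exact this.intervalIntegrable

lemma integrable_sq_of_memLp_two : Integrable fun s => h s ^ 2 := hh.integrable_sq

/-- The Cauchy-Schwarz estimate for the increments of a primitive. -/
lemma sq_intervalIntegral_le {α β : ℝ} (hab : α ≤ β) :
    (∫ s in α..β, h s) ^ 2 ≤ (β - α) * ∫ s in α..β, h s ^ 2 := by
  have hi := hh.intervalIntegrable_two α β
  have hi2 : IntervalIntegrable (fun s => h s ^ 2) volume α β :=
    (integrable_sq_of_memLp_two hh).intervalIntegrable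
  set A := ∫ s in α..β, h s with hA
  set B := ∫ s in α..β, h s ^ 2 with hB
  rcases hab.eq_or_lt with rfl | hlt
  · simp [hA]
  have h0 : 0 ≤ ∫ s in α..β, (h s - A / (β - α)) ^ 2 :=
    intervalIntegral.integral_nonneg hab fun s _ => sq_nonneg _
  have h1 : ∫ s in α..β, (h s - A / (β - α)) ^ 2 = B - A ^ 2 / (β - α) := by
    have : ∀ s, (h s - A / (β - α)) ^ 2 =
        h s ^ 2 - 2 * (A / (β - α)) * h s + (A / (β - α)) ^ 2 := fun s => by ring
    simp only [this]
    rw [intervalIntegral.integral_add (hi2.sub (hi.const_mul _)) (by simp),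
      intervalIntegral.integral_sub hi2 (hi.const_mul _), intervalIntegral.integral_const_mul,
      intervalIntegral.integral_const, ← hA, ← hB, smul_eq_mul]
    have : β - α ≠ 0 := by linarith
    field_simp
    ring
  rw [h1, sub_nonneg, div_le_iff₀ (by linarith)] at h0
  linarith

lemma continuous_primitive_of_memLp_two : Continuous fun s => ∫ r in (0 : ℝ)..s, h r :=
  intervalIntegral.continuous_primitive (fun a b => hh.intervalIntegrable_two a b) 0

lemma abs_primitive_div_sqrt_le {s : ℝ} (hs : 0 < s) :
    |(∫ r in (0 : ℝ)..s, h r) / √s| ≤ √(∫ r in (0 : ℝ)..s, h r ^ 2) := by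
  refine Real.abs_le_sqrt ?_
  rw [div_pow, Real.sq_sqrt hs.le, div_le_iff₀ hs]
  have := sq_intervalIntegral_le hh hs.le
  linarith

lemma tendsto_primitive_div_sqrt_zero :
    Tendsto (fun s => (∫ r in (0 : ℝ)..s, h r) / √s) (𝓝[>] 0) (𝓝 0) := by
  have hc : Continuous fun s => ∫ r in (0 : ℝ)..s, h r ^ 2 :=
    intervalIntegral.continuous_primitive
      (fun a b => (integrable_sq_of_memLp_two hh).intervalIntegrable) 0
  have h1 : Tendsto (fun s => √(∫ r in (0 : ℝ)..s, h r ^ 2)) (𝓝[>] 0) (𝓝 0) := by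
    have := (hc.sqrt.tendsto 0).mono_left (nhdsWithin_le_nhds (s := Set.Ioi 0))
    simpa using this
  refine squeeze_zero_norm' ?_ h1
  filter_upwards [self_mem_nhdsWithin] with s hs
  exact abs_primitive_div_sqrt_le hh hs

/-- The part of the primitive up to a fixed S' is a constant, killed by √s; the rest is controlled
by Cauchy-Schwarz and the small tail of ∫ h². -/
lemma tendsto_primitive_div_sqrt_atTop :
    Tendsto (fun s => (∫ r in (0 : ℝ)..s, h r) / √s) atTop (𝓝 0) := by
  rw [Metric.tendsto_atTop]
  intro ε hε
  have hint := integrable_sq_of_memLp_two hh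
  have ht := intervalIntegral_tendsto_integral_Ioi 0 hint.integrableOn tendsto_id
  rw [Metric.tendsto_atTop] at ht
  -- Two values within ε²/8 of the limit differ by less than ε²/4, whose square root is the ε/2
  -- needed for the tail.
  obtain ⟨S, hS⟩ := ht (ε ^ 2 / 8) (by positivity)
  set S' := max S 1 with hS'
  have hS'0 : 0 < S' := by positivity
  set v := ∫ r in (0 : ℝ)..S', h r with hv
  refine ⟨max S' ((2 * |v| / ε) ^ 2 + 1), fun s hs => ?_⟩
  have hsS : S' ≤ s := (le_max_left _ _).trans hs
  have hs0 : 0 < s := hS'0.trans_le hsS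
  have hsv : (2 * |v| / ε) ^ 2 < s := by linarith [(le_max_right S' ((2 * |v| / ε) ^ 2 + 1)).trans hs]
  have hsplit : ∫ r in (0 : ℝ)..s, h r = v + ∫ r in S'..s, h r :=
    (intervalIntegral.integral_add_adjacent_intervals (hh.intervalIntegrable_two _ _)
      (hh.intervalIntegrable_two _ _)).symm
  have hsplit2 : ∫ r in (0 : ℝ)..s, h r ^ 2 =
      (∫ r in (0 : ℝ)..S', h r ^ 2) + ∫ r in S'..s, h r ^ 2 :=
    (intervalIntegral.integral_add_adjacent_intervals hint.intervalIntegrable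
      hint.intervalIntegrable).symm
  have e1 := hS S' (le_max_left _ _)
  have e2 := hS s ((le_max_left _ _).trans hsS)
  rw [Real.dist_eq, abs_lt] at e1 e2
  simp only [id] at e1 e2
  have hB : ∫ r in S'..s, h r ^ 2 < ε ^ 2 / 4 := by linarith
  have hA := sq_intervalIntegral_le hh hsS
  have hA2 : |∫ r in S'..s, h r| < √s * (ε / 2) := by
    have hB0 : 0 ≤ ∫ r in S'..s, h r ^ 2 :=
      intervalIntegral.integral_nonneg hsS fun s _ => sq_nonneg _
    refine abs_lt_of_sq_lt_sq ?_ (by positivity)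
    rw [mul_pow, Real.sq_sqrt hs0.le]
    nlinarith
  have hv2 : |v| < √s * (ε / 2) := by
    have := Real.lt_sqrt_of_sq_lt hsv
    rw [div_lt_iff₀ hε] at this
    linarith
  rw [dist_zero_right, Real.norm_eq_abs, abs_div, abs_of_nonneg (Real.sqrt_nonneg s),
    div_lt_iff₀ (Real.sqrt_pos.2 hs0), hsplit]
  calc _ ≤ |v| + |∫ r in S'..s, h r| := abs_add_le _ _
    _ < _ := by linarith

/-- `|V(s)| / √s` attains its maximum. -/
lemma exists_max_primitive_div_sqrt {s₁ : ℝ} (hs₁ : 0 < s₁) (hne : ∫ r in (0 : ℝ)..s₁, h r ≠ 0) :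
    ∃ s₀ > 0, (∫ r in (0 : ℝ)..s₀, h r) ≠ 0 ∧
      ∀ s > 0, |(∫ r in (0 : ℝ)..s, h r) / √s| ≤ |(∫ r in (0 : ℝ)..s₀, h r) / √s₀| := by
  set y : ℝ → ℝ := fun s => (∫ r in (0 : ℝ)..s, h r) / √s with hy
  have hy1 : 0 < |y s₁| := by
    simp only [hy]
    exact abs_pos.2 (div_ne_zero hne (Real.sqrt_pos.2 hs₁).ne')
  have hycont : ContinuousOn y (Set.Ioi 0) :=
    (continuous_primitive_of_memLp_two hh).continuousOn.div Real.continuous_sqrt.continuousOn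
      fun s hs => (Real.sqrt_pos.2 hs).ne'
  have h0 : ∀ᶠ s in 𝓝[>] 0, |y s| < |y s₁| := by
    have := (tendsto_primitive_div_sqrt_zero hh).abs
    rw [abs_zero] at this
    exact this.eventually_lt_const hy1
  have h1 : ∀ᶠ s in atTop, |y s| < |y s₁| := by
    have := (tendsto_primitive_div_sqrt_atTop hh).abs
    rw [abs_zero] at this
    exact this.eventually_lt_const hy1
  obtain ⟨δ, hδ, hδ'⟩ := mem_nhdsGT_iff_exists_Ioo_subset.1 h0
  have hδ : 0 < δ := hδ
  obtain ⟨S, hS⟩ := eventually_atTop.1 h1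
  set α := min (δ / 2) s₁ with hα
  have hα0 : 0 < α := by positivity
  set β := max S s₁ with hβ
  have hmem : s₁ ∈ Set.Icc α β := ⟨min_le_right _ _, le_max_right _ _⟩
  obtain ⟨s₀, hs₀, hmax⟩ := isCompact_Icc.exists_isMaxOn ⟨s₁, hmem⟩
    (f := fun s => |y s|) ((hycont.mono fun s hs => hα0.trans_le hs.1).abs)
  have hs₀1 : |y s₁| ≤ |y s₀| := hmax hmem
  refine ⟨s₀, hα0.trans_le hs₀.1, ?_, fun s hs => ?_⟩
  · intro h
    have : y s₀ = 0 := by simp [hy, h]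
    rw [this, abs_zero] at hs₀1
    linarith
  · rcases lt_or_ge s α with hlt | hge
    · have : |y s| < |y s₁| := hδ' ⟨hs, by
        have := min_le_left (δ / 2) s₁
        linarith⟩
      exact this.le.trans hs₀1
    · rcases lt_or_ge β s with hlt | hle
      · exact (hS s ((le_max_left _ _).trans hlt.le)).le.trans hs₀1
      · exact hmax ⟨hge, hle⟩

end Primitive

/-! ### Nagy's identity -/

/-- The square root `½ (z² - |z|^p)^{1/2}` of the potential of the soliton equation. -/
noncomputable def nagyRoot (p z : ℝ) : ℝ := √(z ^ 2 - |z| ^ p) / 2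

/-- The primitive of `nagyRoot p`. -/
noncomputable def nagyPot (p z : ℝ) : ℝ := ∫ r in (0 : ℝ)..z, nagyRoot p r

lemma nagyRoot_nonneg (p z : ℝ) : 0 ≤ nagyRoot p z := by unfold nagyRoot; positivity

lemma nagyPot_zero (p : ℝ) : nagyPot p 0 = 0 := by simp [nagyPot]

lemma nagyRoot_le (p z : ℝ) : nagyRoot p z ≤ |z| / 2 := by
  rw [nagyRoot]
  have : √(z ^ 2 - |z| ^ p) ≤ |z| := by
    refine Real.sqrt_le_iff.2 ⟨abs_nonneg z, ?_⟩
    have : 0 ≤ |z| ^ p := by positivity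
    rw [sq_abs]
    linarith
  linarith

section Root

variable {p : ℝ} (hp : 2 < p)
include hp

lemma continuous_nagyRoot : Continuous (nagyRoot p) := by
  have : Continuous fun z : ℝ => |z| ^ p := continuous_abs.rpow_const fun _ => Or.inr (by linarith)
  unfold nagyRoot
  fun_prop

lemma hasDerivAt_nagyPot (z : ℝ) : HasDerivAt (nagyPot p) (nagyRoot p z) z :=
  ((continuous_nagyRoot hp).integral_hasStrictDerivAt 0 z).hasDerivAt

lemma abs_rpow_le_sq {z : ℝ} (hz : |z| ≤ 1) : |z| ^ p ≤ z ^ 2 := by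
  rw [← sq_abs, ← Real.rpow_natCast]
  rcases (abs_nonneg z).eq_or_lt with h | h
  · rw [← h, Real.zero_rpow (by linarith), Real.zero_rpow (by norm_num)]
  · exact Real.rpow_le_rpow_of_exponent_ge h hz (by push_cast; linarith)

lemma nagyRoot_sq {z : ℝ} (hz : |z| ≤ 1) : nagyRoot p z ^ 2 = (z ^ 2 - |z| ^ p) / 4 := by
  rw [nagyRoot, div_pow, Real.sq_sqrt (sub_nonneg.2 (abs_rpow_le_sq hp hz))]
  norm_num

lemma continuous_nagyPot : Continuous (nagyPot p) :=
  continuous_iff_continuousAt.2 fun z => (hasDerivAt_nagyPot hp z).continuousAt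

end Root

section Identity

variable {h : ℝ → ℝ} (hh : MemLp h 2 volume)
include hh

/-- The chain rule for `Ψ(V(s)/√s)`, where `V` is the primitive of an `L²` function `h`. -/
lemma integral_deriv_comp_primitive {Ψ Ψ' : ℝ → ℝ} (hΨ : ∀ z, HasDerivAt Ψ (Ψ' z) z)
    (hΨc : Continuous Ψ') {α β : ℝ} (hα : 0 < α) (hab : α ≤ β) {y : ℝ → ℝ}
    (hy : ∀ s, y s = (∫ r in (0 : ℝ)..s, h r) / √s) :
    IntervalIntegrable (fun s => Ψ' (y s) * ((√s * h s - y s / 2) / s)) volume α β ∧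
    ∫ s in α..β, Ψ' (y s) * ((√s * h s - y s / 2) / s) = Ψ (y β) - Ψ (y α) := by
  have hI : Set.uIcc α β = Set.Icc α β := Set.uIcc_of_le hab
  have hpos : ∀ s ∈ Set.uIcc α β, 0 < s := fun s hs => hα.trans_le (hI ▸ hs).1
  have hi := hh.intervalIntegrable_two 0 β
  have hV : AbsolutelyContinuousOnInterval (fun s => ∫ r in (0 : ℝ)..s, h r) α β :=
    (hi.absolutelyContinuousOnInterval_intervalIntegral (c := 0) Set.left_mem_uIcc).mono (by
      rw [hI, Set.uIcc_of_le (hα.le.trans hab)]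
      exact Set.Icc_subset_Icc_left hα.le)
  have hr : AbsolutelyContinuousOnInterval (fun s => (√s)⁻¹) α β := by
    refine ContDiffOn.absolutelyContinuousOnInterval fun s hs => ?_
    have := hpos s hs
    exact ((Real.contDiffAt_sqrt this.ne').inv (Real.sqrt_pos.2 this).ne').contDiffWithinAt
  have hyAC : AbsolutelyContinuousOnInterval y α β := by
    have e : y = (fun s => ∫ r in (0 : ℝ)..s, h r) * fun s => (√s)⁻¹ := by
      ext s; simp [hy, div_eq_mul_inv]
    rw [e]
    exact hV.mul hr
  obtain ⟨K, hK⟩ := hyAC.exists_bound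
  have hΨ1 : ContDiff ℝ 1 Ψ := by
    rw [contDiff_one_iff_deriv]
    refine ⟨fun z => (hΨ z).differentiableAt, ?_⟩
    rwa [show deriv Ψ = Ψ' from funext fun z => (hΨ z).deriv]
  obtain ⟨L, hL⟩ := hΨ1.contDiffOn.exists_lipschitzOnWith (s := Set.Icc (-K) K) (by norm_num)
    (convex_Icc _ _) isCompact_Icc
  have hcomp : AbsolutelyContinuousOnInterval (fun s => Ψ (y s)) α β :=
    hyAC.lipschitzOn_comp hL fun s hs => abs_le.1 (hK s hs)
  -- Almost everywhere V' = h, so that s y' = √s h - y/2.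
  have hae : ∀ᵐ s, s ∈ Set.uIcc α β →
      deriv (fun s => Ψ (y s)) s = Ψ' (y s) * ((√s * h s - y s / 2) / s) := by
    filter_upwards [(hh.intervalIntegrable_two 0 β).ae_hasDerivAt_integral] with s hs hsI
    have hs0 := hpos s hsI
    have h1 := hs (by
      rw [Set.uIcc_of_le (hα.le.trans hab)]; rw [hI] at hsI
      exact ⟨hs0.le, hsI.2⟩) 0 Set.left_mem_uIcc
    have h2 := (h1.div (Real.hasDerivAt_sqrt hs0.ne') (Real.sqrt_pos.2 hs0).ne')
    have h3 : HasDerivAt y ((√s * h s - y s / 2) / s) s := by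
      refine (h2.congr_deriv ?_).congr_of_eventuallyEq (Eventually.of_forall fun s => hy s)
      rw [hy]
      have hq : √s ^ 2 = s := Real.sq_sqrt hs0.le
      have hq0 : √s ≠ 0 := (Real.sqrt_pos.2 hs0).ne'
      rw [hq]
      field_simp
    exact ((hΨ (y s)).comp s h3).deriv
  have hae' : ∀ᵐ s, s ∈ Set.uIoc α β →
      deriv (fun s => Ψ (y s)) s = Ψ' (y s) * ((√s * h s - y s / 2) / s) := by
    filter_upwards [hae] with s hs hm using hs (Set.uIoc_subset_uIcc hm)
  refine ⟨hcomp.intervalIntegrable_deriv.congr_ae ?_, ?_⟩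
  · exact (ae_restrict_iff' measurableSet_uIoc).2 hae'
  · rw [← hcomp.integral_deriv_eq_sub]
    exact intervalIntegral.integral_congr_ae (by
      filter_upwards [hae'] with s hs hm using (hs hm).symm)

end Identity

/-- With d = √s h - y/2 and r = `nagyRoot p y`, s h² = (d + y/2)² = (d - τr)² + (2τr + y) d + (y²/4
- r²), and y²/4 - r² = |y|^p/4 by the choice of r. Since d = s y' for y = V/√s, the middle term is
the derivative of 2τΦ(y) + y²/2, up to the factor s. -/
lemma nagy_pointwise {p : ℝ} (hp : 2 < p) {s y h τ : ℝ} (hs : 0 < s) (hy : |y| ≤ 1)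
    (hτ : τ ^ 2 = 1) :
    h ^ 2 = |y| ^ p / (4 * s) + (√s * h - y / 2 - τ * nagyRoot p y) ^ 2 / s +
      (2 * τ * nagyRoot p y + y) * ((√s * h - y / 2) / s) := by
  have hq : √s ^ 2 = s := Real.sq_sqrt hs.le
  have hS := nagyRoot_sq hp hy
  field_simp
  linear_combination (-(16 * h ^ 2)) * hq - 16 * τ ^ 2 * hS - 4 * (y ^ 2 - |y| ^ p) * hτ

/-- The defect in Nagy's inequality. -/
noncomputable def nagyDefect (p s₀ : ℝ) (h y : ℝ → ℝ) (s : ℝ) : ℝ :=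
  (√s * h s - y s / 2 - (if s ≤ s₀ then 1 else -1) * nagyRoot p (y s)) ^ 2 / s

lemma nagyDefect_nonneg {p s₀ : ℝ} {h y : ℝ → ℝ} {s : ℝ} (hs : 0 < s) :
    0 ≤ nagyDefect p s₀ h y s := by unfold nagyDefect; positivity

/-- Nagy's identity on a bounded interval on one side of the maximum. -/
lemma nagy_identity_interval {p : ℝ} (hp : 2 < p) {h : ℝ → ℝ} (hh : MemLp h 2 volume)
    {y : ℝ → ℝ} (hy : ∀ s, y s = (∫ r in (0 : ℝ)..s, h r) / √s) (hy1 : ∀ s > 0, |y s| ≤ 1)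
    {α β s₀ τ : ℝ} (hα : 0 < α) (hab : α ≤ β) (hτ : τ ^ 2 = 1)
    (hτs : ∀ s ∈ Set.Ioc α β, (if s ≤ s₀ then (1 : ℝ) else -1) = τ) :
    IntervalIntegrable (fun s => |y s| ^ p / (4 * s) + nagyDefect p s₀ h y s) volume α β ∧
    ∫ s in α..β, (|y s| ^ p / (4 * s) + nagyDefect p s₀ h y s) = (∫ s in α..β, h s ^ 2) -
      ((2 * τ * nagyPot p (y β) + y β ^ 2 / 2) - (2 * τ * nagyPot p (y α) + y α ^ 2 / 2)) := by
  obtain ⟨h1, h2⟩ := integral_deriv_comp_primitive hh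
    (Ψ := fun z => 2 * τ * nagyPot p z + z ^ 2 / 2) (Ψ' := fun z => 2 * τ * nagyRoot p z + z)
    (fun z => by
      have := ((hasDerivAt_nagyPot hp z).const_mul (2 * τ)).add ((hasDerivAt_pow 2 z).div_const 2)
      refine this.congr_deriv ?_
      norm_num)
    ((continuous_const.mul (continuous_nagyRoot hp)).add continuous_id) hα hab hy
  have h3 : IntervalIntegrable (fun s => h s ^ 2) volume α β :=
    (integrable_sq_of_memLp_two hh).intervalIntegrable
  have hcongr : Set.EqOn (fun s => h s ^ 2 - (2 * τ * nagyRoot p (y s) + y s) *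
      ((√s * h s - y s / 2) / s)) (fun s => |y s| ^ p / (4 * s) + nagyDefect p s₀ h y s)
      (Set.uIoc α β) := by
    intro s hs
    rw [Set.uIoc_of_le hab] at hs
    have hs0 := hα.trans hs.1
    have := nagy_pointwise hp (h := h s) hs0 (hy1 s hs0) hτ
    simp only [nagyDefect, hτs s hs]
    linarith
  refine ⟨(h3.sub h1).congr hcongr, ?_⟩
  rw [← h2, ← intervalIntegral.integral_sub h3 h1]
  exact intervalIntegral.integral_congr_ae (Eventually.of_forall fun s hs => (hcongr hs).symm)

/-- Nagy's identity for a function with `|V(s)| ≤ √s`, with equality at `s₀`. -/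
theorem nagy_identity {p : ℝ} (hp : 2 < p) {h : ℝ → ℝ} (hh : MemLp h 2 volume)
    {y : ℝ → ℝ} (hy : ∀ s, y s = (∫ r in (0 : ℝ)..s, h r) / √s) (hy1 : ∀ s > 0, |y s| ≤ 1)
    {s₀ : ℝ} (hs₀ : 0 < s₀) (hys₀ : y s₀ = 1) :
    IntegrableOn (fun s => |y s| ^ p / s) (Set.Ioi 0) ∧
    IntegrableOn (nagyDefect p s₀ h y) (Set.Ioi 0) ∧
    ∫ s in Set.Ioi (0 : ℝ), h s ^ 2 = (∫ s in Set.Ioi (0 : ℝ), |y s| ^ p / s) / 4 +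
      (∫ s in Set.Ioi (0 : ℝ), nagyDefect p s₀ h y s) + 4 * nagyPot p 1 := by
  set f : ℝ → ℝ := fun s => |y s| ^ p / (4 * s) + nagyDefect p s₀ h y s with hf
  set α : ℕ → ℝ := fun n => s₀ / (n + 2) with hα
  set β : ℕ → ℝ := fun n => s₀ * (n + 2) with hβ
  have hα0 : ∀ n, 0 < α n := fun n => by simp only [hα]; positivity
  have hαs : ∀ n, α n ≤ s₀ := fun n => by
    simp only [hα]; exact div_le_self hs₀.le (by linarith [Nat.cast_nonneg (α := ℝ) n])
  have hβs : ∀ n, s₀ ≤ β n := fun n => by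
    simp only [hβ]; nlinarith [Nat.cast_nonneg (α := ℝ) n]
  have hn2 : Tendsto (fun n : ℕ => (n : ℝ) + 2) atTop atTop :=
    tendsto_atTop_add_const_right _ _ tendsto_natCast_atTop_atTop
  have hαt0 : Tendsto α atTop (𝓝 0) := hn2.const_div_atTop s₀
  have hαt : Tendsto α atTop (𝓝[>] 0) :=
    tendsto_nhdsWithin_iff.2 ⟨hαt0, Eventually.of_forall hα0⟩
  have hβt : Tendsto β atTop atTop := hn2.const_mul_atTop hs₀
  have hyeq : y = fun s => (∫ r in (0 : ℝ)..s, h r) / √s := funext hy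
  have hyα : Tendsto (fun n => y (α n)) atTop (𝓝 0) := by
    rw [hyeq]; exact (tendsto_primitive_div_sqrt_zero hh).comp hαt
  have hyβ : Tendsto (fun n => y (β n)) atTop (𝓝 0) := by
    rw [hyeq]; exact (tendsto_primitive_div_sqrt_atTop hh).comp hβt
  have hint2 := integrable_sq_of_memLp_two hh
  -- The sign is +1 to the left of the maximum point and -1 to the right, so the boundary terms at
  -- s₀ add up to 4Φ(1) instead of cancelling.
  have hL := fun n => nagy_identity_interval hp hh hy hy1 (s₀ := s₀) (τ := 1) (hα0 n) (hαs n)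
    (by norm_num) (fun s hs => if_pos hs.2)
  have hR := fun n => nagy_identity_interval hp hh hy hy1 (s₀ := s₀) (τ := -1) hs₀ (hβs n)
    (by norm_num) (fun s hs => if_neg (not_le.2 hs.1))
  have hval : ∀ n, ∫ s in α n..β n, f s = (∫ s in α n..β n, h s ^ 2) - 4 * nagyPot p 1 +
      (2 * nagyPot p (y (α n)) + y (α n) ^ 2 / 2) -
      (-2 * nagyPot p (y (β n)) + y (β n) ^ 2 / 2) := by
    intro n
    have hsplit : ∫ s in α n..β n, h s ^ 2 =
        (∫ s in α n..s₀, h s ^ 2) + ∫ s in s₀..β n, h s ^ 2 :=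
      (intervalIntegral.integral_add_adjacent_intervals
        hint2.intervalIntegrable hint2.intervalIntegrable).symm
    rw [← intervalIntegral.integral_add_adjacent_intervals (hL n).1 (hR n).1, (hL n).2, (hR n).2,
      hsplit, hys₀]
    ring
  have hinter : ∀ n, Set.Ioc (α n) (β n) ∩ Set.Ioi 0 = Set.Ioc (α n) (β n) := fun n =>
    Set.inter_eq_left.2 fun s hs => (hα0 n).trans hs.1
  have hcov : AECover (volume.restrict (Set.Ioi (0 : ℝ))) atTop fun n => Set.Ioc (α n) (β n) :=
    (aecover_Ioi_of_Ioi hαt0).inter (aecover_Iic hβt).restrict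
  have hlim : Tendsto (fun n => ∫ s in α n..β n, f s) atTop
      (𝓝 ((∫ s in Set.Ioi (0 : ℝ), h s ^ 2) - 4 * nagyPot p 1)) := by
    simp only [hval]
    have h1 : Tendsto (fun n => ∫ s in α n..β n, h s ^ 2) atTop
        (𝓝 (∫ s in Set.Ioi (0 : ℝ), h s ^ 2)) := by
      have := hcov.integral_tendsto_of_countably_generated hint2.integrableOn
      refine this.congr fun n => ?_
      rw [intervalIntegral.integral_of_le ((hαs n).trans (hβs n)), Measure.restrict_restrict
        measurableSet_Ioc, hinter]
    have hΦ := (continuous_nagyPot hp).tendsto 0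
    rw [nagyPot_zero p] at hΦ
    have h2 : Tendsto (fun n => 2 * nagyPot p (y (α n)) + y (α n) ^ 2 / 2) atTop (𝓝 0) := by
      have := ((hΦ.comp hyα).const_mul 2).add ((hyα.pow 2).div_const 2)
      simpa using this
    have h3 : Tendsto (fun n => -2 * nagyPot p (y (β n)) + y (β n) ^ 2 / 2) atTop (𝓝 0) := by
      have := ((hΦ.comp hyβ).const_mul (-2)).add ((hyβ.pow 2).div_const 2)
      simpa using this
    simpa using ((h1.sub_const (4 * nagyPot p 1)).add h2).sub h3
  have hf0 : ∀ s > 0, 0 ≤ f s := fun s hs => by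
    have := nagyDefect_nonneg (p := p) (s₀ := s₀) (h := h) (y := y) hs
    simp only [hf]; positivity
  have hfint : ∀ n, IntegrableOn f (Set.Ioc (α n) (β n)) := fun n => by
    have := (hL n).1.trans (hR n).1
    exact (intervalIntegrable_iff_integrableOn_Ioc_of_le ((hαs n).trans (hβs n))).1 this
  have hrestr : ∀ n, (volume.restrict (Set.Ioi (0 : ℝ))).restrict (Set.Ioc (α n) (β n)) =
      volume.restrict (Set.Ioc (α n) (β n)) := fun n => by
    rw [Measure.restrict_restrict measurableSet_Ioc, hinter]
  have hlim' : Tendsto (fun n => ∫ s in Set.Ioc (α n) (β n), f s ∂volume.restrict (Set.Ioi 0))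
      atTop (𝓝 ((∫ s in Set.Ioi (0 : ℝ), h s ^ 2) - 4 * nagyPot p 1)) := by
    refine hlim.congr fun n => ?_
    rw [intervalIntegral.integral_of_le ((hαs n).trans (hβs n)), hrestr]
  -- The integrand is nonnegative and its integrals over an exhausting sequence converge;
  -- integrability of |y|^p/s is thus a consequence and not an assumption.
  have hfI : IntegrableOn f (Set.Ioi 0) := by
    refine hcov.integrable_of_integral_tendsto_of_nonneg_ae _ (fun n => ?_) ?_ hlim'
    · rw [IntegrableOn, hrestr]; exact hfint n
    · exact (ae_restrict_iff' measurableSet_Ioi).2 (Eventually.of_forall hf0)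
  have hfE : ∫ s in Set.Ioi (0 : ℝ), f s =
      (∫ s in Set.Ioi (0 : ℝ), h s ^ 2) - 4 * nagyPot p 1 :=
    tendsto_nhds_unique (hcov.integral_tendsto_of_countably_generated hfI) hlim'
  have hycont : ContinuousOn y (Set.Ioi 0) := by
    rw [hyeq]
    exact (continuous_primitive_of_memLp_two hh).continuousOn.div
      Real.continuous_sqrt.continuousOn fun s hs => (Real.sqrt_pos.2 hs).ne'
  have hP4 : IntegrableOn (fun s => |y s| ^ p / (4 * s)) (Set.Ioi 0) := by
    refine Integrable.mono' hfI ?_ ?_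
    · refine ContinuousOn.aestronglyMeasurable ?_ measurableSet_Ioi
      refine (hycont.abs.rpow_const fun _ _ => Or.inr (by linarith)).div
        (continuous_const.mul continuous_id).continuousOn fun s hs => ?_
      have : (0 : ℝ) < s := hs
      change (4 * s : ℝ) ≠ 0; positivity
    · refine (ae_restrict_iff' measurableSet_Ioi).2 (Eventually.of_forall fun s hs => ?_)
      have hs' : (0 : ℝ) < s := hs
      rw [Real.norm_of_nonneg (by positivity)]
      have := nagyDefect_nonneg (p := p) (s₀ := s₀) (h := h) (y := y) hs'
      simp only [hf]; linarith
  have hQ : IntegrableOn (nagyDefect p s₀ h y) (Set.Ioi 0) := by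
    have := hfI.sub hP4
    refine this.congr (Eventually.of_forall fun s => ?_)
    simp [hf]
  have hPe : ∀ s, |y s| ^ p / (4 * s) = (|y s| ^ p / s) / 4 := fun s => by
    rw [mul_comm, div_div]
  have hP : IntegrableOn (fun s => |y s| ^ p / s) (Set.Ioi 0) := by
    have := hP4.const_mul 4
    refine this.congr (Eventually.of_forall fun s => ?_)
    simp only [hPe]; ring
  refine ⟨hP, hQ, ?_⟩
  have : ∫ s in Set.Ioi (0 : ℝ), f s = (∫ s in Set.Ioi (0 : ℝ), |y s| ^ p / s) / 4 +
      ∫ s in Set.Ioi (0 : ℝ), nagyDefect p s₀ h y s := by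
    simp only [hf]
    rw [integral_add hP4 hQ]
    simp only [hPe]
    rw [integral_div]
  linarith

/-! ### The differential equation of the equality case -/

/-- Monotonicity and positivity of the decaying solutions of `Y' = -nagyRoot p Y`. -/
lemma nagy_ode_antitone {p : ℝ} {Y : ℝ → ℝ} (hc : ContinuousOn Y (Set.Ici 0))
    (hd : ∀ x > 0, HasDerivAt Y (-nagyRoot p (Y x)) x) : AntitoneOn Y (Set.Ici 0) := by
  refine antitoneOn_of_deriv_nonpos (convex_Ici 0) hc ?_ ?_
  · rw [interior_Ici]
    exact fun x hx => (hd x hx).differentiableAt.differentiableWithinAt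
  · rw [interior_Ici]
    intro x hx
    rw [(hd x hx).deriv]
    linarith [nagyRoot_nonneg p (Y x)]

/-- As `nagyRoot p Y ≤ Y / 2`, the function Y e^{x/2} is nondecreasing, so Y decays no faster than
e^{-x/2}. -/
lemma nagy_ode_pos {p : ℝ} {Y : ℝ → ℝ} (hc : ContinuousOn Y (Set.Ici 0)) (h0 : Y 0 = 1)
    (hd : ∀ x > 0, HasDerivAt Y (-nagyRoot p (Y x)) x) (hlim : Tendsto Y atTop (𝓝 0)) {x : ℝ}
    (hx : 0 ≤ x) : 0 < Y x := by
  have hanti := nagy_ode_antitone hc hd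
  have hnn : ∀ x ≥ 0, 0 ≤ Y x := fun x hx => le_of_tendsto hlim (by
    filter_upwards [eventually_ge_atTop x] with z hz
    exact hanti hx (hx.trans hz) hz)
  have hmono : MonotoneOn (fun x => Y x * Real.exp (x / 2)) (Set.Ici 0) := by
    have hD : ∀ x > 0, HasDerivAt (fun x => Y x * Real.exp (x / 2))
        (-nagyRoot p (Y x) * Real.exp (x / 2) + Y x * (Real.exp (x / 2) * (1 / 2))) x :=
      fun x hx => (hd x hx).mul ((hasDerivAt_id x).div_const 2).exp
    refine monotoneOn_of_deriv_nonneg (convex_Ici 0) (hc.mul (by fun_prop)) ?_ ?_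
    · rw [interior_Ici]
      exact fun x hx => (hD x hx).differentiableAt.differentiableWithinAt
    · rw [interior_Ici]
      intro x hx
      have hx' : (0 : ℝ) < x := hx
      rw [(hD x hx).deriv]
      have h1 := nagyRoot_le p (Y x)
      rw [abs_of_nonneg (hnn x hx'.le)] at h1
      have h2 : 0 < Real.exp (x / 2) := Real.exp_pos _
      nlinarith
  have := hmono Set.self_mem_Ici hx hx
  simp only [h0, zero_div, Real.exp_zero, mul_one] at this
  by_contra hneg
  have h2 : 0 < Real.exp (x / 2) := Real.exp_pos _
  nlinarith

/-- Prepares the substitution ζ = Y^{-1/a}, under which Y' = -`nagyRoot p Y` becomes ζ' = √(ζ² -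
1)/(2a), the equation of a hyperbolic cosine. -/
lemma nagyRoot_eq_of_pos {a Y : ℝ} (hY : 0 < Y) :
    nagyRoot (2 + 2 / a) Y =
      Y / 2 * (√((Y ^ (-(1 / a))) ^ 2 - 1) / Y ^ (-(1 / a))) := by
  set ζ := Y ^ (-(1 / a)) with hζ
  have hζ0 : 0 < ζ := Real.rpow_pos_of_pos hY _
  have h1 : Y ^ (2 + 2 / a) = Y ^ 2 / ζ ^ 2 := by
    have h2 : ζ ^ 2 = Y ^ (-(2 / a)) := by
      rw [hζ, ← Real.rpow_natCast, ← Real.rpow_mul hY.le]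
      congr 1
      push_cast
      ring
    rw [h2, Real.rpow_neg hY.le, div_inv_eq_mul, Real.rpow_add hY, Real.rpow_two]
  rw [nagyRoot, abs_of_pos hY, h1, show Y ^ 2 - Y ^ 2 / ζ ^ 2 = (Y / ζ) ^ 2 * (ζ ^ 2 - 1) by
    field_simp, Real.sqrt_mul (sq_nonneg _), Real.sqrt_sq (by positivity)]
  field_simp

/-- The solutions of `Y' = -nagyRoot p Y` with `Y(0) = 1` that decay at infinity. -/
theorem nagy_ode_eq {a : ℝ} (ha : 0 < a) {Y : ℝ → ℝ} (hc : ContinuousOn Y (Set.Ici 0))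
    (h0 : Y 0 = 1) (hd : ∀ x > 0, HasDerivAt Y (-nagyRoot (2 + 2 / a) (Y x)) x)
    (hlim : Tendsto Y atTop (𝓝 0)) :
    ∃ x₁ ≥ 0, ∀ x ≥ 0, Y x = Real.cosh (max (x - x₁) 0 / (2 * a)) ^ (-a) := by
  have hanti := nagy_ode_antitone hc hd
  have hpos : ∀ x ≥ 0, 0 < Y x := fun x hx => nagy_ode_pos hc h0 hd hlim hx
  have hle1 : ∀ x ≥ 0, Y x ≤ 1 := fun x hx => by
    rw [← h0]; exact hanti Set.self_mem_Ici hx hx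
  -- The right side of the equation is not Lipschitz at Y = 1, so a solution may rest at 1 for some
  -- time before it descends; x₁ is the last time at height 1.
  set A : Set ℝ := Set.Ici 0 ∩ Y ⁻¹' {1} with hA
  have hAne : A.Nonempty := ⟨0, Set.self_mem_Ici, h0⟩
  have hAc : IsClosed A := hc.preimage_isClosed_of_isClosed isClosed_Ici isClosed_singleton
  have hAb : BddAbove A := by
    obtain ⟨X, hX⟩ := eventually_atTop.1 (hlim.eventually_lt_const (show (0 : ℝ) < 1 by norm_num))
    refine ⟨X, fun x hx => ?_⟩
    by_contra h
    have h2 := hX x (not_le.1 h).le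
    rw [show Y x = 1 from hx.2] at h2
    exact lt_irrefl _ h2
  set x₁ := sSup A with hx₁
  have hx₁A : x₁ ∈ A := hAc.csSup_mem hAne hAb
  have hx₁0 : 0 ≤ x₁ := hx₁A.1
  have hYx₁ : Y x₁ = 1 := hx₁A.2
  refine ⟨x₁, hx₁0, fun x hx => ?_⟩
  rcases le_or_gt x x₁ with hle | hgt
  · have h1 : Y x = 1 := le_antisymm (hle1 x hx) (by rw [← hYx₁]; exact hanti hx hx₁0 hle)
    rw [h1, max_eq_right (by linarith)]; simp
  set ζ : ℝ → ℝ := fun x => Y x ^ (-(1 / a)) with hζ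
  have hlt1 : ∀ z > x₁, Y z < 1 := fun z hz => by
    refine lt_of_le_of_ne (hle1 z (hx₁0.trans hz.le)) fun h => ?_
    exact absurd (le_csSup hAb (show z ∈ A from ⟨hx₁0.trans hz.le, h⟩)) (not_le.2 hz)
  have hζ1 : ∀ z > x₁, 1 < ζ z := fun z hz =>
    Real.one_lt_rpow_of_pos_of_lt_one_of_neg (hpos z (hx₁0.trans hz.le)) (hlt1 z hz)
      (by have : 0 < 1 / a := by positivity
          linarith)
  have hsub : Set.Ici x₁ ⊆ Set.Ici 0 := Set.Ici_subset_Ici.2 hx₁0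
  have hζc : ContinuousOn ζ (Set.Ici x₁) := (hc.mono hsub).rpow_const fun z hz =>
    Or.inl (hpos z (hsub hz)).ne'
  have hζd : ∀ z > x₁, HasDerivAt ζ (√(ζ z ^ 2 - 1) / (2 * a)) z := by
    intro z hz
    have hz0 : 0 < z := hx₁0.trans_lt hz
    have hYz := hpos z hz0.le
    have := (hd z hz0).rpow_const (p := -(1 / a)) (Or.inl hYz.ne')
    refine this.congr_deriv ?_
    have hζz : 0 < Y z ^ (-(1 / a)) := Real.rpow_pos_of_pos hYz _
    rw [nagyRoot_eq_of_pos hYz, Real.rpow_sub hYz, Real.rpow_one]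
    simp only [hζ]
    field_simp
  -- Since ζ + √(ζ² - 1) = exp(arcosh ζ) and arcosh ζ has slope 1/(2a), this quantity is conserved.
  set G : ℝ → ℝ := fun z => (ζ z + √(ζ z ^ 2 - 1)) * Real.exp (-(z / (2 * a))) with hG
  have hGc : ContinuousOn G (Set.Ici x₁) :=
    (hζc.add ((hζc.pow 2).sub continuousOn_const).sqrt).mul (by fun_prop)
  have hGd : ∀ z > x₁, HasDerivAt G 0 z := by
    intro z hz
    have h1 := hζ1 z hz
    have hpos' : 0 < ζ z ^ 2 - 1 := by nlinarith
    have hs0 : √(ζ z ^ 2 - 1) ≠ 0 := (Real.sqrt_pos.2 hpos').ne'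
    have hs : HasDerivAt (fun z => √(ζ z ^ 2 - 1)) (ζ z / (2 * a)) z := by
      have h2 : HasDerivAt (fun z => ζ z ^ 2 - 1) (2 * ζ z * (√(ζ z ^ 2 - 1) / (2 * a))) z := by
        simpa using ((hζd z hz).pow 2).sub_const 1
      refine (h2.sqrt hpos'.ne').congr_deriv ?_
      field_simp
    have he : HasDerivAt (fun z => Real.exp (-(z / (2 * a))))
        (Real.exp (-(z / (2 * a))) * -(1 / (2 * a))) z :=
      (((hasDerivAt_id z).div_const (2 * a)).neg).exp
    refine (((hζd z hz).add hs).mul he).congr_deriv ?_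
    simp only [Pi.add_apply]
    ring
  have hint' : ∀ z ∈ interior (Set.Ici x₁), x₁ < z := fun z hz => by
    rwa [interior_Ici] at hz
  have hG1 : MonotoneOn G (Set.Ici x₁) := monotoneOn_of_deriv_nonneg (convex_Ici _) hGc
    (fun z hz => (hGd z (hint' z hz)).differentiableAt.differentiableWithinAt)
    (fun z hz => (hGd z (hint' z hz)).deriv.ge)
  have hG2 : AntitoneOn G (Set.Ici x₁) := antitoneOn_of_deriv_nonpos (convex_Ici _) hGc
    (fun z hz => (hGd z (hint' z hz)).differentiableAt.differentiableWithinAt)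
    (fun z hz => (hGd z (hint' z hz)).deriv.le)
  have hGx : G x = G x₁ := le_antisymm (hG2 Set.self_mem_Ici hgt.le hgt.le)
    (hG1 Set.self_mem_Ici hgt.le hgt.le)
  have hζx₁ : ζ x₁ = 1 := by simp [hζ, hYx₁]
  set e := Real.exp ((x - x₁) / (2 * a)) with he
  have he0 : 0 < e := Real.exp_pos _
  have hξ : ζ x + √(ζ x ^ 2 - 1) = e := by
    simp only [hG, hζx₁] at hGx
    have : Real.exp (-(x / (2 * a))) * e = Real.exp (-(x₁ / (2 * a))) := by
      rw [he, ← Real.exp_add]; congr 1; field_simp; ring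
    rw [← this] at hGx
    have h2 : 0 < Real.exp (-(x / (2 * a))) := Real.exp_pos _
    norm_num at hGx
    have h3 : Real.exp (-(x / (2 * a))) * (ζ x + √(ζ x ^ 2 - 1)) =
      Real.exp (-(x / (2 * a))) * e := by rw [← hGx]; ring
    exact mul_left_cancel₀ h2.ne' h3
  have h1 := hζ1 x hgt
  have hsq : √(ζ x ^ 2 - 1) ^ 2 = ζ x ^ 2 - 1 := Real.sq_sqrt (by nlinarith)
  have hζe : ζ x = (e + e⁻¹) / 2 := by
    have : √(ζ x ^ 2 - 1) = e - ζ x := by linarith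
    rw [this] at hsq
    field_simp
    linarith
  rw [max_eq_left (by linarith), Real.cosh_eq, Real.exp_neg, ← he, ← hζe]
  simp only [hζ]
  rw [← Real.rpow_mul (hpos x hx).le]
  have : -(1 / a) * -a = 1 := by field_simp
  rw [this, Real.rpow_one]

/-- The soliton, as a function of `s = e^x`. -/
noncomputable def soliton (a s₁ s : ℝ) : ℝ := Real.cosh (Real.log (s / s₁) / (2 * a)) ^ (-a)

lemma soliton_pos (a s₁ s : ℝ) : 0 < soliton a s₁ s :=
  Real.rpow_pos_of_pos (Real.cosh_pos _) _

lemma continuousOn_soliton (a : ℝ) {s₁ : ℝ} (hs₁ : 0 < s₁) :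
    ContinuousOn (soliton a s₁) (Set.Ioi 0) := by
  unfold soliton
  refine ContinuousOn.rpow_const ?_ fun s _ => Or.inl (Real.cosh_pos _).ne'
  refine Real.continuous_cosh.comp_continuousOn ((ContinuousOn.log (by fun_prop) ?_).div_const _)
  intro s hs
  exact (div_pos hs hs₁).ne'

/-- A function for which Nagy's defect vanishes lies above a soliton. -/
theorem soliton_le_of_nagyDefect_eq_zero {a : ℝ} (ha : 0 < a) {h : ℝ → ℝ}
    (hh : MemLp h 2 volume) {y : ℝ → ℝ} (hy : ∀ s, y s = (∫ r in (0 : ℝ)..s, h r) / √s)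
    (hy1 : ∀ s > 0, |y s| ≤ 1) {s₀ : ℝ} (hs₀ : 0 < s₀) (hys₀ : y s₀ = 1)
    (hQ : ∫ s in Set.Ioi (0 : ℝ), nagyDefect (2 + 2 / a) s₀ h y s = 0) :
    ∃ s₁ > 0, ∀ s > 0, soliton a s₁ s ≤ y s := by
  set p := 2 + 2 / a with hp
  have hp2 : 2 < p := by rw [hp]; have : 0 < 2 / a := by positivity
                         linarith
  have hyeq : y = fun s => (∫ r in (0 : ℝ)..s, h r) / √s := funext hy
  have hycont : ContinuousOn y (Set.Ioi 0) := by
    rw [hyeq]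
    exact (continuous_primitive_of_memLp_two hh).continuousOn.div
      Real.continuous_sqrt.continuousOn fun s hs => (Real.sqrt_pos.2 hs).ne'
  have hae : ∀ᵐ s, s ∈ Set.Ioi (0 : ℝ) → √s * h s - y s / 2 =
      (if s ≤ s₀ then 1 else -1) * nagyRoot p (y s) := by
    have h1 := (setIntegral_eq_zero_iff_of_nonneg_ae
      ((ae_restrict_iff' measurableSet_Ioi).2 (Eventually.of_forall fun s hs =>
        nagyDefect_nonneg hs)) (nagy_identity hp2 hh hy hy1 hs₀ hys₀).2.1).1 hQ
    filter_upwards [(ae_restrict_iff' measurableSet_Ioi).1 h1] with s hs hs0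
    have h2 := hs hs0
    have hs0' : (0 : ℝ) < s := hs0
    simp only [nagyDefect, Pi.zero_apply, div_eq_zero_iff, hs0'.ne', or_false] at h2
    exact sub_eq_zero.1 (pow_eq_zero_iff (two_ne_zero) |>.1 h2)
  -- The equation for y is known only almost everywhere. Its integral form has a continuous
  -- integrand, which makes y differentiable on each side of s₀.
  have hinc : ∀ τ α β : ℝ, 0 < α → α ≤ β →
      (∀ s ∈ Set.Ioc α β, (if s ≤ s₀ then (1 : ℝ) else -1) = τ) →
      y β - y α = ∫ s in α..β, τ * nagyRoot p (y s) / s := by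
    intro τ α β hα hab hτ
    have h1 := (integral_deriv_comp_primitive hh (Ψ := id) (Ψ' := fun _ => 1)
      (fun z => hasDerivAt_id z) continuous_const hα hab hy).2
    simp only [id, one_mul] at h1
    rw [← h1]
    refine intervalIntegral.integral_congr_ae ?_
    filter_upwards [hae] with s hs hm
    rw [Set.uIoc_of_le hab] at hm
    rw [hs (hα.trans hm.1), hτ s hm]
  have hrc : ∀ τ : ℝ, ContinuousOn (fun s => τ * nagyRoot p (y s) / s) (Set.Ioi 0) := fun τ =>
    (continuousOn_const.mul ((continuous_nagyRoot hp2).comp_continuousOn hycont)).div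
      continuousOn_id fun s hs => (show (0 : ℝ) < s from hs).ne'
  have hFTC : ∀ τ c : ℝ, 0 < c → ∀ s > 0,
      HasDerivAt (fun s => ∫ r in c..s, τ * nagyRoot p (y r) / r) (τ * nagyRoot p (y s) / s) s := by
    intro τ c hc s hs
    refine intervalIntegral.integral_hasDerivAt_right ?_
      ((hrc τ).stronglyMeasurableAtFilter isOpen_Ioi s hs) ((hrc τ).continuousAt (Ioi_mem_nhds hs))
    refine ((hrc τ).mono fun r hr => ?_).intervalIntegrable
    exact (lt_min hc hs).trans_le hr.1
  have hR : ∀ s > s₀, HasDerivAt y (-1 * nagyRoot p (y s) / s) s := by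
    intro s hs
    have h1 := (hFTC (-1) s₀ hs₀ s (hs₀.trans hs)).const_add (y s₀)
    refine h1.congr_of_eventuallyEq ?_
    filter_upwards [Ioi_mem_nhds hs] with r hr
    rw [← hinc (-1) s₀ r hs₀ (le_of_lt hr) fun z hz => if_neg (not_le.2 hz.1)]
    ring
  have hLd : ∀ s > 0, s < s₀ → HasDerivAt y (1 * nagyRoot p (y s) / s) s := by
    intro s hs hlt
    have h1 := (hFTC 1 (s / 2) (by positivity) s hs).const_add (y (s / 2))
    refine h1.congr_of_eventuallyEq ?_
    filter_upwards [Ioo_mem_nhds (show s / 2 < s by linarith) hlt] with r hr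
    rw [← hinc 1 (s / 2) r (by positivity) hr.1.le fun z hz => if_pos (hz.2.trans hr.2.le)]
    ring
  -- In x = log(s/s₀) the right half solves the equation; the left half does so after x ↦ -x. Each
  -- half may have its own plateau.
  obtain ⟨x₁, hx₁, hY₁⟩ := nagy_ode_eq ha (Y := fun x => y (s₀ * Real.exp x))
    (hycont.comp (by fun_prop) fun x _ => mul_pos hs₀ (Real.exp_pos x)) (by simp [hys₀])
    (fun x hx => by
      have he : HasDerivAt (fun x => s₀ * Real.exp x) (s₀ * Real.exp x) x :=
        (Real.hasDerivAt_exp x).const_mul s₀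
      have hgt : s₀ < s₀ * Real.exp x := by
        have := Real.one_lt_exp_iff.2 hx
        nlinarith
      refine ((hR _ hgt).comp x he).congr_deriv ?_
      have := Real.exp_pos x
      rw [div_mul_cancel₀ _ (mul_pos hs₀ this).ne', neg_one_mul])
    ((by
      rw [hyeq]
      exact (tendsto_primitive_div_sqrt_atTop hh).comp
        (Real.tendsto_exp_atTop.const_mul_atTop hs₀)))
  obtain ⟨x₂, hx₂, hY₂⟩ := nagy_ode_eq ha (Y := fun x => y (s₀ * Real.exp (-x)))
    (hycont.comp (by fun_prop) fun x _ => mul_pos hs₀ (Real.exp_pos _)) (by simp [hys₀])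
    (fun x hx => by
      have he : HasDerivAt (fun x => s₀ * Real.exp (-x)) (s₀ * (Real.exp (-x) * -1)) x :=
        ((hasDerivAt_neg x).exp).const_mul s₀
      have hlt : s₀ * Real.exp (-x) < s₀ := by
        have := Real.exp_lt_one_iff.2 (show -x < 0 by linarith)
        nlinarith
      refine ((hLd _ (mul_pos hs₀ (Real.exp_pos _)) hlt).comp x he).congr_deriv ?_
      have := Real.exp_pos (-x)
      rw [mul_neg_one, mul_neg, mul_neg, div_mul_cancel₀ _ (mul_pos hs₀ this).ne', one_mul])
    ((by
      rw [hyeq]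
      refine (tendsto_primitive_div_sqrt_zero hh).comp (tendsto_nhdsWithin_iff.2 ⟨?_,
        Eventually.of_forall fun x => mul_pos hs₀ (Real.exp_pos _)⟩)
      simpa using Real.tendsto_exp_neg_atTop_nhds_zero.const_mul s₀))
  -- The soliton centred at the right end of the plateau coincides with y to the right of it, and
  -- lies below y on the plateau and further left.
  refine ⟨s₀ * Real.exp x₁, mul_pos hs₀ (Real.exp_pos _), fun s hs => ?_⟩
  have hlog : Real.log (s / (s₀ * Real.exp x₁)) = Real.log (s / s₀) - x₁ := by
    rw [← div_div, Real.log_div (div_pos hs hs₀).ne' (Real.exp_pos _).ne', Real.log_exp]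
  set x := Real.log (s / s₀) with hx
  have hsx : s = s₀ * Real.exp x := by
    rw [hx, Real.exp_log (div_pos hs hs₀)]; field_simp
  have hcosh : ∀ u v : ℝ, |u| ≤ |v| →
      Real.cosh (v / (2 * a)) ^ (-a) ≤ Real.cosh (u / (2 * a)) ^ (-a) := by
    intro u v huv
    refine Real.rpow_le_rpow_of_nonpos (Real.cosh_pos _) (Real.cosh_le_cosh.2 ?_) (by linarith)
    rw [abs_div, abs_div]
    gcongr
  rw [soliton, hlog]
  rcases le_total 0 x with h | h
  · rw [hsx, hY₁ x h]
    refine hcosh _ _ ?_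
    rw [abs_of_nonneg (le_max_right _ _)]
    exact max_le (le_abs_self _) (abs_nonneg _)
  · have := hY₂ (-x) (by linarith)
    simp only [neg_neg] at this
    rw [hsx, this]
    refine hcosh _ _ ?_
    rw [abs_of_nonneg (le_max_right _ _)]
    refine max_le ?_ (abs_nonneg _)
    rw [abs_of_nonpos (by linarith)]
    linarith

/-! ### Derivative, energy and mass of the soliton -/

section Soliton

variable {a s₁ : ℝ} (ha : 0 < a) (hs₁ : 0 < s₁)

/-- The hyperbolic tangent in the derivative of the soliton. -/
noncomputable def solitonTanh (a s₁ s : ℝ) : ℝ := Real.tanh (Real.log (s / s₁) / (2 * a))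

lemma abs_solitonTanh_lt_one (a s₁ s : ℝ) : |solitonTanh a s₁ s| < 1 := Real.abs_tanh_lt_one _

lemma measurable_soliton (a s₁ : ℝ) : Measurable (soliton a s₁) := by
  unfold soliton
  exact ((Real.continuous_cosh.measurable.comp
    ((Real.measurable_log.comp (measurable_id.div_const _)).div_const _)).pow_const _)

lemma measurable_solitonTanh (a s₁ : ℝ) : Measurable (solitonTanh a s₁) := by
  have : Measurable fun x => Real.tanh x := by
    have : (fun x => Real.tanh x) = fun x => Real.sinh x / Real.cosh x :=
      funext fun x => Real.tanh_eq_sinh_div_cosh x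
    rw [this]
    exact Real.continuous_sinh.measurable.div Real.continuous_cosh.measurable
  exact this.comp ((Real.measurable_log.comp (measurable_id.div_const _)).div_const _)

lemma solitonTanh_sq (a s₁ s : ℝ) :
    solitonTanh a s₁ s ^ 2 = 1 - (Real.cosh (Real.log (s / s₁) / (2 * a)) ^ 2)⁻¹ := by
  rw [solitonTanh, Real.tanh_eq_sinh_div_cosh, div_pow, Real.sinh_sq]
  have := (Real.cosh_pos (Real.log (s / s₁) / (2 * a))).ne'
  field_simp

include ha hs₁

-- Here soliton^{2/a} = 1/cosh² = 1 - tanh². This is the first integral of the soliton equation: it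
-- makes `nagyRoot` at the soliton equal to soliton · |tanh| / 2.
omit hs₁ in
lemma soliton_rpow (s : ℝ) : soliton a s₁ s ^ (2 + 2 / a) =
    soliton a s₁ s ^ 2 * (1 - solitonTanh a s₁ s ^ 2) := by
  have hc := Real.cosh_pos (Real.log (s / s₁) / (2 * a))
  rw [solitonTanh_sq, sub_sub_cancel, Real.rpow_add (soliton_pos _ _ _), Real.rpow_two]
  congr 1
  rw [soliton, ← Real.rpow_mul hc.le, show -a * (2 / a) = -2 by field_simp, Real.rpow_neg hc.le,
    Real.rpow_two]

lemma hasDerivAt_soliton {s : ℝ} (hs : 0 < s) :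
    HasDerivAt (soliton a s₁) (-(soliton a s₁ s * solitonTanh a s₁ s) / (2 * s)) s := by
  have hc := Real.cosh_pos (Real.log (s / s₁) / (2 * a))
  have h1 : HasDerivAt (fun s => Real.log (s / s₁) / (2 * a)) (1 / (2 * a * s)) s := by
    have := (((hasDerivAt_id s).div_const s₁).log (div_pos hs hs₁).ne').div_const (2 * a)
    refine this.congr_deriv ?_
    simp only [id]
    field_simp
  have h2 := (h1.cosh).rpow_const (p := -a) (Or.inl hc.ne')
  refine h2.congr_deriv ?_
  rw [soliton, solitonTanh, Real.tanh_eq_sinh_div_cosh, Real.rpow_sub hc, Real.rpow_one]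
  field_simp

lemma hasDerivAt_solitonTanh {s : ℝ} (hs : 0 < s) :
    HasDerivAt (solitonTanh a s₁) ((1 - solitonTanh a s₁ s ^ 2) / (2 * a * s)) s := by
  have hc := Real.cosh_pos (Real.log (s / s₁) / (2 * a))
  have h1 : HasDerivAt (fun s => Real.log (s / s₁) / (2 * a)) (1 / (2 * a * s)) s := by
    have := (((hasDerivAt_id s).div_const s₁).log (div_pos hs hs₁).ne').div_const (2 * a)
    refine this.congr_deriv ?_
    simp only [id]
    field_simp
  have h2 := h1.sinh.div h1.cosh hc.ne'
  refine (h2.congr_deriv ?_).congr_of_eventuallyEq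
    (Eventually.of_forall fun s => Real.tanh_eq_sinh_div_cosh _)
  rw [solitonTanh_sq]
  have := Real.cosh_sq (Real.log (s / s₁) / (2 * a))
  field_simp
  rw [this]
  ring

omit hs₁ in
lemma soliton_le_one (s : ℝ) : soliton a s₁ s ≤ 1 := by
  rw [soliton]
  exact Real.rpow_le_one_of_one_le_of_nonpos (Real.one_le_cosh _) (by linarith)

omit ha in
lemma soliton_self : soliton a s₁ s₁ = 1 := by
  simp [soliton, hs₁.ne']

/-- From cosh θ ≥ e^{±θ}/2 and e^{2aθ} = s/s₁. The linear decay at both ends gives integrability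
against ds/s and the vanishing of boundary terms. -/
lemma soliton_sq_le {s : ℝ} (hs : 0 < s) :
    soliton a s₁ s ^ 2 ≤ 4 ^ a * (s / s₁) ∧ soliton a s₁ s ^ 2 ≤ 4 ^ a * (s₁ / s) := by
  set θ := Real.log (s / s₁) / (2 * a) with hθ
  have hc := Real.cosh_pos θ
  have hlog : θ * (2 * a) = Real.log (s / s₁) := by rw [hθ]; field_simp
  have hpos : 0 < s / s₁ := div_pos hs hs₁
  have hsq : soliton a s₁ s ^ 2 = Real.cosh θ ^ (-(2 * a)) := by
    rw [soliton, ← hθ, ← Real.rpow_natCast, ← Real.rpow_mul hc.le]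
    congr 1
    push_cast
    ring
  have key : ∀ u : ℝ, Real.exp u / 2 ≤ Real.cosh θ →
      soliton a s₁ s ^ 2 ≤ 4 ^ a * Real.exp (-(u * (2 * a))) := by
    intro u hu
    rw [hsq]
    calc _ ≤ (Real.exp u / 2) ^ (-(2 * a)) :=
          Real.rpow_le_rpow_of_nonpos (by positivity) hu (by linarith)
      _ = _ := by
          rw [Real.div_rpow (Real.exp_pos u).le two_pos.le, ← Real.exp_mul,
            Real.rpow_neg two_pos.le, Real.rpow_mul two_pos.le, div_inv_eq_mul, mul_comm]
          norm_num
  have hch := Real.cosh_eq θ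
  constructor
  · have := key (-θ) (by rw [hch]; linarith [Real.exp_pos θ])
    rwa [neg_mul, neg_neg, hlog, Real.exp_log hpos] at this
  · have := key θ (by rw [hch]; linarith [Real.exp_pos (-θ)])
    rwa [hlog, Real.exp_neg, Real.exp_log hpos, inv_div] at this

lemma tendsto_soliton_sq_zero : Tendsto (fun s => soliton a s₁ s ^ 2) (𝓝[>] 0) (𝓝 0) := by
  have h : Tendsto (fun s : ℝ => (4 : ℝ) ^ a * (s / s₁)) (𝓝[>] 0) (𝓝 0) := by
    have : Continuous fun s : ℝ => (4 : ℝ) ^ a * (s / s₁) := by fun_prop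
    simpa using (this.tendsto 0).mono_left (nhdsWithin_le_nhds (s := Set.Ioi 0))
  refine squeeze_zero' (Eventually.of_forall fun s => sq_nonneg _) ?_ h
  filter_upwards [self_mem_nhdsWithin] with s hs using (soliton_sq_le ha hs₁ hs).1

lemma tendsto_soliton_sq_atTop : Tendsto (fun s => soliton a s₁ s ^ 2) atTop (𝓝 0) := by
  have h : Tendsto (fun s : ℝ => (4 : ℝ) ^ a * (s₁ / s)) atTop (𝓝 0) := by
    simpa using (tendsto_id.const_div_atTop s₁).const_mul ((4 : ℝ) ^ a)
  refine squeeze_zero' (Eventually.of_forall fun s => sq_nonneg _) ?_ h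
  filter_upwards [eventually_gt_atTop 0] with s hs using (soliton_sq_le ha hs₁ hs).2

lemma integrableOn_soliton_sq_div :
    IntegrableOn (fun s => soliton a s₁ s ^ 2 / s) (Set.Ioi 0) := by
  have hm : Measurable fun s => soliton a s₁ s ^ 2 / s :=
    ((measurable_soliton a s₁).pow_const 2).div measurable_id
  rw [← Set.Ioc_union_Ioi_eq_Ioi hs₁.le]
  refine IntegrableOn.union ?_ ?_
  · refine Integrable.mono' (integrable_const (4 ^ a / s₁)) hm.aestronglyMeasurable
      ((ae_restrict_iff' measurableSet_Ioc).2 (Eventually.of_forall fun s hs => ?_))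
    have hs0 := hs.1
    rw [Real.norm_of_nonneg (by positivity), div_le_iff₀ hs0]
    calc _ ≤ _ := (soliton_sq_le ha hs₁ hs0).1
      _ = _ := by ring
  · refine Integrable.mono' (((integrableOn_Ioi_rpow_of_lt (show (-2 : ℝ) < -1 by norm_num)
      hs₁).const_mul (4 ^ a * s₁))) hm.aestronglyMeasurable
      ((ae_restrict_iff' measurableSet_Ioi).2 (Eventually.of_forall fun s hs => ?_))
    have hs0 : 0 < s := hs₁.trans hs
    rw [Real.norm_of_nonneg (by positivity), div_le_iff₀ hs0]
    calc _ ≤ _ := (soliton_sq_le ha hs₁ hs0).2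
      _ = _ := by
        rw [Real.rpow_neg hs0.le, Real.rpow_two]
        field_simp

omit ha hs₁ in
/-- The derivative of `√s · soliton`, extended by zero. -/
noncomputable def solitonDeriv (a s₁ : ℝ) : ℝ → ℝ :=
  (Set.Ioi 0).indicator fun s => soliton a s₁ s * (1 - solitonTanh a s₁ s) / (2 * √s)

omit ha hs₁ in
lemma solitonDeriv_of_pos {s : ℝ} (hs : 0 < s) : solitonDeriv a s₁ s =
    soliton a s₁ s * (1 - solitonTanh a s₁ s) / (2 * √s) :=
  Set.indicator_of_mem (show s ∈ Set.Ioi 0 from hs) _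

omit ha hs₁ in
lemma solitonDeriv_sq {s : ℝ} (hs : 0 < s) : solitonDeriv a s₁ s ^ 2 =
    soliton a s₁ s ^ 2 / s * ((1 - solitonTanh a s₁ s) ^ 2 / 4) := by
  rw [solitonDeriv_of_pos hs, div_pow, mul_pow, mul_pow, Real.sq_sqrt hs.le]
  field_simp
  norm_num

omit ha hs₁ in
lemma measurable_solitonDeriv (a s₁ : ℝ) : Measurable (solitonDeriv a s₁) := by
  refine Measurable.indicator ?_ measurableSet_Ioi
  exact ((measurable_soliton a s₁).mul (measurable_const.sub (measurable_solitonTanh a s₁))).div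
    (measurable_const.mul Real.continuous_sqrt.measurable)

lemma memLp_solitonDeriv : MemLp (solitonDeriv a s₁) 2 volume := by
  rw [memLp_two_iff_integrable_sq (measurable_solitonDeriv a s₁).aestronglyMeasurable]
  have h0 : (fun s => solitonDeriv a s₁ s ^ 2) =
      (Set.Ioi (0 : ℝ)).indicator fun s => solitonDeriv a s₁ s ^ 2 := by
    ext s
    by_cases hs : s ∈ Set.Ioi (0 : ℝ)
    · rw [Set.indicator_of_mem hs]
    · rw [Set.indicator_of_notMem hs, solitonDeriv, Set.indicator_of_notMem hs]; simp
  rw [h0, integrable_indicator_iff measurableSet_Ioi]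
  refine Integrable.mono' (integrableOn_soliton_sq_div ha hs₁)
    ((measurable_solitonDeriv a s₁).pow_const 2).aestronglyMeasurable
    ((ae_restrict_iff' measurableSet_Ioi).2 (Eventually.of_forall fun s hs => ?_))
  have hs0 : (0 : ℝ) < s := hs
  rw [Real.norm_of_nonneg (sq_nonneg _), solitonDeriv_sq hs0]
  have h1 := abs_lt.1 (abs_solitonTanh_lt_one a s₁ s)
  have h2 : (1 - solitonTanh a s₁ s) ^ 2 / 4 ≤ 1 := by nlinarith
  exact mul_le_of_le_one_right (by positivity) h2

lemma hasDerivAt_sqrt_mul_soliton {s : ℝ} (hs : 0 < s) :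
    HasDerivAt (fun s => √s * soliton a s₁ s) (solitonDeriv a s₁ s) s := by
  refine ((Real.hasDerivAt_sqrt hs.ne').mul (hasDerivAt_soliton ha hs₁ hs)).congr_deriv ?_
  rw [solitonDeriv_of_pos hs]
  have h1 : √s ≠ 0 := (Real.sqrt_pos.2 hs).ne'
  have h2 : √s * √s = s := Real.mul_self_sqrt hs.le
  field_simp
  rw [Real.sq_sqrt hs.le]
  ring

lemma integral_solitonDeriv {s : ℝ} (hs : 0 < s) :
    ∫ r in (0 : ℝ)..s, solitonDeriv a s₁ r = √s * soliton a s₁ s := by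
  have h := intervalIntegral.integral_eq_sub_of_hasDerivAt_of_tendsto hs
    (f := fun s => √s * soliton a s₁ s) (fun r hr => hasDerivAt_sqrt_mul_soliton ha hs₁ hr.1)
    ((memLp_solitonDeriv ha hs₁).intervalIntegrable_two 0 s) (fa := 0) (fb := √s * soliton a s₁ s)
    ?_ ?_
  · rw [h, sub_zero]
  · have h1 : Tendsto (fun s => √s) (𝓝[>] 0) (𝓝 0) := by
      simpa using (Real.continuous_sqrt.tendsto 0).mono_left (nhdsWithin_le_nhds (s := Set.Ioi 0))
    refine squeeze_zero' (Eventually.of_forall fun s =>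
      mul_nonneg (Real.sqrt_nonneg _) (soliton_pos _ _ _).le) (Eventually.of_forall fun s => ?_) h1
    exact mul_le_of_le_one_right (Real.sqrt_nonneg _) (soliton_le_one ha s)
  · exact ((hasDerivAt_sqrt_mul_soliton ha hs₁ hs).continuousAt.tendsto).mono_left
      nhdsWithin_le_nhds

omit hs₁ in
lemma two_lt_exponent : 2 < 2 + 2 / a := by
  have : 0 < 2 / a := by positivity
  linarith

/-- The mass and the energy of the soliton. -/
lemma soliton_integrals :
    IntegrableOn (fun s => soliton a s₁ s ^ (2 + 2 / a) / s) (Set.Ioi 0) ∧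
    ∫ s in Set.Ioi (0 : ℝ), soliton a s₁ s ^ (2 + 2 / a) / s = 16 * a * nagyPot (2 + 2 / a) 1 ∧
    ∫ s in Set.Ioi (0 : ℝ), solitonDeriv a s₁ s ^ 2 =
      (2 + 2 / a) / 8 * ∫ s in Set.Ioi (0 : ℝ), soliton a s₁ s ^ (2 + 2 / a) / s := by
  set p := 2 + 2 / a with hp
  have hp2 : 2 < p := two_lt_exponent ha
  have hh := memLp_solitonDeriv ha hs₁
  set y : ℝ → ℝ := fun s => (∫ r in (0 : ℝ)..s, solitonDeriv a s₁ r) / √s with hy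
  have hys : ∀ s > 0, y s = soliton a s₁ s := fun s hs => by
    simp only [hy]
    rw [integral_solitonDeriv ha hs₁ hs, mul_div_cancel_left₀ _ (Real.sqrt_pos.2 hs).ne']
  obtain ⟨hP, -, hid⟩ := nagy_identity hp2 hh (fun s => rfl) (y := y) (fun s hs => by
    rw [hys s hs, abs_of_pos (soliton_pos _ _ _)]; exact soliton_le_one ha s) hs₁ (by
    rw [hys s₁ hs₁, soliton_self hs₁])
  have hPc : Set.EqOn (fun s => |y s| ^ p / s) (fun s => soliton a s₁ s ^ p / s) (Set.Ioi 0) :=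
    fun s hs => by simp only [hys s hs, abs_of_pos (soliton_pos _ _ _)]
  -- For the soliton √s h - y/2 = -y tanh/2, which is ±`nagyRoot` with the sign changing precisely
  -- at s₁.
  have hQ : ∀ s ∈ Set.Ioi (0 : ℝ), nagyDefect p s₁ (solitonDeriv a s₁) y s = 0 := by
    intro s hs
    have hs0 : (0 : ℝ) < s := hs
    have hq : √s ≠ 0 := (Real.sqrt_pos.2 hs0).ne'
    have hT := abs_solitonTanh_lt_one a s₁ s
    have hroot : nagyRoot p (soliton a s₁ s) = soliton a s₁ s * |solitonTanh a s₁ s| / 2 := by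
      rw [nagyRoot, abs_of_pos (soliton_pos _ _ _), hp, soliton_rpow ha,
        show soliton a s₁ s ^ 2 - soliton a s₁ s ^ 2 * (1 - solitonTanh a s₁ s ^ 2) =
          (soliton a s₁ s * solitonTanh a s₁ s) ^ 2 by ring, Real.sqrt_sq_eq_abs, abs_mul,
        abs_of_pos (soliton_pos _ _ _)]
    have hsign : (if s ≤ s₁ then (1 : ℝ) else -1) * |solitonTanh a s₁ s| =
        -solitonTanh a s₁ s := by
      have hl : ∀ x : ℝ, Real.tanh x = Real.sinh x / Real.cosh x := Real.tanh_eq_sinh_div_cosh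
      split_ifs with h
      · have hlog : Real.log (s / s₁) / (2 * a) ≤ 0 := by
          have := Real.log_nonpos (div_pos hs0 hs₁).le ((div_le_one hs₁).2 h)
          exact div_nonpos_of_nonpos_of_nonneg this (by positivity)
        have : solitonTanh a s₁ s ≤ 0 := by
          rw [solitonTanh, hl]
          exact div_nonpos_of_nonpos_of_nonneg (Real.sinh_nonpos_iff.2 hlog) (Real.cosh_pos _).le
        rw [abs_of_nonpos this, one_mul]
      · have hlog : 0 ≤ Real.log (s / s₁) / (2 * a) := by
          have := Real.log_nonneg ((one_le_div hs₁).2 (not_le.1 h).le)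
          positivity
        have : 0 ≤ solitonTanh a s₁ s := by
          rw [solitonTanh, hl]
          exact div_nonneg (Real.sinh_nonneg_iff.2 hlog) (Real.cosh_pos _).le
        rw [abs_of_nonneg this, neg_one_mul]
    have e1 : √s * (soliton a s₁ s * (1 - solitonTanh a s₁ s) / (2 * √s)) =
        soliton a s₁ s * (1 - solitonTanh a s₁ s) / 2 := by field_simp
    have e2 : (if s ≤ s₁ then (1 : ℝ) else -1) * (soliton a s₁ s * |solitonTanh a s₁ s| / 2) =
        -(soliton a s₁ s * solitonTanh a s₁ s / 2) := by
      linear_combination soliton a s₁ s / 2 * hsign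
    rw [nagyDefect, hys s hs0, hroot, solitonDeriv_of_pos hs0, e1, e2]
    ring
  have hPi := setIntegral_congr_fun (μ := volume) measurableSet_Ioi hPc
  rw [hPi, setIntegral_congr_fun measurableSet_Ioi hQ, integral_zero, add_zero] at hid
  have hPint : IntegrableOn (fun s => soliton a s₁ s ^ p / s) (Set.Ioi 0) :=
    (integrableOn_congr_fun hPc measurableSet_Ioi).1 hP
  have hvirial : ∫ s in Set.Ioi (0 : ℝ), solitonDeriv a s₁ s ^ 2 =
      p / 8 * ∫ s in Set.Ioi (0 : ℝ), soliton a s₁ s ^ p / s := by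
    -- A virial identity: F vanishes at both ends and its derivative compares energy and mass. The
    -- value 0 at s = 0 has to be imposed, since `Real.log 0 = 0` would make the soliton equal to 1
    -- there.
    set F : ℝ → ℝ := fun s => if 0 < s then
      soliton a s₁ s ^ 2 * (1 - solitonTanh a s₁ s) / 2 else 0 with hF
    have hFpos : ∀ s > 0, F s = soliton a s₁ s ^ 2 * (1 - solitonTanh a s₁ s) / 2 :=
      fun s hs => if_pos hs
    have hF0 : F 0 = 0 := if_neg (lt_irrefl _)
    have hFb : ∀ s > 0, 0 ≤ F s ∧ F s ≤ soliton a s₁ s ^ 2 := by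
      intro s hs
      rw [hFpos s hs]
      have h1 := abs_lt.1 (abs_solitonTanh_lt_one a s₁ s)
      have h2 := sq_nonneg (soliton a s₁ s)
      constructor <;> nlinarith
    have hFd : ∀ s ∈ Set.Ioi (0 : ℝ), HasDerivAt F
        (solitonDeriv a s₁ s ^ 2 - p / 8 * (soliton a s₁ s ^ p / s)) s := by
      intro s hs
      have hs0 : (0 : ℝ) < s := hs
      have h1 := (((hasDerivAt_soliton ha hs₁ hs0).pow 2).mul
        ((hasDerivAt_solitonTanh ha hs₁ hs0).const_sub 1)).div_const 2
      have h2 : HasDerivAt F _ s := h1.congr_of_eventuallyEq (by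
        filter_upwards [Ioi_mem_nhds hs0] with r hr
        exact hFpos r hr)
      refine h2.congr_deriv ?_
      rw [solitonDeriv_sq hs0, soliton_rpow ha, hp]
      simp only [Pi.pow_apply]
      field_simp
      ring
    have hlim0 : ContinuousWithinAt F (Set.Ici 0) 0 := by
      rw [← continuousWithinAt_Ioi_iff_Ici, ContinuousWithinAt, hF0]
      refine squeeze_zero' ?_ ?_ (tendsto_soliton_sq_zero ha hs₁)
      · filter_upwards [self_mem_nhdsWithin] with s hs using (hFb s hs).1
      · filter_upwards [self_mem_nhdsWithin] with s hs using (hFb s hs).2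
    have hlim1 : Tendsto F atTop (𝓝 0) := by
      refine squeeze_zero' ?_ ?_ (tendsto_soliton_sq_atTop ha hs₁)
      · filter_upwards [eventually_gt_atTop 0] with s hs using (hFb s hs).1
      · filter_upwards [eventually_gt_atTop 0] with s hs using (hFb s hs).2
    have hi := (integrable_sq_of_memLp_two hh).integrableOn (s := Set.Ioi 0)
    have h3 := integral_Ioi_of_hasDerivAt_of_tendsto hlim0 hFd
      (hi.sub (hPint.const_mul (p / 8))) hlim1
    rw [integral_sub hi (hPint.const_mul _), integral_const_mul, hF0, sub_zero] at h3
    linarith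
  refine ⟨hPint, ?_, hvirial⟩
  rw [hvirial] at hid
  -- Nagy's identity without defect and the virial identity are two linear relations between energy
  -- and mass; together they determine the mass.
  have h4 : (p / 8 - 1 / 4) * ∫ s in Set.Ioi (0 : ℝ), soliton a s₁ s ^ p / s =
      4 * nagyPot p 1 := by linarith
  have h5 : p / 8 - 1 / 4 = 1 / (4 * a) := by rw [hp]; field_simp; ring
  rw [h5] at h4
  field_simp at h4
  linarith

end Soliton

/-- The mass of the soliton. -/
noncomputable def solitonMass (a : ℝ) : ℝ := 16 * a * nagyPot (2 + 2 / a) 1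

lemma solitonMass_pos {a : ℝ} (ha : 0 < a) : 0 < solitonMass a := by
  have h := soliton_integrals ha one_pos
  rw [solitonMass, ← h.2.1, setIntegral_pos_iff_support_of_nonneg_ae ?_ h.1]
  · have : Function.support (fun s => soliton a 1 s ^ (2 + 2 / a) / s) ∩ Set.Ioi 0 =
        Set.Ioi 0 := by
      refine Set.inter_eq_right.2 fun s hs => ?_
      have hs0 : (0 : ℝ) < s := hs
      exact (div_pos (Real.rpow_pos_of_pos (soliton_pos a 1 s) _) hs0).ne'
    rw [this]; simp
  · refine (ae_restrict_iff' measurableSet_Ioi).2 (Eventually.of_forall fun s hs => ?_)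
    have hs0 : (0 : ℝ) < s := hs
    exact (div_pos (Real.rpow_pos_of_pos (soliton_pos a 1 s) _) hs0).le

/-! ### Bliss's inequality and its equality cases -/

section Bliss

variable {a : ℝ} (ha : 0 < a) {h : ℝ → ℝ} (hh : MemLp h 2 volume)
  {y : ℝ → ℝ} (hy : ∀ s, y s = (∫ r in (0 : ℝ)..s, h r) / √s)

/-- Bernoulli's inequality for the exponent 2/p < 1 at 1 + x = P/Q: the concave power lies below its
tangent at P = Q, and touches it only there. -/
lemma bernoulli_mass {p P Q : ℝ} (hp : 2 < p) (hQ : 0 < Q) (hP : 0 ≤ P) :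
    p / 8 * Q ^ (1 - 2 / p) * P ^ (2 / p) ≤ P / 4 + (p - 2) / 8 * Q ∧
    (P / 4 + (p - 2) / 8 * Q ≤ p / 8 * Q ^ (1 - 2 / p) * P ^ (2 / p) → P = Q) := by
  have hp0 : 0 < p := by linarith
  have h2p : 2 / p < 1 := by rw [div_lt_one hp0]; exact hp
  have hx : -1 ≤ P / Q - 1 := by have : 0 ≤ P / Q := by positivity
                                 linarith
  have e1 : p / 8 * Q ^ (1 - 2 / p) * P ^ (2 / p) = p / 8 * Q * (1 + (P / Q - 1)) ^ (2 / p) := by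
    rw [add_sub_cancel, Real.div_rpow hP hQ.le, Real.rpow_sub hQ, Real.rpow_one]
    ring
  have e2 : P / 4 + (p - 2) / 8 * Q = p / 8 * Q * (1 + 2 / p * (P / Q - 1)) := by
    field_simp; ring
  rw [e1, e2]
  have hc : 0 < p / 8 * Q := by positivity
  constructor
  · exact mul_le_mul_of_nonneg_left
      (rpow_one_add_le_one_add_mul_self hx (by positivity) h2p.le) hc.le
  · intro hle
    by_contra hne
    have hne' : P / Q - 1 ≠ 0 := by
      intro h0
      apply hne
      field_simp at h0
      linarith
    have := rpow_one_add_lt_one_add_mul_self hx hne' (by positivity) h2p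
    have h3 := le_of_mul_le_mul_left hle hc
    linarith

include ha hh hy

/-- Bliss's inequality. -/
theorem bliss_inequality :
    IntegrableOn (fun s => |y s| ^ (2 + 2 / a) / s) (Set.Ioi 0) ∧
    (2 + 2 / a) / 8 * solitonMass a ^ (1 - 2 / (2 + 2 / a)) *
      (∫ s in Set.Ioi (0 : ℝ), |y s| ^ (2 + 2 / a) / s) ^ (2 / (2 + 2 / a)) ≤
      ∫ s in Set.Ioi (0 : ℝ), h s ^ 2 ∧
    (∫ s in Set.Ioi (0 : ℝ), h s ^ 2 ≤ (2 + 2 / a) / 8 * solitonMass a ^ (1 - 2 / (2 + 2 / a)) *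
      (∫ s in Set.Ioi (0 : ℝ), |y s| ^ (2 + 2 / a) / s) ^ (2 / (2 + 2 / a)) →
      (∃ s > 0, y s ≠ 0) → ∃ c ≠ 0, ∃ s₁ > 0, ∀ s > 0, y s = c * soliton a s₁ s) := by
  have hp2 : 2 < 2 + 2 / a := two_lt_exponent ha
  set p := 2 + 2 / a with hp
  have hp0 : 0 < p := by linarith
  have hQ := solitonMass_pos ha
  by_cases hne : ∃ s > 0, y s ≠ 0
  swap
  · push Not at hne
    have h0 : Set.EqOn (fun s => |y s| ^ p / s) (fun _ => 0) (Set.Ioi 0) := fun s hs => by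
      simp only [hne s hs, abs_zero]
      rw [Real.zero_rpow hp0.ne', zero_div]
    refine ⟨(integrableOn_congr_fun h0 measurableSet_Ioi).2 integrableOn_zero, ?_,
      fun _ h => ?_⟩
    · rw [setIntegral_congr_fun measurableSet_Ioi h0, integral_zero,
        Real.zero_rpow (by positivity), mul_zero]
      exact integral_nonneg fun s => sq_nonneg _
    · obtain ⟨s, hs, h⟩ := h
      exact absurd (hne s hs) h
  obtain ⟨s', hs', hys'⟩ := hne
  obtain ⟨s₀, hs₀, hV0, hmax⟩ := exists_max_primitive_div_sqrt hh hs' (fun h0 => hys' (by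
    rw [hy, h0, zero_div]))
  simp only [← hy] at hmax
  -- Division by the signed extremal value gives |z| ≤ 1 and z(s₀) = 1; both sides of the inequality
  -- are homogeneous of degree 2.
  set c := y s₀ with hc
  have hc0 : c ≠ 0 := by rw [hc, hy]; exact div_ne_zero hV0 (Real.sqrt_pos.2 hs₀).ne'
  have hcpos : 0 < |c| := abs_pos.2 hc0
  set g : ℝ → ℝ := fun s => c⁻¹ * h s with hg
  have hgL : MemLp g 2 volume := hh.const_mul _
  set z : ℝ → ℝ := fun s => c⁻¹ * y s with hz
  have hzg : ∀ s, z s = (∫ r in (0 : ℝ)..s, g r) / √s := fun s => by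
    simp only [hz, hg, hy]
    rw [intervalIntegral.integral_const_mul]
    ring
  have hz1 : ∀ s > 0, |z s| ≤ 1 := fun s hs => by
    simp only [hz]
    rw [abs_mul, abs_inv, inv_mul_le_iff₀ hcpos, mul_one]
    exact hmax s hs
  have hz0 : z s₀ = 1 := by simp only [hz]; rw [← hc, inv_mul_cancel₀ hc0]
  obtain ⟨hPz, hQz, hid⟩ := nagy_identity hp2 hgL hzg hz1 hs₀ hz0
  have hyz : ∀ s, |y s| ^ p / s = |c| ^ p * (|z s| ^ p / s) := fun s => by
    have : y s = c * z s := by simp only [hz]; field_simp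
    rw [this, abs_mul, Real.mul_rpow (abs_nonneg _) (abs_nonneg _)]
    ring
  have hhg : ∀ s, h s ^ 2 = |c| ^ 2 * g s ^ 2 := fun s => by
    simp only [hg]
    rw [sq_abs]
    field_simp
  simp only [hyz, hhg]
  rw [integral_const_mul, integral_const_mul]
  set P := ∫ s in Set.Ioi (0 : ℝ), |z s| ^ p / s with hP
  set E := ∫ s in Set.Ioi (0 : ℝ), g s ^ 2 with hE
  set D := ∫ s in Set.Ioi (0 : ℝ), nagyDefect p s₀ g z s with hD
  have hP0 : 0 ≤ P := setIntegral_nonneg measurableSet_Ioi fun s hs => by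
    have hs0 : (0 : ℝ) < s := hs
    positivity
  have hD0 : 0 ≤ D := setIntegral_nonneg measurableSet_Ioi fun s hs => nagyDefect_nonneg hs
  -- Since p - 2 = 2/a, this is how the mass 16aΦ(1) was chosen: it makes the constant term of
  -- Nagy's identity the one in `bernoulli_mass`.
  have hpot : 4 * nagyPot p 1 = (p - 2) / 8 * solitonMass a := by
    rw [solitonMass, ← hp, hp]; field_simp; ring
  rw [hpot] at hid
  obtain ⟨b1, b2⟩ := bernoulli_mass hp2 hQ hP0
  have hscale : p / 8 * solitonMass a ^ (1 - 2 / p) * (|c| ^ p * P) ^ (2 / p) =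
      |c| ^ 2 * (p / 8 * solitonMass a ^ (1 - 2 / p) * P ^ (2 / p)) := by
    rw [Real.mul_rpow (by positivity) hP0, ← Real.rpow_mul hcpos.le,
      mul_div_cancel₀ _ hp0.ne', Real.rpow_two]
    ring
  rw [hscale]
  have hc2 : 0 < |c| ^ 2 := by positivity
  refine ⟨hPz.const_mul _, mul_le_mul_of_nonneg_left (by linarith) hc2.le, fun hle _ => ?_⟩
  have hle' := le_of_mul_le_mul_left hle hc2
  -- Two inequalities were used, D ≥ 0 and Bernoulli's; both are now equalities.
  have hDz : D = 0 := by linarith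
  have hPQ : P = solitonMass a := b2 (by linarith)
  obtain ⟨s₁, hs₁, hsol⟩ := soliton_le_of_nagyDefect_eq_zero ha hgL hzg hz1 hs₀ hz0 hDz
  refine ⟨c, hc0, s₁, hs₁, ?_⟩
  obtain ⟨hSi, hSm, -⟩ := soliton_integrals ha hs₁
  have hzc : ContinuousOn z (Set.Ioi 0) := by
    rw [show z = fun s => (∫ r in (0 : ℝ)..s, g r) / √s from funext hzg]
    exact (continuous_primitive_of_memLp_two hgL).continuousOn.div
      Real.continuous_sqrt.continuousOn fun s hs => (Real.sqrt_pos.2 hs).ne'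
  have hSle : ∀ s ∈ Set.Ioi (0 : ℝ), 0 ≤ |z s| ^ p / s - soliton a s₁ s ^ p / s := by
    intro s hs
    have hs0 : (0 : ℝ) < s := hs
    rw [← sub_div]
    refine div_nonneg (sub_nonneg.2 ?_) hs0.le
    exact Real.rpow_le_rpow (soliton_pos _ _ _).le ((hsol s hs0).trans (le_abs_self _)) hp0.le
  -- The function z lies above a soliton of the same mass, so the two agree almost everywhere, and
  -- everywhere by continuity.
  have hzero : ∫ s in Set.Ioi (0 : ℝ), (|z s| ^ p / s - soliton a s₁ s ^ p / s) = 0 := by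
    rw [integral_sub hPz hSi, hSm, ← hP, hPQ, solitonMass]
    simp
  have hae := (setIntegral_eq_zero_iff_of_nonneg_ae ((ae_restrict_iff' measurableSet_Ioi).2
    (Eventually.of_forall hSle)) (hPz.sub hSi)).1 hzero
  have hae2 : ∀ᵐ s ∂volume.restrict (Set.Ioi (0 : ℝ)), z s = soliton a s₁ s := by
    filter_upwards [hae, ae_restrict_mem measurableSet_Ioi] with s hs hs0
    have hs0' : (0 : ℝ) < s := hs0
    simp only [Pi.zero_apply, ← sub_div, div_eq_zero_iff, hs0'.ne', or_false] at hs
    have h1 : |z s| ^ p = soliton a s₁ s ^ p := by linarith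
    have h2 := (Real.rpow_left_inj (abs_nonneg _) (soliton_pos _ _ _).le hp0.ne').1 h1
    rw [← h2, abs_of_nonneg ((soliton_pos _ _ _).le.trans (hsol s hs0'))]
  have heq : Set.EqOn z (soliton a s₁) (Set.Ioi 0) :=
    Measure.eqOn_of_ae_eq hae2 hzc (continuousOn_soliton a hs₁)
      (by rw [isOpen_Ioi.interior_eq]; exact subset_closure)
  intro s hs
  rw [← heq hs]
  simp only [hz]
  field_simp

end Bliss

/-! ### Logarithmic polar coordinates -/

section Polar

variable {N : ℕ} {R : ℝ}

/-- The surface measure of the unit sphere. -/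
noncomputable abbrev sphereMeasure (N : ℕ) : Measure (Metric.sphere (0 : Euc N) 1) :=
  (volume : Measure (Euc N)).toSphere

/-- The area of the unit sphere. -/
noncomputable def sphereArea (N : ℕ) : ℝ := N * volume.real (Metric.ball (0 : Euc N) 1)

lemma sphereMeasure_real_univ (N : ℕ) : (sphereMeasure N).real Set.univ = sphereArea N := by
  rw [Measure.toSphere_real_apply_univ, sphereArea, finrank_euclideanSpace_fin]

lemma sphereArea_pos (hN : 3 ≤ N) : 0 < sphereArea N := by
  have : (0 : ℝ) < N := by exact_mod_cast (by omega : 0 < N)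
  exact mul_pos this (ENNReal.toReal_pos (Metric.measure_ball_pos _ _ one_pos).ne'
    measure_ball_lt_top.ne)

/-- The measure `(R e^{-s})^N ds` on `(0, ∞)`. -/
noncomputable def logRadialMeasure (N : ℕ) (R : ℝ) : Measure ℝ :=
  (volume.restrict (Set.Ioi 0)).withDensity fun s => ENNReal.ofReal ((R * Real.exp (-s)) ^ N)

/-- The point of the ball with logarithmic polar coordinates `(s, θ)`. -/
noncomputable def logPolar (R : ℝ) (z : ℝ × Metric.sphere (0 : Euc N) 1) : Euc N :=
  (R * Real.exp (-z.1)) • (z.2 : Euc N)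

lemma continuous_logPolar : Continuous (logPolar (N := N) R) := by
  unfold logPolar
  fun_prop

lemma norm_logPolar (hR : 0 < R) (z : ℝ × Metric.sphere (0 : Euc N) 1) :
    ‖logPolar R z‖ = R * Real.exp (-z.1) := by
  rw [logPolar, norm_smul, norm_eq_of_mem_sphere, mul_one, Real.norm_of_nonneg (by positivity)]

lemma lintegral_polar (hN : 3 ≤ N) {f : Euc N → ENNReal} (hf : Measurable f) :
    ∫⁻ x, f x = ∫⁻ θ, (∫⁻ r in Set.Ioi (0 : ℝ), ENNReal.ofReal (r ^ (N - 1)) *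
      f (r • (θ : Euc N))) ∂(sphereMeasure N) := by
  have : Nontrivial (Euc N) := by
    have : Nonempty (Fin N) := ⟨⟨0, by omega⟩⟩
    infer_instance
  have h := ((volume : Measure (Euc N)).measurePreserving_homeomorphUnitSphereProd)
  have h0 : ∫⁻ x, f x = ∫⁻ x in ({0}ᶜ : Set (Euc N)), f x := by
    rw [← setLIntegral_univ]
    refine setLIntegral_congr ?_
    exact (compl_mem_ae_iff.2 (by simp : volume ({0} : Set (Euc N)) = 0) |> fun h =>
      (eventuallyEq_univ.2 h)).symm
  rw [h0, ← lintegral_subtype_comap (measurableSet_singleton _).compl]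
  have h1 : ∫⁻ x : ({0}ᶜ : Set (Euc N)), f x ∂(Measure.comap Subtype.val volume) =
      ∫⁻ z, f ((homeomorphUnitSphereProd (Euc N)).symm z : Euc N)
        ∂((sphereMeasure N).prod (Measure.volumeIoiPow (Module.finrank ℝ (Euc N) - 1))) := by
    rw [← h.map_eq, (homeomorphUnitSphereProd (Euc N)).measurableEmbedding.lintegral_map]
    simp
  have hm : Measurable fun z : Metric.sphere (0 : Euc N) 1 × Set.Ioi (0 : ℝ) =>
      f ((homeomorphUnitSphereProd (Euc N)).symm z : Euc N) :=
    hf.comp (measurable_subtype_coe.comp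
      (homeomorphUnitSphereProd (Euc N)).symm.continuous.measurable)
  rw [h1, lintegral_prod _ hm.aemeasurable, finrank_euclideanSpace_fin]
  refine lintegral_congr fun θ => ?_
  have hm' : Measurable fun r : Set.Ioi (0 : ℝ) => ENNReal.ofReal (r.1 ^ (N - 1)) := by fun_prop
  have hmθ : Measurable fun r : Set.Ioi (0 : ℝ) =>
      f ((homeomorphUnitSphereProd (Euc N)).symm (θ, r) : Euc N) := hm.comp measurable_prodMk_left
  rw [Measure.volumeIoiPow, lintegral_withDensity_eq_lintegral_mul _ hm' hmθ]
  rw [← lintegral_subtype_comap measurableSet_Ioi]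
  rfl

lemma image_logRadius (hR : 0 < R) :
    (fun s => R * Real.exp (-s)) '' Set.Ioi 0 = Set.Ioo 0 R := by
  ext r
  constructor
  · rintro ⟨s, hs, rfl⟩
    have : Real.exp (-s) < 1 := by
      rw [← Real.exp_zero]
      exact Real.exp_lt_exp.2 (neg_lt_zero.2 hs)
    exact ⟨by positivity, by nlinarith⟩
  · rintro ⟨h0, h1⟩
    refine ⟨-Real.log (r / R), ?_, ?_⟩
    · exact neg_pos.2 (Real.log_neg (by positivity) ((div_lt_one hR).2 h1))
    · dsimp only
      rw [neg_neg, Real.exp_log (by positivity)]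
      field_simp

lemma hasDerivAt_logRadius (s : ℝ) :
    HasDerivAt (fun s => R * Real.exp (-s)) (-(R * Real.exp (-s))) s := by
  have := ((Real.hasDerivAt_exp (-s)).comp s (hasDerivAt_neg s)).const_mul R
  exact this.congr_deriv (by ring)

lemma injOn_logRadius (hR : 0 < R) (t : Set ℝ) : Set.InjOn (fun s => R * Real.exp (-s)) t := by
  intro s _ r _ h
  exact neg_injective (Real.exp_injective (mul_left_cancel₀ hR.ne' h))

/-- For r = R e^{-s} one has |dr| = r ds, so the density r^{N-1} dr becomes r^N ds; s > 0
corresponds to r < R. -/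
theorem measurePreserving_logPolar (hN : 3 ≤ N) (hR : 0 < R) :
    MeasurePreserving (logPolar (N := N) R) ((logRadialMeasure N R).prod (sphereMeasure N))
      (ballMeasure N R) := by
  have hmd : Measurable fun s : ℝ => ENNReal.ofReal ((R * Real.exp (-s)) ^ N) := by fun_prop
  have : SFinite (logRadialMeasure N R) := by unfold logRadialMeasure; infer_instance
  refine ⟨continuous_logPolar.measurable, ?_⟩
  refine Measure.ext_of_lintegral _ fun f hf => ?_
  rw [lintegral_map hf continuous_logPolar.measurable,
    lintegral_prod_symm (fun z => f (logPolar R z))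
      (hf.comp continuous_logPolar.measurable).aemeasurable, ballMeasure,
    ← lintegral_indicator Metric.isOpen_ball.measurableSet,
    lintegral_polar hN (hf.indicator Metric.isOpen_ball.measurableSet)]
  refine lintegral_congr fun θ => ?_
  have hfθ : Measurable fun s => f (logPolar R (s, θ)) :=
    hf.comp (continuous_logPolar.measurable.comp measurable_prodMk_right)
  rw [logRadialMeasure, lintegral_withDensity_eq_lintegral_mul _ hmd hfθ]
  have h1 : ∀ r ∈ Set.Ioi (0 : ℝ), ENNReal.ofReal (r ^ (N - 1)) *
      (Metric.ball 0 R).indicator f (r • (θ : Euc N)) = (Set.Iio R).indicator (fun r =>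
        ENNReal.ofReal (r ^ (N - 1)) * f (r • (θ : Euc N))) r := by
    intro r hr
    have hr0 : (0 : ℝ) < r := hr
    have : r • (θ : Euc N) ∈ Metric.ball 0 R ↔ r ∈ Set.Iio R := by
      rw [mem_ball_zero_iff, norm_smul, norm_eq_of_mem_sphere, mul_one, Real.norm_of_nonneg hr0.le,
        Set.mem_Iio]
    by_cases h : r ∈ Set.Iio R
    · rw [Set.indicator_of_mem h, Set.indicator_of_mem (this.2 h)]
    · rw [Set.indicator_of_notMem h, Set.indicator_of_notMem (this.not.2 h), mul_zero]
  rw [setLIntegral_congr_fun measurableSet_Ioi h1, lintegral_indicator measurableSet_Iio,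
    Measure.restrict_restrict measurableSet_Iio, Set.Iio_inter_Ioi, ← image_logRadius hR,
    lintegral_image_eq_lintegral_abs_deriv_mul measurableSet_Ioi
      (fun s _ => (hasDerivAt_logRadius s).hasDerivWithinAt) (injOn_logRadius hR _)]
  refine lintegral_congr fun s => ?_
  simp only [Pi.mul_apply, logPolar]
  have : 0 < R * Real.exp (-s) := by positivity
  rw [← mul_assoc, abs_neg, abs_of_pos this, ← ENNReal.ofReal_mul this.le, ← pow_succ',
    Nat.sub_add_cancel (by omega)]

lemma nontrivial_euc (hN : 3 ≤ N) : Nontrivial (Euc N) := by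
  have : Nonempty (Fin N) := ⟨⟨0, by omega⟩⟩
  infer_instance

lemma indicator_norm_eq (R : ℝ) (g : ℝ → ℝ) : (fun x : Euc N => (Set.Iio R).indicator g ‖x‖) =
    (Metric.ball 0 R).indicator fun x => g ‖x‖ := by
  ext x
  by_cases h : ‖x‖ < R
  · rw [Set.indicator_of_mem (show ‖x‖ ∈ Set.Iio R from h),
      Set.indicator_of_mem (mem_ball_zero_iff.2 h)]
  · rw [Set.indicator_of_notMem (show ‖x‖ ∉ Set.Iio R from h),
      Set.indicator_of_notMem (fun h' => h (mem_ball_zero_iff.1 h'))]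

lemma integral_ball_radial (hN : 3 ≤ N) (hR : 0 < R) (g : ℝ → ℝ) :
    ∫ x, g ‖x‖ ∂(ballMeasure N R) = sphereArea N *
      ∫ s in Set.Ioi (0 : ℝ), (R * Real.exp (-s)) ^ N * g (R * Real.exp (-s)) := by
  have := nontrivial_euc hN
  have h1 := indicator_norm_eq (N := N) R g
  rw [ballMeasure, ← integral_indicator Metric.isOpen_ball.measurableSet, ← h1,
    integral_fun_norm_addHaar volume ((Set.Iio R).indicator g), finrank_euclideanSpace_fin]
  have h2 : (fun y : ℝ => y ^ (N - 1) • (Set.Iio R).indicator g y) =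
      (Set.Iio R).indicator fun y => y ^ (N - 1) * g y := by
    ext y
    simp only [Set.indicator_apply, smul_eq_mul]
    split_ifs <;> simp
  rw [h2, setIntegral_indicator measurableSet_Iio, Set.Ioi_inter_Iio, ← image_logRadius hR,
    integral_image_eq_integral_abs_deriv_smul measurableSet_Ioi
      (fun s _ => (hasDerivAt_logRadius s).hasDerivWithinAt) (injOn_logRadius hR _), sphereArea,
    nsmul_eq_mul, smul_eq_mul, mul_assoc]
  congr 2
  refine setIntegral_congr_fun measurableSet_Ioi fun s _ => ?_
  have : 0 < R * Real.exp (-s) := by positivity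
  simp only [smul_eq_mul]
  rw [← mul_assoc, abs_neg, abs_of_pos this, ← pow_succ', Nat.sub_add_cancel (by omega)]

lemma integrable_ball_radial (hN : 3 ≤ N) (hR : 0 < R) (g : ℝ → ℝ) :
    Integrable (fun x => g ‖x‖) (ballMeasure N R) ↔
      IntegrableOn (fun s => (R * Real.exp (-s)) ^ N * g (R * Real.exp (-s))) (Set.Ioi 0) := by
  have := nontrivial_euc hN
  have h1 := indicator_norm_eq (N := N) R g
  rw [ballMeasure, ← IntegrableOn, ← integrable_indicator_iff Metric.isOpen_ball.measurableSet,
    ← h1, integrable_fun_norm_addHaar volume (f := (Set.Iio R).indicator g),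
    finrank_euclideanSpace_fin]
  have h2 : (fun y : ℝ => y ^ (N - 1) • (Set.Iio R).indicator g y) =
      (Set.Iio R).indicator fun y => y ^ (N - 1) * g y := by
    ext y
    simp only [Set.indicator_apply, smul_eq_mul]
    split_ifs <;> simp
  rw [h2, IntegrableOn, integrable_indicator_iff measurableSet_Iio, IntegrableOn,
    Measure.restrict_restrict measurableSet_Iio, Set.Iio_inter_Ioi, ← image_logRadius hR,
    ← IntegrableOn,
    integrableOn_image_iff_integrableOn_abs_deriv_smul measurableSet_Ioi
      (fun s _ => (hasDerivAt_logRadius s).hasDerivWithinAt) (injOn_logRadius hR _)]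
  refine integrableOn_congr_fun (fun s _ => ?_) measurableSet_Ioi
  have : 0 < R * Real.exp (-s) := by positivity
  simp only [smul_eq_mul]
  rw [← mul_assoc, abs_neg, abs_of_pos this, ← pow_succ', Nat.sub_add_cancel (by omega)]

/-- Polar integration on the whole space in the variable `s = |y|^{-(N-2)}`. -/
lemma integral_euc_radial (hN : 3 ≤ N) (g : ℝ → ℝ) :
    ∫ y : Euc N, g ‖y‖ = sphereArea N / (N - 2) *
      ∫ s in Set.Ioi (0 : ℝ), s ^ (-(2 * ((N : ℝ) - 1) / (N - 2))) * g (s ^ (-(1 / ((N : ℝ) - 2)))) := by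
  have := nontrivial_euc hN
  have hN' : (3 : ℝ) ≤ N := by exact_mod_cast hN
  have hN2 : (0 : ℝ) < N - 2 := by linarith
  have hp : -(1 / ((N : ℝ) - 2)) ≠ 0 := neg_ne_zero.2 (by positivity)
  rw [integral_fun_norm_addHaar volume g, finrank_euclideanSpace_fin,
    ← integral_comp_rpow_Ioi _ hp, sphereArea, nsmul_eq_mul, smul_eq_mul, div_mul_eq_mul_div,
    mul_div_assoc, ← mul_assoc, ← integral_div]
  congr 1
  refine setIntegral_congr_fun measurableSet_Ioi fun s hs => ?_
  have hs0 : (0 : ℝ) < s := hs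
  simp only [smul_eq_mul]
  rw [abs_neg, abs_of_pos (by positivity : 0 < 1 / ((N : ℝ) - 2)), ← Real.rpow_natCast (s ^ _),
    ← Real.rpow_mul hs0.le, Nat.cast_sub (by omega : 1 ≤ N), Nat.cast_one,
    show -(2 * ((N : ℝ) - 1) / (N - 2)) = (-(1 / ((N : ℝ) - 2)) - 1) + -(1 / ((N : ℝ) - 2)) * (N - 1)
      by field_simp; ring, Real.rpow_add hs0]
  ring

end Polar

/-! ### Profiles and the transformation between u and w -/

section RadialTransform

variable {N : ℕ} {R : ℝ} {V : ℝ → ℝ}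

/-- `V ∈ C_c^∞(0, ∞)`. -/
def IsProfile (V : ℝ → ℝ) : Prop :=
  ContDiff ℝ ∞ V ∧ ∃ c > 0, ∃ d > 0, ∀ s, V s ≠ 0 → c ≤ s ∧ s ≤ d

lemma IsProfile.eq_zero (hV : IsProfile V) {s : ℝ} (hs : s ≤ 0) : V s = 0 := by
  obtain ⟨-, c, hc, d, hd, h⟩ := hV
  by_contra hne
  linarith [(h s hne).1]

lemma IsProfile.hasCompactSupport (hV : IsProfile V) : HasCompactSupport V := by
  obtain ⟨-, c, hc, d, hd, h⟩ := hV
  exact HasCompactSupport.intro (isCompact_Icc (a := c) (b := d)) fun s hs => by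
    by_contra hne
    exact hs (h s hne)

/-- The function `|x|^{-(N-2)/2} V(-log (|x|/R))` on the ball. -/
noncomputable def ballProfile (N : ℕ) (R : ℝ) (V : ℝ → ℝ) (x : Euc N) : ℝ :=
  ‖x‖ ^ (-(((N : ℝ) - 2) / 2)) * V (-Real.log (‖x‖ / R))

/-- The function `V(|y|^{-(N-2)})` on the whole space. -/
noncomputable def spaceProfile (N : ℕ) (V : ℝ → ℝ) (y : Euc N) : ℝ :=
  V (‖y‖ ^ (-((N : ℝ) - 2)))

lemma isRadial_ballProfile : IsRadial (ballProfile N R V) := fun x y h => by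
  simp only [ballProfile, h]

lemma isRadial_spaceProfile : IsRadial (spaceProfile N V) := fun x y h => by
  simp only [spaceProfile, h]

/-- The norm is smooth off the origin, and near the origin the function is identically zero because
α > 0. -/
lemma isTest_radial {g : ℝ → ℝ} {α β : ℝ} {Ω : Set (Euc N)} (hα : 0 < α)
    (hg : ∀ r > 0, ContDiffAt ℝ ∞ g r) (hsupp : ∀ r ≥ 0, g r ≠ 0 → α ≤ r ∧ r ≤ β)
    (hΩ : ∀ x : Euc N, α ≤ ‖x‖ → ‖x‖ ≤ β → x ∈ Ω) : IsTest Ω fun x => g ‖x‖ := by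
  have hK : IsCompact {x : Euc N | α ≤ ‖x‖ ∧ ‖x‖ ≤ β} := by
    refine (isCompact_closedBall (0 : Euc N) β).of_isClosed_subset ?_ fun x hx =>
      mem_closedBall_zero_iff.2 hx.2
    exact (isClosed_le continuous_const continuous_norm).inter
      (isClosed_le continuous_norm continuous_const)
  have hzero : ∀ x : Euc N, x ∉ {x : Euc N | α ≤ ‖x‖ ∧ ‖x‖ ≤ β} → g ‖x‖ = 0 := by
    intro x hx
    by_contra h
    exact hx (hsupp _ (norm_nonneg _) h)
  refine ⟨?_, HasCompactSupport.intro hK hzero, ?_⟩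
  · rw [contDiff_iff_contDiffAt]
    intro x
    by_cases hx : x = 0
    · refine (contDiffAt_const (c := (0 : ℝ))).congr_of_eventuallyEq ?_
      filter_upwards [Metric.ball_mem_nhds x hα] with y hy
      refine hzero y fun h => ?_
      rw [hx, mem_ball_zero_iff] at hy
      exact absurd h.1 (not_le.2 hy)
    · exact (hg _ (norm_pos_iff.2 hx)).comp x (contDiffAt_norm ℝ hx)
  · refine (closure_minimal (fun x hx => ?_) hK.isClosed).trans fun x hx => hΩ x hx.1 hx.2
    by_contra h
    exact hx (hzero x h)

lemma isTest_ballProfile (hR : 0 < R) (hV : IsProfile V) :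
    IsTest (Metric.ball 0 R \ {0}) (ballProfile N R V) := by
  obtain ⟨hs, c, hc, d, hd, hsupp⟩ := hV
  refine isTest_radial (g := fun r => r ^ (-(((N : ℝ) - 2) / 2)) * V (-Real.log (r / R)))
    (α := R * Real.exp (-d)) (β := R * Real.exp (-c)) (by positivity) (fun r hr => ?_)
    (fun r hr h => ?_) (fun x hα hβ => ?_)
  · refine ((contDiffAt_id).rpow_const_of_ne hr.ne').mul ?_
    have : ContDiffAt ℝ ∞ (fun r => -Real.log (r / R)) r :=
      ((contDiffAt_id.div_const R).log (div_pos hr hR).ne').neg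
    exact hs.contDiffAt.comp r this
  · have h1 := hsupp _ (right_ne_zero_of_mul h)
    -- At r = 0 the convention `Real.log 0 = 0` puts the argument of V at 0, outside its support.
    have hr0 : 0 < r := by
      refine lt_of_le_of_ne hr fun h0 => ?_
      rw [← h0, zero_div, Real.log_zero, neg_zero] at h1
      linarith [h1.1]
    have hq : 0 < r / R := div_pos hr0 hR
    constructor
    · rw [mul_comm, ← le_div_iff₀ hR, ← Real.le_log_iff_exp_le hq]
      linarith [h1.2]
    · rw [mul_comm, ← div_le_iff₀ hR, ← Real.log_le_iff_le_exp hq]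
      linarith [h1.1]
  · have h1 : Real.exp (-c) < 1 := by
      rw [← Real.exp_zero]
      exact Real.exp_lt_exp.2 (by linarith)
    refine ⟨mem_ball_zero_iff.2 (by nlinarith), fun h0 => ?_⟩
    have h2 : x = 0 := h0
    rw [h2, norm_zero] at hα
    have : 0 < R * Real.exp (-d) := by positivity
    linarith

lemma isTest_spaceProfile (hN : 3 ≤ N) (hV : IsProfile V) :
    IsTest {0}ᶜ (spaceProfile N V) := by
  have hN' : (3 : ℝ) ≤ N := by exact_mod_cast hN
  have hk : (0 : ℝ) < N - 2 := by linarith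
  have hV0 := hV.eq_zero le_rfl
  obtain ⟨hs, c, hc, d, hd, hsupp⟩ := hV
  have hneg : -(((N : ℝ) - 2)⁻¹) < 0 := neg_lt_zero.2 (by positivity)
  refine isTest_radial (g := fun r => V (r ^ (-((N : ℝ) - 2))))
    (α := d ^ (-((N : ℝ) - 2)⁻¹)) (β := c ^ (-((N : ℝ) - 2)⁻¹)) (by positivity) (fun r hr => ?_)
    (fun r hr h => ?_) (fun x hα hβ => ?_)
  · exact hs.contDiffAt.comp r ((contDiffAt_id).rpow_const_of_ne hr.ne')
  · have h1 := hsupp _ h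
    have hr0 : 0 < r := by
      refine lt_of_le_of_ne hr fun h0 => h ?_
      rw [← h0, Real.zero_rpow (neg_lt_zero.2 hk).ne, hV0]
    have hr1 : r = (r ^ (-((N : ℝ) - 2))) ^ (-((N : ℝ) - 2)⁻¹) := by
      rw [← Real.rpow_mul hr, neg_mul_neg, mul_inv_cancel₀ hk.ne', Real.rpow_one]
    have hp : 0 < r ^ (-((N : ℝ) - 2)) := by positivity
    rw [hr1]
    exact ⟨Real.rpow_le_rpow_of_nonpos hp h1.2 hneg.le, Real.rpow_le_rpow_of_nonpos hc h1.1 hneg.le⟩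
  · intro h0
    have h2 : x = 0 := h0
    rw [h2, norm_zero] at hα
    have : 0 < d ^ (-((N : ℝ) - 2)⁻¹) := by positivity
    linarith

lemma isTransform_profile (hN : 3 ≤ N) (hR : 0 < R) :
    IsTransform R (ballProfile N R V) (spaceProfile N V) := by
  have hN' : (3 : ℝ) ≤ N := by exact_mod_cast hN
  have hk : (0 : ℝ) < N - 2 := by linarith
  intro x y hx hxR hy
  have hs : 0 < -Real.log (‖x‖ / R) :=
    neg_pos.2 (Real.log_neg (by positivity) ((div_lt_one hR).2 hxR))
  rw [spaceProfile, ballProfile, hy, tVar, ← Real.rpow_mul hs.le, neg_mul_neg,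
    one_div_mul_cancel hk.ne', Real.rpow_one, ← mul_assoc, ← Real.rpow_add hx, add_neg_cancel,
    Real.rpow_zero, one_mul]

lemma exists_euc_norm_eq (hN : 3 ≤ N) {r : ℝ} (hr : 0 ≤ r) : ∃ x : Euc N, ‖x‖ = r := by
  have := nontrivial_euc hN
  exact exists_norm_eq (Euc N) hr

lemma IsTest.eq_zero {Ω : Set (Euc N)} {φ : Euc N → ℝ} (h : IsTest Ω φ) {x : Euc N} (hx : x ∉ Ω) :
    φ x = 0 := image_eq_zero_of_notMem_tsupport fun h' => hx (h.2.2 h')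

/-- Every y ≠ 0 is reached by the change of variable, from a sphere of radius R exp(-|y|^{-(N-2)}),
and both functions vanish at the origin. -/
lemma eq_spaceProfile_of_isTransform (hN : 3 ≤ N) (hR : 0 < R) (hV : IsProfile V)
    {w : Euc N → ℝ} (hw : IsTest {0}ᶜ w) (ht : IsTransform R (ballProfile N R V) w) :
    w = spaceProfile N V := by
  have hN' : (3 : ℝ) ≤ N := by exact_mod_cast hN
  have hk : (0 : ℝ) < N - 2 := by linarith
  ext y
  by_cases hy : y = 0
  · rw [hw.eq_zero (by simp [hy]), (isTest_spaceProfile hN hV).eq_zero (by simp [hy])]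
  · have hy0 : 0 < ‖y‖ := norm_pos_iff.2 hy
    set s := ‖y‖ ^ (-((N : ℝ) - 2)) with hsdef
    have hs : 0 < s := by positivity
    obtain ⟨x, hx⟩ := exists_euc_norm_eq hN (r := R * Real.exp (-s)) (by positivity)
    have hx0 : 0 < ‖x‖ := by rw [hx]; positivity
    have hxR : ‖x‖ < R := by
      have : Real.exp (-s) < 1 := by
        rw [← Real.exp_zero]
        exact Real.exp_lt_exp.2 (by linarith)
      rw [hx]
      nlinarith
    have hy1 : ‖y‖ = tVar N R ‖x‖ := by
      rw [tVar, hx, mul_div_cancel_left₀ _ hR.ne', Real.log_exp, neg_neg, hsdef,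
        ← Real.rpow_mul hy0.le, neg_mul_neg, mul_one_div_cancel hk.ne', Real.rpow_one]
    rw [ht x y hx0 hxR hy1, isTransform_profile hN hR x y hx0 hxR hy1]

lemma eq_ballProfile_of_isTransform (hN : 3 ≤ N) (hR : 0 < R) (hV : IsProfile V)
    {u : Euc N → ℝ} (hu : IsTest (Metric.ball 0 R \ {0}) u)
    (ht : IsTransform R u (spaceProfile N V)) : u = ballProfile N R V := by
  ext x
  by_cases hx : x ∈ Metric.ball 0 R \ {0}
  · have hxR : ‖x‖ < R := mem_ball_zero_iff.1 hx.1
    have hx0 : 0 < ‖x‖ := norm_pos_iff.2 hx.2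
    have hs : 0 < -Real.log (‖x‖ / R) :=
      neg_pos.2 (Real.log_neg (by positivity) ((div_lt_one hR).2 hxR))
    obtain ⟨y, hy⟩ := exists_euc_norm_eq hN (r := tVar N R ‖x‖) (Real.rpow_nonneg hs.le _)
    have h1 := ht x y hx0 hxR hy
    rw [isTransform_profile hN hR x y hx0 hxR hy] at h1
    exact (mul_left_cancel₀ (Real.rpow_pos_of_pos hx0 _).ne' h1).symm
  · rw [hu.eq_zero hx, (isTest_ballProfile hR hV).eq_zero hx]

/-- Every radial test function on the punctured ball comes from a profile. -/
lemma exists_ballProfile_eq (hN : 3 ≤ N) (hR : 0 < R) {u : Euc N → ℝ} (hr : IsRadial u)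
    (hu : IsTest (Metric.ball 0 R \ {0}) u) : ∃ V, IsProfile V ∧ u = ballProfile N R V := by
  obtain ⟨e, he⟩ := exists_euc_norm_eq (N := N) hN zero_le_one
  have hK : IsCompact (tsupport u) := hu.2.1
  set V : ℝ → ℝ := fun s =>
    (R * Real.exp (-s)) ^ (((N : ℝ) - 2) / 2) * u ((R * Real.exp (-s)) • e) with hVdef
  have hVs : ContDiff ℝ ∞ V := by
    have h1 : ContDiff ℝ ∞ fun s : ℝ => R * Real.exp (-s) :=
      contDiff_const.mul (Real.contDiff_exp.comp contDiff_neg)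
    have h2 : ContDiff ℝ ∞ fun s : ℝ => u ((R * Real.exp (-s)) • e) :=
      hu.1.comp (h1.smul contDiff_const)
    refine ContDiff.mul ?_ h2
    exact h1.rpow_const_of_ne fun s => by positivity
  have hne : ∀ s, V s ≠ 0 → (R * Real.exp (-s)) • e ∈ tsupport u := fun s hs =>
    subset_tsupport u (right_ne_zero_of_mul hs)
  have hnorm : ∀ s, ‖(R * Real.exp (-s)) • e‖ = R * Real.exp (-s) := fun s => by
    rw [norm_smul, he, mul_one, Real.norm_of_nonneg (by positivity)]
  refine ⟨V, ⟨hVs, ?_⟩, ?_⟩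
  · by_cases hemp : (tsupport u).Nonempty
    · obtain ⟨x₁, hx₁, hmin⟩ := hK.exists_isMinOn hemp continuous_norm.continuousOn
      obtain ⟨x₂, hx₂, hmax⟩ := hK.exists_isMaxOn hemp continuous_norm.continuousOn
      have h1 : 0 < ‖x₁‖ := norm_pos_iff.2 (hu.2.2 hx₁).2
      have h2 : ‖x₁‖ < R := mem_ball_zero_iff.1 (hu.2.2 hx₁).1
      have h3 : 0 < ‖x₂‖ := norm_pos_iff.2 (hu.2.2 hx₂).2
      have h4 : ‖x₂‖ < R := mem_ball_zero_iff.1 (hu.2.2 hx₂).1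
      refine ⟨-Real.log (‖x₂‖ / R), neg_pos.2 (Real.log_neg (by positivity) ((div_lt_one hR).2 h4)),
        -Real.log (‖x₁‖ / R), neg_pos.2 (Real.log_neg (by positivity) ((div_lt_one hR).2 h2)),
        fun s hs => ?_⟩
      have h5 : ‖x₁‖ ≤ ‖(R * Real.exp (-s)) • e‖ := hmin (hne s hs)
      have h6 : ‖(R * Real.exp (-s)) • e‖ ≤ ‖x₂‖ := hmax (hne s hs)
      rw [hnorm] at h5 h6
      constructor
      · have : -s ≤ Real.log (‖x₂‖ / R) := by
          rw [Real.le_log_iff_exp_le (by positivity), le_div_iff₀ hR]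
          linarith
        linarith
      · have : Real.log (‖x₁‖ / R) ≤ -s := by
          rw [Real.log_le_iff_le_exp (by positivity), div_le_iff₀ hR]
          linarith
        linarith
    · exact ⟨1, one_pos, 1, one_pos, fun s hs => absurd ⟨_, hne s hs⟩ hemp⟩
  · ext x
    by_cases hx : x = 0
    · rw [hu.eq_zero (by simp [hx]), ballProfile, hx, norm_zero, zero_div, Real.log_zero]
      have hN' : (3 : ℝ) ≤ N := by exact_mod_cast hN
      rw [Real.zero_rpow (by linarith), zero_mul]
    · have hx0 : 0 < ‖x‖ := norm_pos_iff.2 hx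
      have h1 : R * Real.exp (-(-Real.log (‖x‖ / R))) = ‖x‖ := by
        rw [neg_neg, Real.exp_log (by positivity)]
        field_simp
      simp only [ballProfile, hVdef]
      rw [h1, ← mul_assoc, ← Real.rpow_add hx0, neg_add_cancel, Real.rpow_zero, one_mul]
      exact hr _ _ (by rw [norm_smul, he, mul_one, norm_norm])

/-- Every radial test function on the punctured space comes from a profile. -/
lemma exists_spaceProfile_eq (hN : 3 ≤ N) {w : Euc N → ℝ} (hr : IsRadial w)
    (hw : IsTest {0}ᶜ w) : ∃ V, IsProfile V ∧ w = spaceProfile N V := by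
  have hN' : (3 : ℝ) ≤ N := by exact_mod_cast hN
  have hk : (0 : ℝ) < N - 2 := by linarith
  obtain ⟨e, he⟩ := exists_euc_norm_eq (N := N) hN zero_le_one
  have hK : IsCompact (tsupport w) := hw.2.1
  set ρ : ℝ → ℝ := fun s => s ^ (-((N : ℝ) - 2)⁻¹) with hρ
  -- The cut at 0 discards the meaningless values of real powers of nonpositive s.
  set V : ℝ → ℝ := fun s => if 0 < s then w (ρ s • e) else 0 with hVdef
  have hnorm : ∀ s > 0, ‖ρ s • e‖ = ρ s := fun s hs => by
    rw [norm_smul, he, mul_one, Real.norm_of_nonneg (Real.rpow_nonneg hs.le _)]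
  have hρi : ∀ s > 0, s = ρ s ^ (-((N : ℝ) - 2)) := fun s hs => by
    rw [hρ, ← Real.rpow_mul hs.le, neg_mul_neg, inv_mul_cancel₀ hk.ne', Real.rpow_one]
  have hne : ∀ s, V s ≠ 0 → 0 < s ∧ ρ s • e ∈ tsupport w := fun s hs => by
    by_cases h : 0 < s
    · simp only [hVdef, if_pos h] at hs
      exact ⟨h, subset_tsupport w hs⟩
    · simp only [hVdef, if_neg h] at hs
      exact absurd rfl hs
  have hsupp : ∃ c > 0, ∃ d > 0, ∀ s, V s ≠ 0 → c ≤ s ∧ s ≤ d := by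
    by_cases hemp : (tsupport w).Nonempty
    · obtain ⟨x₁, hx₁, hmin⟩ := hK.exists_isMinOn hemp continuous_norm.continuousOn
      obtain ⟨x₂, hx₂, hmax⟩ := hK.exists_isMaxOn hemp continuous_norm.continuousOn
      have h1 : 0 < ‖x₁‖ := norm_pos_iff.2 (hw.2.2 hx₁)
      have h3 : 0 < ‖x₂‖ := norm_pos_iff.2 (hw.2.2 hx₂)
      refine ⟨‖x₂‖ ^ (-((N : ℝ) - 2)), by positivity, ‖x₁‖ ^ (-((N : ℝ) - 2)), by positivity,
        fun s hs => ?_⟩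
      obtain ⟨hs0, hs1⟩ := hne s hs
      have h5 : ‖x₁‖ ≤ ‖ρ s • e‖ := hmin hs1
      have h6 : ‖ρ s • e‖ ≤ ‖x₂‖ := hmax hs1
      rw [hnorm s hs0] at h5 h6
      have hρ0 : 0 < ρ s := lt_of_lt_of_le h1 h5
      rw [hρi s hs0]
      exact ⟨Real.rpow_le_rpow_of_nonpos hρ0 h6 (by linarith),
        Real.rpow_le_rpow_of_nonpos h1 h5 (by linarith)⟩
    · exact ⟨1, one_pos, 1, one_pos, fun s hs => absurd ⟨_, (hne s hs).2⟩ hemp⟩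
  refine ⟨V, ⟨?_, hsupp⟩, ?_⟩
  · obtain ⟨c, hc, d, hd, h⟩ := hsupp
    rw [contDiff_iff_contDiffAt]
    intro s
    by_cases hs : s < c
    · refine (contDiffAt_const (c := (0 : ℝ))).congr_of_eventuallyEq ?_
      filter_upwards [Iio_mem_nhds hs] with r hr
      by_contra h'
      exact absurd (h r h').1 (not_le.2 hr)
    · have hs0 : 0 < s := by linarith
      have h1 : ContDiffAt ℝ ∞ (fun s => w (ρ s • e)) s := by
        refine hw.1.contDiffAt.comp s ?_
        exact ((contDiffAt_id).rpow_const_of_ne hs0.ne').smul contDiffAt_const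
      refine h1.congr_of_eventuallyEq ?_
      filter_upwards [Ioi_mem_nhds hs0] with r hr
      exact if_pos hr
  · ext y
    by_cases hy : y = 0
    · rw [hw.eq_zero (by simp [hy]), spaceProfile, hy, norm_zero,
        Real.zero_rpow (neg_lt_zero.2 hk).ne]
      simp [hVdef]
    · have hy0 : 0 < ‖y‖ := norm_pos_iff.2 hy
      have h0 : 0 < ‖y‖ ^ (-((N : ℝ) - 2)) := by positivity
      simp only [spaceProfile, hVdef, if_pos h0]
      have h1 : ρ (‖y‖ ^ (-((N : ℝ) - 2))) = ‖y‖ := by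
        simp only [hρ]
        rw [← Real.rpow_mul hy0.le, neg_mul_neg, mul_inv_cancel₀ hk.ne', Real.rpow_one]
      rw [h1]
      exact hr _ _ (by rw [norm_smul, he, mul_one, norm_norm])

end RadialTransform

/-! ### Both inequalities in terms of the profile -/

section ProfileIntegrals

variable {N : ℕ} {R : ℝ} {V : ℝ → ℝ}

lemma norm_fderiv_radial (hN : 3 ≤ N) {g : ℝ → ℝ} {g' : ℝ} {x : Euc N} (hx : x ≠ 0)
    (hg : HasDerivAt g g' ‖x‖) : ‖fderiv ℝ (fun x : Euc N => g ‖x‖) x‖ = |g'| := by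
  have := nontrivial_euc hN
  have hd : DifferentiableAt ℝ (fun x : Euc N => ‖x‖) x :=
    (contDiffAt_norm (n := 1) ℝ hx).differentiableAt one_ne_zero
  have h := hg.comp_hasFDerivAt x hd.hasFDerivAt
  have h' : HasFDerivAt (fun x : Euc N => g ‖x‖) (g' • fderiv ℝ (fun x : Euc N => ‖x‖) x) x := h
  rw [h'.fderiv, norm_smul, norm_fderiv_norm hd, mul_one, Real.norm_eq_abs]

lemma logRadius_div (hR : 0 < R) (s : ℝ) : -Real.log (R * Real.exp (-s) / R) = s := by
  rw [mul_div_cancel_left₀ _ hR.ne', Real.log_exp, neg_neg]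

/-- Because a · 2* = N, the singular factor of u cancels the volume density r^N exactly. -/
lemma logRadius_weight (hN : 3 ≤ N) (hR : 0 < R) (s : ℝ) :
    (R * Real.exp (-s)) ^ N * |(R * Real.exp (-s)) ^ (-(((N : ℝ) - 2) / 2))| ^
      (2 * (N : ℝ) / ((N : ℝ) - 2)) = 1 := by
  have hN' : (3 : ℝ) ≤ N := by exact_mod_cast hN
  have hk : (N : ℝ) - 2 ≠ 0 := by linarith
  have hr : 0 < R * Real.exp (-s) := by positivity
  rw [abs_of_pos (Real.rpow_pos_of_pos hr _), ← Real.rpow_mul hr.le, ← Real.rpow_natCast,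
    ← Real.rpow_add hr, show (N : ℝ) + -(((N : ℝ) - 2) / 2) * (2 * N / (N - 2)) = 0 by
      field_simp; ring, Real.rpow_zero]

lemma hsDensity_ballProfile_logRadius (hN : 3 ≤ N) (hR : 0 < R) (V : ℝ → ℝ) (s : ℝ) :
    (R * Real.exp (-s)) ^ N * (|(R * Real.exp (-s)) ^ (-(((N : ℝ) - 2) / 2)) *
      V (-Real.log (R * Real.exp (-s) / R))| ^ (2 * (N : ℝ) / ((N : ℝ) - 2)) *
      (-Real.log (R * Real.exp (-s) / R)) ^ (-(2 * ((N : ℝ) - 1) / ((N : ℝ) - 2)))) =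
    |V s| ^ (2 * (N : ℝ) / ((N : ℝ) - 2)) * s ^ (-(2 * ((N : ℝ) - 1) / ((N : ℝ) - 2))) := by
  rw [logRadius_div hR, abs_mul, Real.mul_rpow (abs_nonneg _) (abs_nonneg _), ← mul_assoc,
    ← mul_assoc, logRadius_weight hN hR, one_mul]

lemma integral_hsDensity_ballProfile (hN : 3 ≤ N) (hR : 0 < R) (V : ℝ → ℝ) :
    ∫ x, hsDensity R (ballProfile N R V) x ∂(ballMeasure N R) = sphereArea N *
      ∫ s in Set.Ioi (0 : ℝ), |V s| ^ (2 * (N : ℝ) / ((N : ℝ) - 2)) *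
        s ^ (-(2 * ((N : ℝ) - 1) / ((N : ℝ) - 2))) := by
  have h := integral_ball_radial hN hR fun r => |r ^ (-(((N : ℝ) - 2) / 2)) *
    V (-Real.log (r / R))| ^ (2 * (N : ℝ) / ((N : ℝ) - 2)) *
      (-Real.log (r / R)) ^ (-(2 * ((N : ℝ) - 1) / ((N : ℝ) - 2)))
  simp only [hsDensity_ballProfile_logRadius hN hR] at h
  exact h

lemma integrable_hsDensity_ballProfile (hN : 3 ≤ N) (hR : 0 < R) (V : ℝ → ℝ) :
    Integrable (hsDensity R (ballProfile N R V)) (ballMeasure N R) ↔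
      IntegrableOn (fun s => |V s| ^ (2 * (N : ℝ) / ((N : ℝ) - 2)) *
        s ^ (-(2 * ((N : ℝ) - 1) / ((N : ℝ) - 2)))) (Set.Ioi 0) := by
  have h := integrable_ball_radial hN hR fun r => |r ^ (-(((N : ℝ) - 2) / 2)) *
    V (-Real.log (r / R))| ^ (2 * (N : ℝ) / ((N : ℝ) - 2)) *
      (-Real.log (r / R)) ^ (-(2 * ((N : ℝ) - 1) / ((N : ℝ) - 2)))
  simp only [hsDensity_ballProfile_logRadius hN hR] at h
  exact h

/-- The energy of a profile on the ball, in terms of the profile. -/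
lemma integral_fderiv_ballProfile (hN : 3 ≤ N) (hR : 0 < R) (hV : IsProfile V) :
    ∫ x, ‖fderiv ℝ (ballProfile N R V) x‖ ^ 2 ∂(ballMeasure N R) =
      (((N : ℝ) - 2) / 2) ^ 2 *
        (∫ x, ballProfile N R V x ^ 2 / ‖x‖ ^ 2 ∂(ballMeasure N R)) +
      sphereArea N * ∫ s in Set.Ioi (0 : ℝ), deriv V s ^ 2 := by
  have hN' : (3 : ℝ) ≤ N := by exact_mod_cast hN
  have := nontrivial_euc hN
  set a : ℝ := ((N : ℝ) - 2) / 2 with ha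
  have hVd : Differentiable ℝ V := hV.1.differentiable (by simp)
  have hVc : Continuous V := hV.1.continuous
  have hVc' : Continuous (deriv V) := hV.1.continuous_deriv (by simp)
  have hVK := hV.hasCompactSupport
  set g' : ℝ → ℝ := fun r => -(r ^ (-a - 1) *
    (a * V (-Real.log (r / R)) + deriv V (-Real.log (r / R)))) with hg'
  have hgd : ∀ r > 0, HasDerivAt (fun r => r ^ (-a) * V (-Real.log (r / R))) (g' r) r := by
    intro r hr
    have h1 := Real.hasDerivAt_rpow_const (p := -a) (Or.inl hr.ne')
    have h2 : HasDerivAt (fun r => -Real.log (r / R)) (-(1 / R / (r / R))) r :=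
      (((hasDerivAt_id r).div_const R).log (div_pos hr hR).ne').neg
    have h3 := (hVd _).hasDerivAt.comp r h2
    refine (h1.mul h3).congr_deriv ?_
    have h4 : r ^ (-a) = r ^ (-a - 1) * r := by
      rw [Real.rpow_sub hr, Real.rpow_one]
      field_simp
    simp only [hg', Function.comp]
    rw [h4]
    field_simp
    ring
  have hL : ∫ x, ‖fderiv ℝ (ballProfile N R V) x‖ ^ 2 ∂(ballMeasure N R) =
      ∫ x, g' ‖x‖ ^ 2 ∂(ballMeasure N R) := by
    have h0 : ∀ᵐ x : Euc N ∂(ballMeasure N R), x ≠ 0 :=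
      ae_restrict_of_ae (compl_mem_ae_iff.2 (by simp : volume ({0} : Set (Euc N)) = 0))
    refine integral_congr_ae ?_
    filter_upwards [h0] with x hx
    rw [show ballProfile N R V = fun x => (fun r => r ^ (-a) * V (-Real.log (r / R))) ‖x‖ from rfl,
      norm_fderiv_radial hN hx (hgd _ (norm_pos_iff.2 hx)), sq_abs]
  have hpow : ∀ s, (R * Real.exp (-s)) ^ N * ((R * Real.exp (-s)) ^ (-a - 1)) ^ 2 = 1 := fun s => by
    have hr : 0 < R * Real.exp (-s) := by positivity
    rw [← Real.rpow_natCast, ← Real.rpow_natCast, ← Real.rpow_mul hr.le, ← Real.rpow_add hr,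
      show (N : ℝ) + (-a - 1) * (2 : ℕ) = 0 by rw [ha]; push_cast; ring, Real.rpow_zero]
  rw [hL, integral_ball_radial hN hR fun r => g' r ^ 2,
    show (fun x : Euc N => ballProfile N R V x ^ 2 / ‖x‖ ^ 2) = fun x =>
      (fun r => (r ^ (-a) * V (-Real.log (r / R))) ^ 2 / r ^ 2) ‖x‖ from rfl,
    integral_ball_radial hN hR fun r => (r ^ (-a) * V (-Real.log (r / R))) ^ 2 / r ^ 2]
  -- This is (aV + V')² expanded. The last term is a times the derivative of V², and V vanishes near
  -- both ends of (0, ∞).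
  have e1 : ∀ s, (R * Real.exp (-s)) ^ N * g' (R * Real.exp (-s)) ^ 2 =
      a ^ 2 * V s ^ 2 + deriv V s ^ 2 + a * (V s * deriv V s + deriv V s * V s) := fun s => by
    simp only [hg', logRadius_div hR]
    linear_combination (a * V s + deriv V s) ^ 2 * hpow s
  have e2 : ∀ s, (R * Real.exp (-s)) ^ N * (((R * Real.exp (-s)) ^ (-a) *
      V (-Real.log (R * Real.exp (-s) / R))) ^ 2 / (R * Real.exp (-s)) ^ 2) = V s ^ 2 := fun s => by
    have hr : 0 < R * Real.exp (-s) := by positivity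
    have h4 : (R * Real.exp (-s)) ^ (-a) = (R * Real.exp (-s)) ^ (-a - 1) * (R * Real.exp (-s)) := by
      rw [Real.rpow_sub hr, Real.rpow_one]
      field_simp
    have h5 := hpow s
    rw [h4, logRadius_div hR]
    generalize R * Real.exp (-s) = r at hr h5 ⊢
    have : (r ^ (-a - 1) * r * V s) ^ 2 / r ^ 2 = (r ^ (-a - 1)) ^ 2 * V s ^ 2 := by
      field_simp
    rw [this, ← mul_assoc, h5, one_mul]
  simp only [e1, e2]
  have i1 : IntegrableOn (fun s => V s ^ 2) (Set.Ioi 0) := by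
    have hc : HasCompactSupport fun s => V s ^ 2 := hVK.comp_left (g := fun z => z ^ 2) (by simp)
    exact ((hVc.pow 2).integrable_of_hasCompactSupport hc).integrableOn
  have i2 : IntegrableOn (fun s => deriv V s ^ 2) (Set.Ioi 0) := by
    have hc : HasCompactSupport fun s => deriv V s ^ 2 :=
      hVK.deriv.comp_left (g := fun z => z ^ 2) (by simp)
    exact ((hVc'.pow 2).integrable_of_hasCompactSupport hc).integrableOn
  have i3' : Integrable fun s => V s * deriv V s + deriv V s * V s := by
    have h1 : Continuous fun s => V s * deriv V s + deriv V s * V s := by fun_prop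
    exact h1.integrable_of_hasCompactSupport ((hVK.mul_right).add (hVK.mul_left))
  have i3 : ∫ s in Set.Ioi (0 : ℝ), (V s * deriv V s + deriv V s * V s) = 0 := by
    have hz : ∫ s, (V s * deriv V s + deriv V s * V s) = 0 := by
      have i4 : Integrable fun s => V s * V s :=
        (hVc.mul hVc).integrable_of_hasCompactSupport (hVK.mul_right)
      refine integral_eq_zero_of_hasDerivAt_of_integrable (f := fun s => V s * V s) (fun s => ?_)
        i3' i4
      exact ((hVd s).hasDerivAt.mul (hVd s).hasDerivAt).congr_deriv (by ring)
    refine (setIntegral_eq_integral_of_forall_compl_eq_zero fun s hs => ?_).trans hz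
    rw [hV.eq_zero (not_lt.1 hs)]
    ring
  have hsum1 : IntegrableOn (fun s => a ^ 2 * V s ^ 2 + deriv V s ^ 2) (Set.Ioi 0) :=
    (i1.const_mul _).add i2
  rw [integral_add hsum1 (i3'.integrableOn.const_mul a), integral_add (i1.const_mul _) i2,
    integral_const_mul, integral_const_mul, i3]
  ring

/-- The variable s = |y|^{-(N-2)} is harmonic, up to a constant the fundamental solution; this is
why the Dirichlet integral carries no weight in s. -/
lemma integral_fderiv_spaceProfile (hN : 3 ≤ N) (hV : IsProfile V) :
    ∫ y, ‖fderiv ℝ (spaceProfile N V) y‖ ^ 2 =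
      ((N : ℝ) - 2) * sphereArea N * ∫ s in Set.Ioi (0 : ℝ), deriv V s ^ 2 := by
  have hN' : (3 : ℝ) ≤ N := by exact_mod_cast hN
  have hk : (0 : ℝ) < N - 2 := by linarith
  have := nontrivial_euc hN
  have hVd : Differentiable ℝ V := hV.1.differentiable (by simp)
  set g' : ℝ → ℝ := fun r => deriv V (r ^ (-((N : ℝ) - 2))) *
    (-((N : ℝ) - 2) * r ^ (-((N : ℝ) - 2) - 1)) with hg'
  have hL : ∫ y, ‖fderiv ℝ (spaceProfile N V) y‖ ^ 2 = ∫ y : Euc N, g' ‖y‖ ^ 2 := by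
    have h0 : ∀ᵐ x : Euc N, x ≠ 0 :=
      compl_mem_ae_iff.2 (by simp : volume ({0} : Set (Euc N)) = 0)
    refine integral_congr_ae ?_
    filter_upwards [h0] with x hx
    have h1 := Real.hasDerivAt_rpow_const (p := -((N : ℝ) - 2)) (Or.inl (norm_pos_iff.2 hx).ne')
    have h3 : HasDerivAt (fun r => V (r ^ (-((N : ℝ) - 2)))) (g' ‖x‖) ‖x‖ :=
      (hVd _).hasDerivAt.comp _ h1
    rw [show spaceProfile N V = fun x => (fun r => V (r ^ (-((N : ℝ) - 2)))) ‖x‖ from rfl,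
      norm_fderiv_radial hN hx h3, sq_abs]
  rw [hL, integral_euc_radial hN fun r => g' r ^ 2]
  have e : ∀ s ∈ Set.Ioi (0 : ℝ), s ^ (-(2 * ((N : ℝ) - 1) / (N - 2))) *
      g' (s ^ (-(1 / ((N : ℝ) - 2)))) ^ 2 = ((N : ℝ) - 2) ^ 2 * deriv V s ^ 2 := by
    intro s hs
    have hs0 : (0 : ℝ) < s := hs
    have h1 : (s ^ (-(1 / ((N : ℝ) - 2)))) ^ (-((N : ℝ) - 2)) = s := by
      rw [← Real.rpow_mul hs0.le, neg_mul_neg, one_div_mul_cancel hk.ne', Real.rpow_one]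
    have h2 : s ^ (-(2 * ((N : ℝ) - 1) / (N - 2))) *
        ((s ^ (-(1 / ((N : ℝ) - 2)))) ^ (-((N : ℝ) - 2) - 1)) ^ 2 = 1 := by
      rw [← Real.rpow_mul hs0.le, ← Real.rpow_natCast, ← Real.rpow_mul hs0.le, ← Real.rpow_add hs0]
      have : -(2 * ((N : ℝ) - 1) / (N - 2)) +
          -(1 / ((N : ℝ) - 2)) * (-((N : ℝ) - 2) - 1) * (2 : ℕ) = 0 := by
        push_cast
        field_simp
        ring
      rw [this, Real.rpow_zero]
    simp only [hg']
    rw [h1]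
    linear_combination ((N : ℝ) - 2) ^ 2 * deriv V s ^ 2 * h2
  rw [setIntegral_congr_fun measurableSet_Ioi e, integral_const_mul]
  field_simp

lemma integral_rpow_spaceProfile (hN : 3 ≤ N) (V : ℝ → ℝ) (q : ℝ) :
    ∫ y, |spaceProfile N V y| ^ q = sphereArea N / (N - 2) *
      ∫ s in Set.Ioi (0 : ℝ), |V s| ^ q * s ^ (-(2 * ((N : ℝ) - 1) / ((N : ℝ) - 2))) := by
  have hN' : (3 : ℝ) ≤ N := by exact_mod_cast hN
  have hk : (0 : ℝ) < N - 2 := by linarith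
  rw [show (fun y : Euc N => |spaceProfile N V y| ^ q) = fun y =>
    (fun r => |V (r ^ (-((N : ℝ) - 2)))| ^ q) ‖y‖ from rfl,
    integral_euc_radial hN fun r => |V (r ^ (-((N : ℝ) - 2)))| ^ q]
  congr 1
  refine setIntegral_congr_fun measurableSet_Ioi fun s hs => ?_
  have hs0 : (0 : ℝ) < s := hs
  rw [← Real.rpow_mul hs0.le, neg_mul_neg, one_div_mul_cancel hk.ne', Real.rpow_one, mul_comm]

/-- The energy of a profile. -/
noncomputable def profileEnergy (V : ℝ → ℝ) : ℝ := ∫ s in Set.Ioi (0 : ℝ), deriv V s ^ 2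

/-- The weighted `L^{2N/(N-2)}` integral of a profile. -/
noncomputable def profileMass (N : ℕ) (V : ℝ → ℝ) : ℝ :=
  ∫ s in Set.Ioi (0 : ℝ), |V s| ^ (2 * (N : ℝ) / ((N : ℝ) - 2)) *
    s ^ (-(2 * ((N : ℝ) - 1) / ((N : ℝ) - 2)))

lemma profileMass_nonneg (N : ℕ) (V : ℝ → ℝ) : 0 ≤ profileMass N V :=
  setIntegral_nonneg measurableSet_Ioi fun _ hs =>
    mul_nonneg (Real.rpow_nonneg (abs_nonneg _) _) (Real.rpow_nonneg (le_of_lt hs) _)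

lemma hsTerm_ballProfile (hN : 3 ≤ N) (hR : 0 < R) (V : ℝ → ℝ) :
    hsTerm R (ballProfile N R V) =
      (sphereArea N * profileMass N V) ^ (((N : ℝ) - 2) / (N : ℝ)) := by
  rw [hsTerm, integral_hsDensity_ballProfile hN hR, profileMass]

lemma hardySobolevIneq_ballProfile (hN : 3 ≤ N) (hR : 0 < R) (hV : IsProfile V) (C : ℝ) :
    HardySobolevIneq R C (ballProfile N R V) ↔
      C * (sphereArea N * profileMass N V) ^ (((N : ℝ) - 2) / (N : ℝ)) ≤
        sphereArea N * profileEnergy V := by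
  rw [HardySobolevIneq, integral_fderiv_ballProfile hN hR hV, hsTerm_ballProfile hN hR, ge_iff_le,
    add_le_add_iff_left, profileEnergy]

/-- The energy contributes one power of N - 2 and the mass (N-2)/N of a power. Their sum 2(N-1)/N is
the exponent put in (eq6), so the condition is literally that of `hardySobolevIneq_ballProfile`. -/
lemma sobolevIneq_spaceProfile (hN : 3 ≤ N) (hV : IsProfile V) (C : ℝ) :
    SobolevIneq C (spaceProfile N V) ↔
      C * (sphereArea N * profileMass N V) ^ (((N : ℝ) - 2) / (N : ℝ)) ≤
        sphereArea N * profileEnergy V := by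
  have hN' : (3 : ℝ) ≤ N := by exact_mod_cast hN
  have hk : (0 : ℝ) < N - 2 := by linarith
  rw [SobolevIneq, integral_fderiv_spaceProfile hN hV, integral_rpow_spaceProfile hN V,
    ← profileMass, ← profileEnergy, ge_iff_le, div_mul_eq_mul_div,
    Real.div_rpow (mul_nonneg (sphereArea_pos hN).le (profileMass_nonneg N V)) hk.le]
  have h1 : ((N : ℝ) - 2) ^ (2 * ((N : ℝ) - 1) / N) =
      ((N : ℝ) - 2) * ((N : ℝ) - 2) ^ (((N : ℝ) - 2) / N) := by
    rw [← Real.rpow_one_add' hk.le]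
    · congr 1
      field_simp
      ring
    · positivity
  have h2 : 0 < ((N : ℝ) - 2) ^ (((N : ℝ) - 2) / N) := by positivity
  rw [h1, show ((N : ℝ) - 2) * ((N : ℝ) - 2) ^ (((N : ℝ) - 2) / N) * C *
      ((sphereArea N * profileMass N V) ^ (((N : ℝ) - 2) / N) / ((N : ℝ) - 2) ^ (((N : ℝ) - 2) / N)) =
      ((N : ℝ) - 2) * (C * (sphereArea N * profileMass N V) ^ (((N : ℝ) - 2) / N)) by field_simp,
    mul_assoc, mul_le_mul_iff_right₀ hk]

end ProfileIntegrals

/-! ### The Hardy form as a weighted Dirichlet integral -/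

section HardyForm

variable {N : ℕ} {R : ℝ} {φ : Euc N → ℝ}

lemma integrable_norm_rpow_ball (hN : 3 ≤ N) (hR : 0 < R) {q : ℝ} (hq : -(N : ℝ) < q) :
    Integrable (fun x : Euc N => ‖x‖ ^ q) (ballMeasure N R) := by
  rw [integrable_ball_radial hN hR fun r => r ^ q]
  have h1 : (fun s => (R * Real.exp (-s)) ^ N * (R * Real.exp (-s)) ^ q) =
      fun s => R ^ ((N : ℝ) + q) * Real.exp (-((N : ℝ) + q) * s) := by
    ext s
    have hr : 0 < R * Real.exp (-s) := by positivity
    rw [← Real.rpow_natCast, ← Real.rpow_add hr, Real.mul_rpow hR.le (Real.exp_pos _).le,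
      ← Real.exp_mul]
    congr 2
    ring
  rw [h1]
  exact (exp_neg_integrableOn_Ioi 0 (by linarith)).const_mul _

lemma IsTest.continuous {Ω : Set (Euc N)} (h : IsTest Ω φ) : Continuous φ := h.1.continuous

lemma IsTest.differentiable {Ω : Set (Euc N)} (h : IsTest Ω φ) : Differentiable ℝ φ :=
  h.1.differentiable (by simp)

lemma IsTest.continuous_fderiv {Ω : Set (Euc N)} (h : IsTest Ω φ) : Continuous (fderiv ℝ φ) :=
  h.1.continuous_fderiv (by simp)

lemma IsTest.exists_bound {Ω : Set (Euc N)} (h : IsTest Ω φ) :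
    ∃ M ≥ 0, ∀ x, |φ x| ≤ M ∧ ‖fderiv ℝ φ x‖ ≤ M := by
  obtain ⟨M₁, h₁⟩ := h.continuous.bounded_above_of_compact_support h.2.1
  obtain ⟨M₂, h₂⟩ := h.continuous_fderiv.bounded_above_of_compact_support (h.2.1.fderiv ℝ)
  exact ⟨max M₁ M₂, le_max_of_le_left ((norm_nonneg _).trans (h₁ 0)), fun x =>
    ⟨(h₁ x).trans (le_max_left _ _), (h₂ x).trans (le_max_right _ _)⟩⟩

/-- Ground state substitution: ∇u = |x|^{-a}(∇φ - aφ x/|x|²). In the expanded square the φ² term is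
exactly the Hardy term. -/
lemma norm_sq_fderiv_singularMul {x : Euc N} (hx : x ≠ 0)
    (hφ : DifferentiableAt ℝ φ x) :
    ‖fderiv ℝ (singularMul φ) x‖ ^ 2 -
        (((N : ℝ) - 2) / 2) ^ 2 * (singularMul φ x ^ 2 / ‖x‖ ^ 2) =
      ‖x‖ ^ (2 - (N : ℝ)) * ‖fderiv ℝ φ x‖ ^ 2 -
        ((N : ℝ) - 2) * (‖x‖ ^ (-(N : ℝ)) * (φ x * fderiv ℝ φ x x)) := by
  set a : ℝ := ((N : ℝ) - 2) / 2 with ha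
  have hx0 : 0 < ‖x‖ := norm_pos_iff.2 hx
  have hnx : HasFDerivAt (fun x : Euc N => ‖x‖ ^ 2) (2 • innerSL ℝ x) x :=
    (hasStrictFDerivAt_norm_sq x).hasFDerivAt
  have h1 : HasFDerivAt (fun x : Euc N => ‖x‖ ^ (-a))
      ((-a * ‖x‖ ^ (-a - 2)) • innerSL ℝ x) x := by
    have h2 := (Real.hasDerivAt_rpow_const (p := -a / 2) (Or.inl (by positivity :
      ‖x‖ ^ 2 ≠ 0))).comp_hasFDerivAt x hnx
    have h3 : (fun x : Euc N => ‖x‖ ^ (-a)) = (fun z : ℝ => z ^ (-a / 2)) ∘ fun x : Euc N => ‖x‖ ^ 2 := by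
      ext z
      simp only [Function.comp]
      rw [← Real.rpow_natCast, ← Real.rpow_mul (norm_nonneg z)]
      congr 1
      push_cast
      ring
    rw [h3]
    refine h2.congr_fderiv ?_
    rw [← Real.rpow_natCast, ← Real.rpow_mul (norm_nonneg x), ← Nat.cast_smul_eq_nsmul ℝ, smul_smul]
    congr 1
    rw [show ((2 : ℕ) : ℝ) * (-a / 2 - 1) = -a - 2 by push_cast; ring]
    push_cast
    ring
  have h4 := h1.mul hφ.hasFDerivAt
  have h5 : HasFDerivAt (singularMul φ) _ x := h4
  have hpow : ‖x‖ ^ (-a) = ‖x‖ ^ (-a - 2) * ‖x‖ ^ 2 := by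
    rw [← Real.rpow_natCast, ← Real.rpow_add hx0]
    congr 1
    push_cast
    ring
  have hN1 : ‖x‖ ^ (-(N : ℝ)) = ‖x‖ ^ (-a - 2) * ‖x‖ ^ (-a - 2) * ‖x‖ ^ 2 := by
    rw [← Real.rpow_natCast, ← Real.rpow_add hx0, ← Real.rpow_add hx0]
    congr 1
    rw [ha]
    push_cast
    ring
  have hN2 : ‖x‖ ^ (2 - (N : ℝ)) = ‖x‖ ^ (-(N : ℝ)) * ‖x‖ ^ 2 := by
    rw [← Real.rpow_natCast, ← Real.rpow_add hx0]
    congr 1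
    push_cast
    ring
  obtain ⟨G, hGd⟩ : ∃ G : Euc N, fderiv ℝ φ x = innerSL ℝ G := by
    refine ⟨(InnerProductSpace.toDual ℝ (Euc N)).symm (fderiv ℝ φ x), ?_⟩
    ext z
    rw [innerSL_apply_apply, InnerProductSpace.toDual_symm_apply]
  have hn : ‖fderiv ℝ φ x‖ = ‖G‖ := by rw [hGd, innerSL_apply_norm]
  have hGx : fderiv ℝ φ x x = inner ℝ G x := by rw [hGd, innerSL_apply_apply]
  rw [h5.fderiv, hn, hGx, hGd, smul_smul, ← (innerSL ℝ).map_smul, ← (innerSL ℝ).map_smul,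
    ← (innerSL ℝ).map_add, innerSL_apply_norm,
    norm_add_sq_real, norm_smul, norm_smul, inner_smul_left, inner_smul_right, singularMul, ← ha,
    hN2, hN1, hpow]
  simp only [mul_pow, Real.norm_eq_abs, sq_abs, conj_trivial]
  rw [show (N : ℝ) - 2 = 2 * a by rw [ha]; ring]
  field_simp
  ring

lemma hasDerivAt_comp_logRadius (hφ : Differentiable ℝ φ) (θ : Euc N) (s : ℝ) :
    HasDerivAt (fun s => φ ((R * Real.exp (-s)) • θ))
      (-(fderiv ℝ φ ((R * Real.exp (-s)) • θ) ((R * Real.exp (-s)) • θ))) s := by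
  have h1 : HasDerivAt (fun s => (R * Real.exp (-s)) • θ) (-(R * Real.exp (-s)) • θ) s :=
    (hasDerivAt_logRadius s).smul_const θ
  have h2 := (hφ ((R * Real.exp (-s)) • θ)).hasFDerivAt.comp_hasDerivAt s h1
  refine h2.congr_deriv ?_
  rw [neg_smul, map_neg]

lemma norm_logRadius_smul (hR : 0 < R) (s : ℝ) (θ : Metric.sphere (0 : Euc N) 1) :
    ‖(R * Real.exp (-s)) • (θ : Euc N)‖ = R * Real.exp (-s) := norm_logPolar hR (s, θ)

lemma integrable_norm_rpow_mul_energy (hN : 3 ≤ N) (hR : 0 < R)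
    (hφ : IsTest (Metric.ball 0 R) φ) :
    Integrable (fun x => ‖x‖ ^ (2 - (N : ℝ)) * ‖fderiv ℝ φ x‖ ^ 2) (ballMeasure N R) := by
  obtain ⟨M, hM, hb⟩ := hφ.exists_bound
  refine ((integrable_norm_rpow_ball hN hR (q := 2 - (N : ℝ)) (by linarith)).mul_const
    (M ^ 2)).mono' ?_ ?_
  · have := hφ.continuous_fderiv.measurable.norm
    have h2 : Measurable fun x : Euc N => ‖x‖ ^ (2 - (N : ℝ)) * ‖fderiv ℝ φ x‖ ^ 2 :=
      (measurable_norm.pow_const _).mul (this.pow_const 2)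
    exact h2.aestronglyMeasurable
  · refine Eventually.of_forall fun x => ?_
    rw [Real.norm_of_nonneg (by positivity)]
    exact mul_le_mul_of_nonneg_left (pow_le_pow_left₀ (norm_nonneg _) (hb x).2 2) (by positivity)

/-- The factor x inside the derivative lowers the singularity from |x|^{-N} to |x|^{1-N}, which is
integrable. -/
lemma integrable_norm_rpow_mul_radial (hN : 3 ≤ N) (hR : 0 < R)
    (hφ : IsTest (Metric.ball 0 R) φ) :
    Integrable (fun x => ‖x‖ ^ (-(N : ℝ)) * (φ x * fderiv ℝ φ x x)) (ballMeasure N R) := by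
  obtain ⟨M, hM, hb⟩ := hφ.exists_bound
  refine ((integrable_norm_rpow_ball hN hR (q := 1 - (N : ℝ)) (by linarith)).mul_const
    (M ^ 2)).mono' ?_ ?_
  · have h1 : Continuous fun x => fderiv ℝ φ x x := hφ.continuous_fderiv.clm_apply continuous_id
    have h2 : Measurable fun x : Euc N => ‖x‖ ^ (-(N : ℝ)) * (φ x * fderiv ℝ φ x x) :=
      (measurable_norm.pow_const _).mul (hφ.continuous.measurable.mul h1.measurable)
    exact h2.aestronglyMeasurable
  · have h0 : ∀ᵐ x : Euc N ∂(ballMeasure N R), x ≠ 0 :=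
      ae_restrict_of_ae (compl_mem_ae_iff.2 (by
        have := nontrivial_euc hN
        simp : volume ({0} : Set (Euc N)) = 0))
    filter_upwards [h0] with x hx
    have hx0 := norm_pos_iff.2 hx
    rw [norm_mul, norm_mul, Real.norm_of_nonneg (by positivity), sub_eq_neg_add,
      Real.rpow_add hx0, Real.rpow_one, mul_assoc]
    refine mul_le_mul_of_nonneg_left ?_ (by positivity)
    have h2 : ‖fderiv ℝ φ x x‖ ≤ M * ‖x‖ :=
      ((fderiv ℝ φ x).le_opNorm x).trans (mul_le_mul_of_nonneg_right (hb x).2 (norm_nonneg _))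
    calc ‖φ x‖ * ‖fderiv ℝ φ x x‖ ≤ M * (M * ‖x‖) :=
          mul_le_mul (hb x).1 h2 (norm_nonneg _) hM
      _ = ‖x‖ * M ^ 2 := by ring

instance : SFinite (logRadialMeasure N R) := by unfold logRadialMeasure; infer_instance

lemma integral_logRadialMeasure (hR : 0 < R) (f : ℝ → ℝ) :
    ∫ s, f s ∂(logRadialMeasure N R) =
      ∫ s in Set.Ioi (0 : ℝ), (R * Real.exp (-s)) ^ N * f s := by
  rw [logRadialMeasure, integral_withDensity_eq_integral_toReal_smul (by fun_prop)
    (Eventually.of_forall fun s => ENNReal.ofReal_lt_top)]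
  refine setIntegral_congr_fun measurableSet_Ioi fun s _ => ?_
  have : 0 ≤ (R * Real.exp (-s)) ^ N := by positivity
  simp only [smul_eq_mul, ENNReal.toReal_ofReal this]

lemma tendsto_logRadius_smul (θ : Euc N) :
    Tendsto (fun s => (R * Real.exp (-s)) • θ) atTop (𝓝 0) := by
  have h1 : Tendsto (fun s => R * Real.exp (-s)) atTop (𝓝 (R * 0)) :=
    (Real.tendsto_exp_neg_atTop_nhds_zero).const_mul R
  rw [mul_zero] at h1
  simpa using h1.smul_const θ

/-- Along each ray the integrand, in the variable s, is -(φ²)'/2, with φ = 0 at s = 0 and φ → φ(0)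
as s → ∞. The value at the origin is what L(u)² compensates. -/
lemma integral_norm_rpow_mul_radial (hN : 3 ≤ N) (hR : 0 < R)
    (hφ : IsTest (Metric.ball 0 R) φ) :
    2 * ∫ x, ‖x‖ ^ (-(N : ℝ)) * (φ x * fderiv ℝ φ x x) ∂(ballMeasure N R) =
      -(sphereArea N * φ 0 ^ 2) := by
  have hmp := measurePreserving_logPolar (N := N) hN hR
  set f : Euc N → ℝ := fun x => ‖x‖ ^ (-(N : ℝ)) * (φ x * fderiv ℝ φ x x) with hf
  have hint := integrable_norm_rpow_mul_radial hN hR hφ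
  have hint' : Integrable (fun z => f (logPolar R z))
      ((logRadialMeasure N R).prod (sphereMeasure N)) := hmp.integrable_comp_of_integrable hint
  have h1 : ∫ x, f x ∂(ballMeasure N R) =
      ∫ z, f (logPolar R z) ∂((logRadialMeasure N R).prod (sphereMeasure N)) := by
    rw [← hmp.map_eq, integral_map hmp.aemeasurable]
    rw [hmp.map_eq]
    exact hint.aestronglyMeasurable
  rw [h1, integral_prod_symm _ hint', ← integral_const_mul]
  have h2 : ∀ᵐ θ ∂(sphereMeasure N), 2 * ∫ s, f (logPolar R (s, θ)) ∂(logRadialMeasure N R) =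
      -(φ 0 ^ 2) := by
    filter_upwards [hint'.prod_left_ae] with θ hθ
    rw [integral_logRadialMeasure hR, ← integral_const_mul]
    have h3 : ∀ s, 2 * ((R * Real.exp (-s)) ^ N * f (logPolar R (s, θ))) =
        2 * (φ ((R * Real.exp (-s)) • (θ : Euc N)) * fderiv ℝ φ ((R * Real.exp (-s)) • (θ : Euc N))
          ((R * Real.exp (-s)) • (θ : Euc N))) := fun s => by
      have hr : 0 < R * Real.exp (-s) := by positivity
      simp only [hf, logPolar]
      rw [norm_logRadius_smul hR, ← mul_assoc ((R * Real.exp (-s)) ^ N), Real.rpow_neg hr.le,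
        Real.rpow_natCast, mul_inv_cancel₀ (by positivity), one_mul]
    have hθ' : IntegrableOn (fun s => 2 * ((R * Real.exp (-s)) ^ N * f (logPolar R (s, θ))))
        (Set.Ioi 0) := by
      rw [logRadialMeasure, integrable_withDensity_iff_integrable_smul' (by fun_prop)
        (Eventually.of_forall fun s => ENNReal.ofReal_lt_top)] at hθ
      refine (hθ.congr (Eventually.of_forall fun s => ?_)).const_mul 2
      have : 0 ≤ (R * Real.exp (-s)) ^ N := by positivity
      simp only [smul_eq_mul, ENNReal.toReal_ofReal this]
    simp only [h3] at hθ' ⊢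
    have hd : ∀ s, HasDerivAt (fun s => φ ((R * Real.exp (-s)) • (θ : Euc N)) ^ 2)
        (-(2 * (φ ((R * Real.exp (-s)) • (θ : Euc N)) *
          fderiv ℝ φ ((R * Real.exp (-s)) • (θ : Euc N)) ((R * Real.exp (-s)) • (θ : Euc N))))) s := by
      intro s
      refine ((hasDerivAt_comp_logRadius hφ.differentiable _ s).pow 2).congr_deriv ?_
      push_cast
      ring
    have hlim : Tendsto (fun s => φ ((R * Real.exp (-s)) • (θ : Euc N)) ^ 2) atTop
        (𝓝 (φ 0 ^ 2)) :=
      ((hφ.continuous.tendsto 0).comp (tendsto_logRadius_smul _)).pow 2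
    have h4 := integral_Ioi_of_hasDerivAt_of_tendsto' (fun s _ => hd s) hθ'.neg hlim
      (a := (0 : ℝ))
    have h5 : φ ((R * Real.exp (-0)) • (θ : Euc N)) = 0 := by
      refine hφ.eq_zero fun h => ?_
      rw [mem_ball_zero_iff, norm_logRadius_smul hR] at h
      simp at h
    rw [h5, integral_neg] at h4
    linarith
  rw [integral_congr_ae h2, integral_const, sphereMeasure_real_univ, smul_eq_mul]
  ring

end HardyForm

/-! ### Spherical means -/

section SphericalAverage

variable {N : ℕ} {R : ℝ} {φ : Euc N → ℝ}

lemma integrable_sphere {f : Metric.sphere (0 : Euc N) 1 → ℝ} (hf : Continuous f) :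
    Integrable f (sphereMeasure N) := by
  rw [← integrableOn_univ]
  exact hf.continuousOn.integrableOn_compact isCompact_univ

lemma average_sphere_eq (f : Metric.sphere (0 : Euc N) 1 → ℝ) :
    ⨍ θ, f θ ∂(sphereMeasure N) = (sphereArea N)⁻¹ * ∫ θ, f θ ∂(sphereMeasure N) := by
  rw [average_eq, sphereMeasure_real_univ, smul_eq_mul]

lemma average_sphere_const (hN : 3 ≤ N) (c : ℝ) : ⨍ _, c ∂(sphereMeasure N) = c := by
  rw [average_sphere_eq, integral_const, sphereMeasure_real_univ, smul_eq_mul,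
    inv_mul_cancel_left₀ (sphereArea_pos hN).ne']

/-- Jensen's inequality on the sphere for the square. -/
lemma sq_average_sphere_le (hN : 3 ≤ N) {f : Metric.sphere (0 : Euc N) 1 → ℝ}
    (hf : Continuous f) :
    sphereArea N * (⨍ θ, f θ ∂(sphereMeasure N)) ^ 2 ≤ ∫ θ, f θ ^ 2 ∂(sphereMeasure N) := by
  have hσ := sphereArea_pos hN
  set m := ⨍ θ, f θ ∂(sphereMeasure N) with hm
  have hI : ∫ θ, f θ ∂(sphereMeasure N) = sphereArea N * m := by
    rw [hm, average_sphere_eq, mul_inv_cancel_left₀ hσ.ne']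
  have h0 : 0 ≤ ∫ θ, (f θ - m) ^ 2 ∂(sphereMeasure N) := integral_nonneg fun θ => sq_nonneg _
  have h1 : ∀ θ, (f θ - m) ^ 2 = f θ ^ 2 - 2 * m * f θ + m ^ 2 := fun θ => by ring
  simp only [h1] at h0
  have i1 : Integrable (fun θ => f θ ^ 2) (sphereMeasure N) := integrable_sphere (hf.pow 2)
  have i2 : Integrable (fun θ => 2 * m * f θ) (sphereMeasure N) :=
    (integrable_sphere hf).const_mul _
  have i3 : Integrable (fun θ => f θ ^ 2 - 2 * m * f θ) (sphereMeasure N) := i1.sub i2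
  rw [integral_add i3 (integrable_const _), integral_sub i1 i2, integral_const_mul, hI,
    integral_const, sphereMeasure_real_univ, smul_eq_mul] at h0
  nlinarith

lemma continuous_average_smul {ψ : Euc N → ℝ} (hψ : Continuous ψ) :
    Continuous fun r : ℝ => ⨍ θ : Metric.sphere (0 : Euc N) 1, ψ (r • (θ : Euc N))
      ∂(sphereMeasure N) := by
  simp only [average_sphere_eq]
  have h : Continuous (Function.uncurry fun (r : ℝ) (θ : Metric.sphere (0 : Euc N) 1) =>
      ψ (r • (θ : Euc N))) := by
    unfold Function.uncurry
    fun_prop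
  have h2 := continuous_parametric_integral_of_continuous (μ := sphereMeasure N) h
    (s := Set.univ) isCompact_univ
  simp only [Measure.restrict_univ] at h2
  exact continuous_const.mul h2

/-- The factor r^a cancels the singular one, and the means of the continuous function φ over
shrinking spheres tend to φ(0). -/
lemma hardyL_singularMul (hN : 3 ≤ N) (hφ : Continuous φ) :
    hardyL (singularMul φ) =
      Real.sqrt ((N : ℝ) * ((N : ℝ) - 2) / 2 * volume.real (Metric.ball (0 : Euc N) 1)) * φ 0 := by
  have h1 : Tendsto (fun r : ℝ => r ^ (((N : ℝ) - 2) / 2) * sphericalMean (singularMul φ) r)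
      (𝓝[>] 0) (𝓝 (φ 0)) := by
    have h2 := ((continuous_average_smul hφ).tendsto 0).mono_left
      (nhdsWithin_le_nhds (s := Set.Ioi 0))
    simp only [zero_smul] at h2
    rw [average_sphere_const hN] at h2
    refine h2.congr' ?_
    filter_upwards [self_mem_nhdsWithin] with r hr
    have hr0 : (0 : ℝ) < r := hr
    have h3 : ∀ θ : Metric.sphere (0 : Euc N) 1, singularMul φ (r • (θ : Euc N)) =
        r ^ (-(((N : ℝ) - 2) / 2)) * φ (r • (θ : Euc N)) := fun θ => by
      rw [singularMul, norm_smul, norm_eq_of_mem_sphere, mul_one, Real.norm_of_nonneg hr0.le]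
    simp only [sphericalMean, h3]
    rw [average_sphere_eq, average_sphere_eq, integral_const_mul, mul_left_comm, ← mul_assoc,
      ← mul_assoc, mul_assoc (sphereArea N)⁻¹, ← Real.rpow_add hr0, add_neg_cancel,
      Real.rpow_zero, mul_one]
  rw [hardyL, h1.limUnder_eq]

lemma hardyL_singularMul_sq (hN : 3 ≤ N) (hφ : Continuous φ) :
    hardyL (singularMul φ) ^ 2 = ((N : ℝ) - 2) / 2 * (sphereArea N * φ 0 ^ 2) := by
  have hN' : (3 : ℝ) ≤ N := by exact_mod_cast hN
  have hk : (0 : ℝ) < N - 2 := by linarith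
  have h0 : 0 ≤ volume.real (Metric.ball (0 : Euc N) 1) := measureReal_nonneg
  rw [hardyL_singularMul hN hφ, mul_pow, Real.sq_sqrt (by positivity), sphereArea]
  ring

/-- The square of the norm of `H(B_R)` is a weighted Dirichlet integral. -/
theorem hForm_singularMul (hN : 3 ≤ N) (hR : 0 < R) (hφ : IsTest (Metric.ball 0 R) φ) :
    hForm R (singularMul φ) =
      ∫ x, ‖x‖ ^ (2 - (N : ℝ)) * ‖fderiv ℝ φ x‖ ^ 2 ∂(ballMeasure N R) := by
  have h0 : ∀ᵐ x : Euc N ∂(ballMeasure N R), x ≠ 0 :=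
    ae_restrict_of_ae (compl_mem_ae_iff.2 (by
      have := nontrivial_euc hN
      simp : volume ({0} : Set (Euc N)) = 0))
  rw [hForm, hardyL_singularMul_sq hN hφ.continuous, integral_congr_ae (h0.mono fun x hx =>
    norm_sq_fderiv_singularMul hx (hφ.differentiable x)),
    integral_sub (integrable_norm_rpow_mul_energy hN hR hφ)
      ((integrable_norm_rpow_mul_radial hN hR hφ).const_mul _), integral_const_mul]
  linear_combination -(((N : ℝ) - 2) / 2) * integral_norm_rpow_mul_radial hN hR hφ

/-- The spherical means of a function on the ball, in the logarithmic radial variable. -/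
noncomputable def logMean (R : ℝ) (φ : Euc N → ℝ) (s : ℝ) : ℝ :=
  ⨍ θ : Metric.sphere (0 : Euc N) 1, φ ((R * Real.exp (-s)) • (θ : Euc N)) ∂(sphereMeasure N)

/-- The derivative of `logMean`. -/
noncomputable def logMeanDeriv (R : ℝ) (φ : Euc N → ℝ) (s : ℝ) : ℝ :=
  logMean R (fun x => -(fderiv ℝ φ x x)) s

lemma continuous_logMean (hφ : Continuous φ) : Continuous (logMean R φ) := by
  have h : Continuous fun s : ℝ => R * Real.exp (-s) := by fun_prop
  exact (continuous_average_smul hφ).comp h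

lemma continuous_logMeanDeriv (hφ : ContDiff ℝ ∞ φ) : Continuous (logMeanDeriv R φ) :=
  continuous_logMean ((hφ.continuous_fderiv (by simp)).clm_apply continuous_id).neg

lemma hasDerivAt_logMean (hφ : IsTest (Metric.ball 0 R) φ) (s : ℝ) :
    HasDerivAt (logMean R φ) (logMeanDeriv R φ s) s := by
  have hc : Continuous fun x => -(fderiv ℝ φ x x) :=
    (hφ.continuous_fderiv.clm_apply continuous_id).neg
  have hK : HasCompactSupport fun x => -(fderiv ℝ φ x x) := by
    refine (hφ.2.1.fderiv ℝ).mono fun x hx => ?_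
    rw [Function.mem_support] at hx ⊢
    intro h
    rw [h] at hx
    simp at hx
  obtain ⟨C, hC⟩ := hc.bounded_above_of_compact_support hK
  have hm : ∀ s : ℝ, Continuous fun θ : Metric.sphere (0 : Euc N) 1 =>
      φ ((R * Real.exp (-s)) • (θ : Euc N)) := fun s => by
    have := hφ.continuous
    fun_prop
  have hm' : Continuous fun θ : Metric.sphere (0 : Euc N) 1 =>
      -(fderiv ℝ φ ((R * Real.exp (-s)) • (θ : Euc N)) ((R * Real.exp (-s)) • (θ : Euc N))) := by
    have h2 : Continuous fun θ : Metric.sphere (0 : Euc N) 1 =>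
      (R * Real.exp (-s)) • (θ : Euc N) := by fun_prop
    exact hc.comp h2
  have h := (hasDerivAt_integral_of_dominated_loc_of_deriv_le (μ := sphereMeasure N)
    (F := fun s θ => φ ((R * Real.exp (-s)) • (θ : Euc N)))
    (F' := fun s θ => -(fderiv ℝ φ ((R * Real.exp (-s)) • (θ : Euc N))
      ((R * Real.exp (-s)) • (θ : Euc N)))) (x₀ := s) (s := Set.univ) (bound := fun _ => C)
    univ_mem (Eventually.of_forall fun s => (hm s).aestronglyMeasurable)
    (integrable_sphere (hm s)) hm'.aestronglyMeasurable
    (Eventually.of_forall fun θ s _ => hC _) (integrable_const _)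
    (Eventually.of_forall fun θ s _ => hasDerivAt_comp_logRadius hφ.differentiable _ s)).2
  have h2 : logMean R φ = fun s => (sphereArea N)⁻¹ *
      ∫ θ : Metric.sphere (0 : Euc N) 1, φ ((R * Real.exp (-s)) • (θ : Euc N)) ∂(sphereMeasure N) := by
    ext s
    rw [logMean, average_sphere_eq]
  rw [logMeanDeriv, logMean, average_sphere_eq, h2]
  exact h.const_mul _

lemma logMean_zero (hN : 3 ≤ N) (hR : 0 < R) (hφ : IsTest (Metric.ball 0 R) φ) :
    logMean R φ 0 = 0 := by
  have h : ∀ θ : Metric.sphere (0 : Euc N) 1, φ ((R * Real.exp (-0)) • (θ : Euc N)) = 0 := by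
    intro θ
    refine hφ.eq_zero fun h => ?_
    rw [mem_ball_zero_iff, norm_logRadius_smul hR] at h
    simp at h
  simp only [logMean, h]
  exact average_sphere_const hN 0

lemma logMean_eq_integral (hN : 3 ≤ N) (hR : 0 < R) (hφ : IsTest (Metric.ball 0 R) φ) (s : ℝ) :
    logMean R φ s = ∫ r in (0 : ℝ)..s, logMeanDeriv R φ r := by
  rw [intervalIntegral.integral_eq_sub_of_hasDerivAt (fun r _ => hasDerivAt_logMean hφ r)
    ((continuous_logMeanDeriv hφ.1).intervalIntegrable _ _), logMean_zero hN hR hφ, sub_zero]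

lemma integrable_logRadialMeasure {f : ℝ → ℝ} :
    Integrable f (logRadialMeasure N R) → 0 < R →
      IntegrableOn (fun s => (R * Real.exp (-s)) ^ N * f s) (Set.Ioi 0) := by
  intro h hR
  rw [logRadialMeasure, integrable_withDensity_iff_integrable_smul' (by fun_prop)
    (Eventually.of_forall fun s => ENNReal.ofReal_lt_top)] at h
  refine h.congr (Eventually.of_forall fun s => ?_)
  have : 0 ≤ (R * Real.exp (-s)) ^ N := by positivity
  simp only [smul_eq_mul, ENNReal.toReal_ofReal this]

/-- On each sphere Jensen's inequality and |x·∇φ| ≤ |x||∇φ| are combined; the weight r^N r^{2-N} =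
r² is the square of the factor |x|. -/
theorem sphereArea_mul_integral_logMeanDeriv_sq_le (hN : 3 ≤ N) (hR : 0 < R)
    (hφ : IsTest (Metric.ball 0 R) φ) :
    IntegrableOn (fun s => logMeanDeriv R φ s ^ 2) (Set.Ioi 0) ∧
    sphereArea N * ∫ s in Set.Ioi (0 : ℝ), logMeanDeriv R φ s ^ 2 ≤ hForm R (singularMul φ) := by
  have hmp := measurePreserving_logPolar (N := N) hN hR
  have hσ := sphereArea_pos hN
  set f : Euc N → ℝ := fun x => ‖x‖ ^ (2 - (N : ℝ)) * ‖fderiv ℝ φ x‖ ^ 2 with hf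
  have hint : Integrable f (ballMeasure N R) := integrable_norm_rpow_mul_energy hN hR hφ
  have hint' : Integrable (fun z => f (logPolar R z))
      ((logRadialMeasure N R).prod (sphereMeasure N)) := hmp.integrable_comp_of_integrable hint
  have h1 : ∫ x, f x ∂(ballMeasure N R) =
      ∫ z, f (logPolar R z) ∂((logRadialMeasure N R).prod (sphereMeasure N)) := by
    rw [← hmp.map_eq, integral_map hmp.aemeasurable]
    rw [hmp.map_eq]
    exact hint.aestronglyMeasurable
  have h2 := integrable_logRadialMeasure hint'.integral_prod_left hR
  rw [integral_prod _ hint', integral_logRadialMeasure hR] at h1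
  have hle : ∀ s, sphereArea N * logMeanDeriv R φ s ^ 2 ≤
      (R * Real.exp (-s)) ^ N * ∫ θ, f (logPolar R (s, θ)) ∂(sphereMeasure N) := by
    intro s
    have hr : 0 < R * Real.exp (-s) := by positivity
    have hcs : Continuous fun θ : Metric.sphere (0 : Euc N) 1 => (R * Real.exp (-s)) • (θ : Euc N) := by
      fun_prop
    have hc1 : Continuous fun θ : Metric.sphere (0 : Euc N) 1 =>
        -(fderiv ℝ φ ((R * Real.exp (-s)) • (θ : Euc N)) ((R * Real.exp (-s)) • (θ : Euc N))) :=
      ((hφ.continuous_fderiv.clm_apply continuous_id).neg).comp hcs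
    have hc2 : Continuous fun θ : Metric.sphere (0 : Euc N) 1 =>
        (R * Real.exp (-s)) ^ 2 * ‖fderiv ℝ φ ((R * Real.exp (-s)) • (θ : Euc N))‖ ^ 2 :=
      continuous_const.mul (((hφ.continuous_fderiv.comp hcs).norm).pow 2)
    refine (sq_average_sphere_le hN hc1).trans ?_
    rw [← integral_const_mul]
    have e : ∀ θ : Metric.sphere (0 : Euc N) 1, (R * Real.exp (-s)) ^ N * f (logPolar R (s, θ)) =
        (R * Real.exp (-s)) ^ 2 * ‖fderiv ℝ φ ((R * Real.exp (-s)) • (θ : Euc N))‖ ^ 2 := fun θ => by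
      simp only [hf, logPolar]
      rw [norm_logRadius_smul hR, ← mul_assoc, ← Real.rpow_natCast, ← Real.rpow_add hr,
        show (N : ℝ) + (2 - N) = (2 : ℕ) by push_cast; ring, Real.rpow_natCast]
    simp only [e]
    refine integral_mono (integrable_sphere (hc1.pow 2)) (integrable_sphere hc2) fun θ => ?_
    have h3 := (fderiv ℝ φ ((R * Real.exp (-s)) • (θ : Euc N))).le_opNorm
      ((R * Real.exp (-s)) • (θ : Euc N))
    rw [norm_logRadius_smul hR] at h3
    dsimp only
    rw [neg_sq, ← sq_abs, ← mul_pow, mul_comm (R * Real.exp (-s))]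
    exact pow_le_pow_left₀ (abs_nonneg _) h3 2
  have hi : IntegrableOn (fun s => sphereArea N * logMeanDeriv R φ s ^ 2) (Set.Ioi 0) := by
    refine h2.mono' ((continuous_const.mul ((continuous_logMeanDeriv hφ.1).pow 2)).aestronglyMeasurable)
      (Eventually.of_forall fun s => ?_)
    rw [Real.norm_of_nonneg (by positivity)]
    exact hle s
  refine ⟨?_, ?_⟩
  · refine (hi.const_mul (sphereArea N)⁻¹).congr (Eventually.of_forall fun s => ?_)
    dsimp only
    rw [inv_mul_cancel_left₀ hσ.ne']
  · rw [hForm_singularMul hN hR hφ, h1, ← integral_const_mul]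
    exact integral_mono hi h2 hle

end SphericalAverage

/-! ### Talenti profiles as solitons, and the sharp constant -/

section TalentiSoliton

variable {N : ℕ} {R : ℝ}

lemma two_add_two_div (hN : 3 ≤ N) :
    2 + 2 / (((N : ℝ) - 2) / 2) = 2 * (N : ℝ) / ((N : ℝ) - 2) := by
  have hN' : (3 : ℝ) ≤ N := by exact_mod_cast hN
  have hk : (N : ℝ) - 2 ≠ 0 := by linarith
  field_simp
  ring

/-- With q = s^{1/(2a)}, m² + n² q^{-2} = 2|mn| q^{-1} cosh(log(q|m|/|n|)); the power -a of q^{-1}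
is √s. -/
lemma talenti_eq_soliton (hN : 3 ≤ N) {m n : ℝ} (hm : m ≠ 0) (hn : n ≠ 0) {s : ℝ} (hs : 0 < s) :
    talenti N m n (s ^ (-(1 / ((N : ℝ) - 2)))) = (2 * |m * n|) ^ (-(((N : ℝ) - 2) / 2)) *
      (√s * soliton (((N : ℝ) - 2) / 2) ((n ^ 2 / m ^ 2) ^ (((N : ℝ) - 2) / 2)) s) := by
  have hN' : (3 : ℝ) ≤ N := by exact_mod_cast hN
  have hk : (0 : ℝ) < N - 2 := by linarith
  set a : ℝ := ((N : ℝ) - 2) / 2 with ha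
  have ha0 : 0 < a := by positivity
  have hka : (N : ℝ) - 2 = 2 * a := by rw [ha]; ring
  have hm0 : 0 < |m| := abs_pos.2 hm
  have hn0 : 0 < |n| := abs_pos.2 hn
  set q := s ^ (1 / (2 * a)) with hq
  have hq0 : 0 < q := by positivity
  have hlog : Real.log (s / (n ^ 2 / m ^ 2) ^ a) / (2 * a) = Real.log (q * (|m| / |n|)) := by
    rw [Real.log_div hs.ne' (by positivity), Real.log_rpow (by positivity),
      Real.log_mul hq0.ne' (by positivity), hq, Real.log_rpow hs,
      Real.log_div hm0.ne' hn0.ne', Real.log_div (by positivity) (by positivity), ← sq_abs n,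
      ← sq_abs m, Real.log_pow, Real.log_pow]
    field_simp
    push_cast
    ring
  have hx : 0 < q * (|m| / |n|) := by positivity
  have hcosh : 2 * |m * n| * q⁻¹ * Real.cosh (Real.log (q * (|m| / |n|))) =
      m ^ 2 + n ^ 2 * (s ^ (-(1 / ((N : ℝ) - 2)))) ^ 2 := by
    have h1 : s ^ (-(1 / ((N : ℝ) - 2))) = q⁻¹ := by rw [hka, Real.rpow_neg hs.le]
    rw [h1, Real.cosh_log hx, ← sq_abs m, ← sq_abs n, abs_mul]
    field_simp
  have hsq : q⁻¹ ^ (-a) = √s := by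
    rw [Real.inv_rpow hq0.le, Real.rpow_neg hq0.le, inv_inv, hq, ← Real.rpow_mul hs.le,
      Real.sqrt_eq_rpow]
    congr 1
    field_simp
  rw [talenti, soliton, hlog, ← hcosh, Real.mul_rpow (by positivity) (Real.cosh_pos _).le,
    Real.mul_rpow (by positivity) (by positivity), hsq, mul_assoc]

lemma rpow_div_eq_weight (hN : 3 ≤ N) (v : ℝ) {s : ℝ} (hs : 0 < s) :
    |v / √s| ^ (2 * (N : ℝ) / ((N : ℝ) - 2)) / s =
      |v| ^ (2 * (N : ℝ) / ((N : ℝ) - 2)) * s ^ (-(2 * ((N : ℝ) - 1) / ((N : ℝ) - 2))) := by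
  have hN' : (3 : ℝ) ≤ N := by exact_mod_cast hN
  have hk : (N : ℝ) - 2 ≠ 0 := by linarith
  have h1 : s ^ (2 * ((N : ℝ) - 1) / ((N : ℝ) - 2)) = √s ^ (2 * (N : ℝ) / ((N : ℝ) - 2)) * s := by
    rw [Real.sqrt_eq_rpow, ← Real.rpow_mul hs.le, ← Real.rpow_add_one hs.ne']
    congr 1
    field_simp
    ring
  rw [abs_div, abs_of_nonneg (Real.sqrt_nonneg s),
    Real.div_rpow (abs_nonneg v) (Real.sqrt_nonneg s), Real.rpow_neg hs.le, h1]
  field_simp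

/-- Case m = n = 1 of `talenti_eq_soliton`, raised to the power 2*. It evaluates the soliton mass
through the Gamma integral. -/
lemma talentiMass_eq_solitonMass (hN : 3 ≤ N) :
    talentiMass N = sphereArea N / (N - 2) *
      ((2 : ℝ) ^ (-(N : ℝ)) * solitonMass (((N : ℝ) - 2) / 2)) := by
  have hN' : (3 : ℝ) ≤ N := by exact_mod_cast hN
  have hk : (0 : ℝ) < N - 2 := by linarith
  have ha0 : (0 : ℝ) < ((N : ℝ) - 2) / 2 := by positivity
  have hQ := (soliton_integrals ha0 one_pos).2.1
  rw [talentiMass, integral_euc_radial hN fun r => (1 + r ^ 2) ^ (-(N : ℝ)), solitonMass, ← hQ,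
    ← integral_const_mul ((2 : ℝ) ^ (-(N : ℝ)))]
  congr 1
  refine setIntegral_congr_fun measurableSet_Ioi fun s hs => ?_
  have hs0 : (0 : ℝ) < s := hs
  have h1 := talenti_eq_soliton hN one_ne_zero one_ne_zero hs0
  rw [talenti, mul_one, abs_one, mul_one, one_pow, div_one, Real.one_rpow, one_mul] at h1
  have hb : (0 : ℝ) < 1 + (s ^ (-(1 / ((N : ℝ) - 2)))) ^ 2 := by positivity
  have h2 : (1 + (s ^ (-(1 / ((N : ℝ) - 2)))) ^ 2) ^ (-(N : ℝ)) =
      ((1 + (s ^ (-(1 / ((N : ℝ) - 2)))) ^ 2) ^ (-(((N : ℝ) - 2) / 2))) ^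
        (2 * (N : ℝ) / ((N : ℝ) - 2)) := by
    rw [← Real.rpow_mul hb.le]
    congr 1
    field_simp
  have hsol := soliton_pos (((N : ℝ) - 2) / 2) 1 s
  have h3 := rpow_div_eq_weight hN (√s * soliton (((N : ℝ) - 2) / 2) 1 s) hs0
  rw [mul_div_cancel_left₀ _ (Real.sqrt_pos.2 hs0).ne', abs_of_pos hsol,
    abs_of_nonneg (mul_nonneg (Real.sqrt_nonneg s) hsol.le)] at h3
  rw [two_add_two_div hN, h3, h2, h1, Real.mul_rpow (by positivity)
    (mul_nonneg (Real.sqrt_nonneg s) hsol.le), ← Real.rpow_mul (by norm_num),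
    show -(((N : ℝ) - 2) / 2) * (2 * N / (N - 2)) = -(N : ℝ) by field_simp]
  ring

/-- Identifies C_HS with the constant of Bliss's inequality. The factor 1/4 is (2^{-N})^{2/N}, and
the powers of the sphere area have exponents 2/N and (N-2)/N, which add up to 1. -/
lemma hsConst_mul_sphereArea (hN : 3 ≤ N) :
    hsConst N * sphereArea N ^ (((N : ℝ) - 2) / N) = sphereArea N *
      (2 * (N : ℝ) / ((N : ℝ) - 2) / 8 * solitonMass (((N : ℝ) - 2) / 2) ^ (2 / (N : ℝ))) := by
  have hN' : (3 : ℝ) ≤ N := by exact_mod_cast hN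
  have hk : (0 : ℝ) < N - 2 := by linarith
  have hN0 : (0 : ℝ) < N := by linarith
  have ha0 : (0 : ℝ) < ((N : ℝ) - 2) / 2 := by positivity
  have hσ := sphereArea_pos hN
  have hQ := solitonMass_pos ha0
  set Q := solitonMass (((N : ℝ) - 2) / 2) with hQd
  have h1 : ((2 : ℝ) ^ (-(N : ℝ))) ^ (2 / (N : ℝ)) = 1 / 4 := by
    rw [← Real.rpow_mul (by norm_num), show -(N : ℝ) * (2 / N) = ((-2 : ℤ) : ℝ) by
      push_cast; field_simp, Real.rpow_intCast]
    norm_num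
  have h2 : sphereArea N ^ (2 / (N : ℝ)) * sphereArea N ^ (((N : ℝ) - 2) / N) = sphereArea N := by
    rw [← Real.rpow_add hσ, show 2 / (N : ℝ) + (N - 2) / N = 1 by field_simp; ring, Real.rpow_one]
  have h3 : ((N : ℝ) - 2) * (((N : ℝ) - 2) ^ (2 / (N : ℝ)))⁻¹ *
      ((N : ℝ) - 2) ^ (-(2 * ((N : ℝ) - 1) / N)) = ((N : ℝ) - 2)⁻¹ := by
    rw [← Real.rpow_neg hk.le, ← Real.rpow_one_add' hk.le, ← Real.rpow_add hk, ← Real.rpow_neg_one]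
    · congr 1
      field_simp
      ring
    · have : (2 : ℝ) / N < 1 := by rw [div_lt_one hN0]; linarith
      linarith
  rw [hsConst, sobolevConst_eq hN, talentiMass_eq_solitonMass hN, ← hQd,
    Real.mul_rpow (by positivity) (by positivity), Real.div_rpow hσ.le hk.le,
    Real.mul_rpow (by positivity) hQ.le, h1]
  have h4 : (N : ℝ) * (N - 2) * (sphereArea N ^ (2 / (N : ℝ)) / ((N : ℝ) - 2) ^ (2 / (N : ℝ)) *
      (1 / 4 * Q ^ (2 / (N : ℝ)))) * ((N : ℝ) - 2) ^ (-(2 * ((N : ℝ) - 1) / N)) *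
      sphereArea N ^ (((N : ℝ) - 2) / N) = N / 4 * Q ^ (2 / (N : ℝ)) *
      (((N : ℝ) - 2) * (((N : ℝ) - 2) ^ (2 / (N : ℝ)))⁻¹ *
      ((N : ℝ) - 2) ^ (-(2 * ((N : ℝ) - 1) / N))) *
      (sphereArea N ^ (2 / (N : ℝ)) * sphereArea N ^ (((N : ℝ) - 2) / N)) := by
    rw [div_eq_mul_inv (sphereArea N ^ (2 / (N : ℝ)))]
    ring
  rw [h4, h2, h3]
  field_simp
  ring

/-- Bliss's inequality for profiles, with the constant of the Hardy-Sobolev inequality, and its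
equality cases. -/
theorem bliss_profile (hN : 3 ≤ N) {h V : ℝ → ℝ} (hh : MemLp h 2 volume)
    (hV : ∀ s, V s = ∫ r in (0 : ℝ)..s, h r) :
    IntegrableOn (fun s => |V s| ^ (2 * (N : ℝ) / ((N : ℝ) - 2)) *
      s ^ (-(2 * ((N : ℝ) - 1) / ((N : ℝ) - 2)))) (Set.Ioi 0) ∧
    hsConst N * (sphereArea N * profileMass N V) ^ (((N : ℝ) - 2) / N) ≤
      sphereArea N * ∫ s in Set.Ioi (0 : ℝ), h s ^ 2 ∧
    (sphereArea N * ∫ s in Set.Ioi (0 : ℝ), h s ^ 2 ≤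
      hsConst N * (sphereArea N * profileMass N V) ^ (((N : ℝ) - 2) / N) →
      (∃ s > 0, V s ≠ 0) → ∃ m n : ℝ, m ≠ 0 ∧ n ≠ 0 ∧
        ((∀ s > 0, V s = talenti N m n (s ^ (-(1 / ((N : ℝ) - 2))))) ∨
          ∀ s > 0, V s = -talenti N m n (s ^ (-(1 / ((N : ℝ) - 2)))))) := by
  have hN' : (3 : ℝ) ≤ N := by exact_mod_cast hN
  have hk : (0 : ℝ) < N - 2 := by linarith
  have hN0 : (0 : ℝ) < N := by linarith
  set a : ℝ := ((N : ℝ) - 2) / 2 with ha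
  have ha0 : 0 < a := by positivity
  have hσ := sphereArea_pos hN
  obtain ⟨h1, h2, h3⟩ := bliss_inequality (y := fun s => V s / √s) ha0 hh
    (fun s => by simp only [hV])
  have e : Set.EqOn (fun s => |V s / √s| ^ (2 * (N : ℝ) / ((N : ℝ) - 2)) / s)
      (fun s => |V s| ^ (2 * (N : ℝ) / ((N : ℝ) - 2)) *
        s ^ (-(2 * ((N : ℝ) - 1) / ((N : ℝ) - 2)))) (Set.Ioi 0) :=
    fun s hs => rpow_div_eq_weight hN (V s) hs
  have hexp : 2 / (2 * (N : ℝ) / ((N : ℝ) - 2)) = ((N : ℝ) - 2) / N := by field_simp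
  have hexp' : 1 - ((N : ℝ) - 2) / N = 2 / N := by field_simp; ring
  rw [two_add_two_div hN, hexp, hexp', setIntegral_congr_fun measurableSet_Ioi e,
    ← profileMass] at h2
  rw [two_add_two_div hN, integrableOn_congr_fun e measurableSet_Ioi] at h1
  rw [two_add_two_div hN, hexp, hexp', setIntegral_congr_fun measurableSet_Ioi e,
    ← profileMass] at h3
  have hK : hsConst N * (sphereArea N * profileMass N V) ^ (((N : ℝ) - 2) / N) =
      sphereArea N * (2 * (N : ℝ) / ((N : ℝ) - 2) / 8 * solitonMass a ^ (2 / (N : ℝ)) *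
        profileMass N V ^ (((N : ℝ) - 2) / N)) := by
    rw [Real.mul_rpow hσ.le (profileMass_nonneg N V), ← mul_assoc, hsConst_mul_sphereArea hN, ← ha]
    ring
  rw [hK]
  refine ⟨h1, mul_le_mul_of_nonneg_left h2 hσ.le, fun hle hne => ?_⟩
  obtain ⟨s', hs', hVs'⟩ := hne
  obtain ⟨c, hc, s₁, hs₁, hsol⟩ := h3 (le_of_mul_le_mul_left hle hσ)
    ⟨s', hs', div_ne_zero hVs' (Real.sqrt_pos.2 hs').ne'⟩
  have hsol' : ∀ s > 0, V s = c * (√s * soliton a s₁ s) := fun s hs => by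
    have := hsol s hs
    rw [div_eq_iff (Real.sqrt_pos.2 hs).ne'] at this
    rw [this]
    ring
  have hc0 : 0 < |c| := abs_pos.2 hc
  -- With m = k/b and n = kb, the product mn = k² fixes the amplitude, (2k²)^{-a} = |c|, and the
  -- ratio n/m = b² fixes the centre, b^{4a} = s₁.
  set k := √(|c| ^ (-(1 / a)) / 2) with hkd
  have hk0 : 0 < k := Real.sqrt_pos.2 (by positivity)
  have hk2 : k ^ 2 = |c| ^ (-(1 / a)) / 2 := Real.sq_sqrt (by positivity)
  set b := s₁ ^ (1 / (4 * a)) with hb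
  have hb0 : 0 < b := by positivity
  have hb4 : (b ^ 4) ^ a = s₁ := by
    rw [hb, ← Real.rpow_natCast, ← Real.rpow_mul hs₁.le, ← Real.rpow_mul hs₁.le,
      show 1 / (4 * a) * (4 : ℕ) * a = 1 by push_cast; field_simp, Real.rpow_one]
  have hmn : (2 * |k * b⁻¹ * (k * b)|) ^ (-a) = |c| := by
    have : k * b⁻¹ * (k * b) = k ^ 2 := by field_simp
    rw [this, abs_of_pos (by positivity), hk2, mul_div_cancel₀ _ two_ne_zero,
      ← Real.rpow_mul hc0.le, show -(1 / a) * -a = 1 by field_simp, Real.rpow_one]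
  have hs₁' : ((k * b) ^ 2 / (k * b⁻¹) ^ 2) ^ a = s₁ := by
    have : (k * b) ^ 2 / (k * b⁻¹) ^ 2 = b ^ 4 := by field_simp
    rw [this, hb4]
  have hT : ∀ s > 0, talenti N (k * b⁻¹) (k * b) (s ^ (-(1 / ((N : ℝ) - 2)))) =
      |c| * (√s * soliton a s₁ s) := fun s hs => by
    rw [talenti_eq_soliton hN (by positivity) (by positivity) hs, ← ha, hmn, hs₁']
  refine ⟨k * b⁻¹, k * b, by positivity, by positivity, ?_⟩
  rcases lt_or_gt_of_ne hc with h | h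
  · refine Or.inr fun s hs => ?_
    rw [hT s hs, hsol' s hs, abs_of_neg h]
    ring
  · refine Or.inl fun s hs => ?_
    rw [hT s hs, hsol' s hs, abs_of_pos h]

/-- The profile of the extremal functions. -/
noncomputable def extremalProfile (N : ℕ) (m n s : ℝ) : ℝ :=
  talenti N m n (s ^ (-(1 / ((N : ℝ) - 2))))

lemma hsExtremal_eq_ballProfile (N : ℕ) (R m n : ℝ) :
    hsExtremal N R m n = ballProfile N R (extremalProfile N m n) := rfl

end TalentiSoliton

/-! ### Cutting off profiles -/

section Cutoff

/-- The weight is adapted to the arguments κs - 1 and s/κ - 1 of the cutoffs: adding 1 gives the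
factor that s d/ds produces. -/
lemma exists_bound_deriv_smoothTransition :
    ∃ K : ℝ, ∀ x, |(x + 1) * deriv Real.smoothTransition x| ≤ K := by
  have hc : Continuous fun x => (x + 1) * deriv Real.smoothTransition x :=
    (continuous_id.add continuous_const).mul
      ((Real.smoothTransition.contDiff (n := 1)).continuous_deriv le_rfl)
  obtain ⟨K, hK⟩ := (isCompact_Icc (a := (0 : ℝ)) (b := 1)).exists_bound_of_continuousOn
    hc.continuousOn
  have hK0 : 0 ≤ K := (norm_nonneg _).trans (hK 0 (by simp))
  refine ⟨K, fun x => ?_⟩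
  by_cases hx : x ∈ Set.Icc (0 : ℝ) 1
  · exact hK x hx
  · have : deriv Real.smoothTransition x = 0 := by
      rw [Set.mem_Icc, not_and_or, not_le, not_le] at hx
      rcases hx with hx | hx
      · have h : Real.smoothTransition =ᶠ[𝓝 x] fun _ => (0 : ℝ) := by
          filter_upwards [Iio_mem_nhds hx] with y hy
          exact Real.smoothTransition.zero_of_nonpos (le_of_lt hy)
        rw [h.deriv_eq, deriv_const]
      · have h : Real.smoothTransition =ᶠ[𝓝 x] fun _ => (1 : ℝ) := by
          filter_upwards [Ioi_mem_nhds hx] with y hy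
          exact Real.smoothTransition.one_of_one_le (le_of_lt hy)
        rw [h.deriv_eq, deriv_const]
    rw [this, mul_zero, abs_zero]
    exact hK0

/-- A cutoff function equal to `1` on `[2/κ, κ]` and supported in `[1/κ, 2κ]`. -/
noncomputable def logCutoff (κ s : ℝ) : ℝ :=
  Real.smoothTransition (κ * s - 1) * (1 - Real.smoothTransition (s / κ - 1))

lemma contDiff_logCutoff (κ : ℝ) : ContDiff ℝ ∞ (logCutoff κ) := by
  have h1 : ContDiff ℝ ∞ fun s : ℝ => κ * s - 1 := (contDiff_const.mul contDiff_id).sub contDiff_const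
  have h2 : ContDiff ℝ ∞ fun s : ℝ => s / κ - 1 := (contDiff_id.div_const κ).sub contDiff_const
  exact (Real.smoothTransition.contDiff.comp h1).mul
    (contDiff_const.sub (Real.smoothTransition.contDiff.comp h2))

lemma logCutoff_mem_Icc (κ s : ℝ) : logCutoff κ s ∈ Set.Icc (0 : ℝ) 1 := by
  have h1 := Real.smoothTransition.nonneg (κ * s - 1)
  have h2 := Real.smoothTransition.le_one (κ * s - 1)
  have h3 := Real.smoothTransition.nonneg (s / κ - 1)
  have h4 := Real.smoothTransition.le_one (s / κ - 1)
  exact ⟨mul_nonneg h1 (by linarith), mul_le_one₀ h2 (by linarith) (by linarith)⟩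

lemma logCutoff_ne_zero {κ s : ℝ} (hκ : 0 < κ) (h : logCutoff κ s ≠ 0) : 1 / κ ≤ s ∧ s ≤ 2 * κ := by
  constructor
  · by_contra hs
    rw [not_le, lt_div_iff₀ hκ] at hs
    refine h ?_
    rw [logCutoff, Real.smoothTransition.zero_of_nonpos (by linarith), zero_mul]
  · by_contra hs
    have h1 : 2 ≤ s / κ := by rw [le_div_iff₀ hκ]; linarith
    refine h ?_
    rw [logCutoff, Real.smoothTransition.one_of_one_le (x := s / κ - 1) (by linarith), sub_self,
      mul_zero]

lemma logCutoff_eq_one {κ s : ℝ} (hκ : 0 < κ) (h1 : 2 / κ < s) (h2 : s < κ) :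
    logCutoff κ s = 1 := by
  have h3 : s / κ ≤ 1 := by rw [div_le_one hκ]; exact h2.le
  rw [div_lt_iff₀ hκ] at h1
  rw [logCutoff, Real.smoothTransition.one_of_one_le (by linarith),
    Real.smoothTransition.zero_of_nonpos (by linarith), sub_zero, one_mul]

lemma deriv_logCutoff_eq_zero {κ s : ℝ} (hκ : 0 < κ) (h1 : 2 / κ < s) (h2 : s < κ) :
    deriv (logCutoff κ) s = 0 := by
  have h : logCutoff κ =ᶠ[𝓝 s] fun _ => (1 : ℝ) := by
    filter_upwards [Ioo_mem_nhds h1 h2] with y hy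
    exact logCutoff_eq_one hκ hy.1 hy.2
  rw [h.deriv_eq, deriv_const]

/-- Both cutoffs are dilations of a fixed function, so s d/ds of them is bounded uniformly in κ. The
error V η' is thus dominated by V/s, which is assumed square integrable. -/
lemma exists_bound_deriv_logCutoff :
    ∃ C : ℝ, ∀ κ > 0, ∀ s > 0, |deriv (logCutoff κ) s| ≤ C / s := by
  obtain ⟨K, hK⟩ := exists_bound_deriv_smoothTransition
  refine ⟨K + K, fun κ hκ s hs => ?_⟩
  have hT : ∀ x, HasDerivAt Real.smoothTransition (deriv Real.smoothTransition x) x := fun x =>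
    ((Real.smoothTransition.contDiff (n := 1)).differentiable one_ne_zero x).hasDerivAt
  have h1 : HasDerivAt (fun s : ℝ => κ * s - 1) κ s := by
    simpa using ((hasDerivAt_id s).const_mul κ).sub_const 1
  have h2 : HasDerivAt (fun s : ℝ => s / κ - 1) (1 / κ) s :=
    ((hasDerivAt_id s).div_const κ).sub_const 1
  have h3 : HasDerivAt (logCutoff κ) _ s :=
    ((hT _).comp s h1).mul (((hT _).comp s h2).const_sub 1)
  rw [h3.deriv, le_div_iff₀ hs]
  have a1 := Real.smoothTransition.nonneg (κ * s - 1)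
  have a2 := Real.smoothTransition.le_one (κ * s - 1)
  have a3 := Real.smoothTransition.nonneg (s / κ - 1)
  have a4 := Real.smoothTransition.le_one (s / κ - 1)
  have k1 := hK (κ * s - 1)
  have k2 := hK (s / κ - 1)
  rw [sub_add_cancel] at k1 k2
  have e : (deriv Real.smoothTransition (κ * s - 1) * κ *
      (1 - Real.smoothTransition (s / κ - 1)) +
      (Real.smoothTransition ∘ fun s => κ * s - 1) s *
        -(deriv Real.smoothTransition (s / κ - 1) * (1 / κ))) * s =
      (κ * s * deriv Real.smoothTransition (κ * s - 1)) *
        (1 - Real.smoothTransition (s / κ - 1)) -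
      Real.smoothTransition (κ * s - 1) * (s / κ * deriv Real.smoothTransition (s / κ - 1)) := by
    simp only [Function.comp]
    field_simp
    ring
  rw [← abs_of_pos hs, ← abs_mul, abs_of_pos hs, e]
  refine (abs_sub _ _).trans (add_le_add ?_ ?_)
  · rw [abs_mul]
    refine (mul_le_of_le_one_right (abs_nonneg _) ?_).trans k1
    rw [abs_of_nonneg (by linarith)]
    linarith
  · rw [abs_mul]
    refine (mul_le_of_le_one_left (abs_nonneg _) ?_).trans k2
    rw [abs_of_nonneg a1]
    exact a2

/-- Approximation by compactly supported profiles. -/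
theorem exists_profile_approx {V h : ℝ → ℝ} (hVs : ∀ s > 0, ContDiffAt ℝ ∞ V s)
    (hVd : ∀ s > 0, HasDerivAt V (h s) s) (hh : IntegrableOn (fun s => h s ^ 2) (Set.Ioi 0))
    (hm : Measurable h) (hV : IntegrableOn (fun s => V s ^ 2 / s ^ 2) (Set.Ioi 0)) :
    ∃ W : ℕ → ℝ → ℝ, (∀ k, IsProfile (W k)) ∧ (∀ k, ∀ s > 0, |W k s| ≤ |V s|) ∧
      (∀ s > 0, Tendsto (fun k => W k s) atTop (𝓝 (V s))) ∧
      (∀ k, IntegrableOn (fun s => (deriv (W k) s - h s) ^ 2) (Set.Ioi 0)) ∧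
      Tendsto (fun k => ∫ s in Set.Ioi (0 : ℝ), (deriv (W k) s - h s) ^ 2) atTop (𝓝 0) ∧
      Tendsto (fun k => ∫ s in Set.Ioi (0 : ℝ), deriv (W k) s ^ 2) atTop
        (𝓝 (∫ s in Set.Ioi (0 : ℝ), h s ^ 2)) := by
  obtain ⟨C, hC⟩ := exists_bound_deriv_logCutoff
  set κ : ℕ → ℝ := fun k => (k : ℝ) + 1 with hκ
  have hκ0 : ∀ k, 0 < κ k := fun k => by positivity
  have hκt : Tendsto κ atTop atTop := tendsto_atTop_add_const_right _ _ tendsto_natCast_atTop_atTop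
  set W : ℕ → ℝ → ℝ := fun k s => V s * logCutoff (κ k) s with hW
  have hWne : ∀ k s, W k s ≠ 0 → 1 / κ k ≤ s ∧ s ≤ 2 * κ k := fun k s hs =>
    logCutoff_ne_zero (hκ0 k) (right_ne_zero_of_mul hs)
  have hprof : ∀ k, IsProfile (W k) := fun k => by
    refine ⟨?_, 1 / κ k, by have := hκ0 k; positivity, 2 * κ k, by have := hκ0 k; positivity, hWne k⟩
    rw [contDiff_iff_contDiffAt]
    intro s
    by_cases hs : s < 1 / κ k
    · refine (contDiffAt_const (c := (0 : ℝ))).congr_of_eventuallyEq ?_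
      filter_upwards [Iio_mem_nhds hs] with r hr
      by_contra h'
      exact absurd (hWne k r h').1 (not_le.2 hr)
    · have hs0 : 0 < s := lt_of_lt_of_le (by have := hκ0 k; positivity) (not_lt.1 hs)
      exact (hVs s hs0).mul (contDiff_logCutoff _).contDiffAt
  have hder : ∀ k, ∀ s > 0, deriv (W k) s =
      h s * logCutoff (κ k) s + V s * deriv (logCutoff (κ k)) s := fun k s hs =>
    ((hVd s hs).mul (((contDiff_logCutoff (κ k)).differentiable (by simp) s).hasDerivAt)).deriv
  have hev : ∀ s > 0, ∀ᶠ k in atTop, 2 / κ k < s ∧ s < κ k := fun s hs => by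
    filter_upwards [hκt.eventually_gt_atTop (2 / s), hκt.eventually_gt_atTop s] with k h1 h2
    rw [div_lt_iff₀ hs] at h1
    refine ⟨?_, h2⟩
    rw [div_lt_iff₀ (hκ0 k)]
    linarith
  have hbd : ∀ k, ∀ s > 0, deriv (W k) s ^ 2 ≤ 2 * h s ^ 2 + 2 * C ^ 2 * (V s ^ 2 / s ^ 2) := by
    intro k s hs
    rw [hder k s hs]
    obtain ⟨c0, c1⟩ := logCutoff_mem_Icc (κ k) s
    have h2 : (deriv (logCutoff (κ k)) s) ^ 2 ≤ C ^ 2 / s ^ 2 := by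
      rw [← sq_abs, ← div_pow]
      exact pow_le_pow_left₀ (abs_nonneg _) (hC _ (hκ0 k) s hs) 2
    have h3 : (h s * logCutoff (κ k) s) ^ 2 ≤ h s ^ 2 := by
      rw [mul_pow]
      exact mul_le_of_le_one_right (sq_nonneg _) (pow_le_one₀ c0 c1)
    have h4 : (V s * deriv (logCutoff (κ k)) s) ^ 2 ≤ C ^ 2 * (V s ^ 2 / s ^ 2) := by
      rw [mul_pow]
      calc _ ≤ V s ^ 2 * (C ^ 2 / s ^ 2) := mul_le_mul_of_nonneg_left h2 (sq_nonneg _)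
        _ = _ := by ring
    nlinarith [sq_nonneg (h s * logCutoff (κ k) s - V s * deriv (logCutoff (κ k)) s)]
  have hdm : ∀ k, Measurable (deriv (W k)) := fun k => measurable_deriv _
  have hdom : IntegrableOn (fun s => 2 * h s ^ 2 + 2 * C ^ 2 * (V s ^ 2 / s ^ 2)) (Set.Ioi 0) :=
    (hh.const_mul _).add (hV.const_mul _)
  have hdom' : IntegrableOn (fun s => 2 * (2 * h s ^ 2 + 2 * C ^ 2 * (V s ^ 2 / s ^ 2)) +
      2 * h s ^ 2) (Set.Ioi 0) := (hdom.const_mul _).add (hh.const_mul _)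
  have hbd' : ∀ k, ∀ s > 0, (deriv (W k) s - h s) ^ 2 ≤
      2 * (2 * h s ^ 2 + 2 * C ^ 2 * (V s ^ 2 / s ^ 2)) + 2 * h s ^ 2 := fun k s hs => by
    nlinarith [hbd k s hs, sq_nonneg (deriv (W k) s + h s)]
  -- For fixed s the cutoff is eventually 1 near s, so pointwise convergence is eventual equality.
  have hlim : ∀ s > 0, ∀ᶠ k in atTop, deriv (W k) s = h s := fun s hs => by
    filter_upwards [hev s hs] with k hk
    rw [hder k s hs, logCutoff_eq_one (hκ0 k) hk.1 hk.2, deriv_logCutoff_eq_zero (hκ0 k) hk.1 hk.2]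
    ring
  refine ⟨W, hprof, fun k s hs => ?_, fun s hs => ?_, fun k => ?_, ?_, ?_⟩
  · obtain ⟨c0, c1⟩ := logCutoff_mem_Icc (κ k) s
    simp only [hW]
    rw [abs_mul, abs_of_nonneg c0]
    exact mul_le_of_le_one_right (abs_nonneg _) c1
  · refine tendsto_const_nhds.congr' ?_
    filter_upwards [hev s hs] with k hk
    simp only [hW]
    rw [logCutoff_eq_one (hκ0 k) hk.1 hk.2, mul_one]
  · refine hdom'.mono' (((hdm k).sub hm).pow_const 2).aestronglyMeasurable ?_
    refine (ae_restrict_iff' measurableSet_Ioi).2 (Eventually.of_forall fun s hs => ?_)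
    rw [Real.norm_of_nonneg (sq_nonneg _)]
    exact hbd' k s hs
  · have hmk : ∀ k, Measurable fun s => (deriv (W k) s - h s) ^ 2 := fun k =>
      ((hdm k).sub hm).pow_const 2
    have key := tendsto_integral_of_dominated_convergence
      (F := fun k s => (deriv (W k) s - h s) ^ 2) (f := fun _ => (0 : ℝ)) _
      (fun k => (hmk k).aestronglyMeasurable) hdom' (fun k => by
        refine (ae_restrict_iff' measurableSet_Ioi).2 (Eventually.of_forall fun s hs => ?_)
        rw [Real.norm_of_nonneg (sq_nonneg _)]
        exact hbd' k s hs) (by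
        refine (ae_restrict_iff' measurableSet_Ioi).2 (Eventually.of_forall fun s hs => ?_)
        refine tendsto_const_nhds.congr' ?_
        filter_upwards [hlim s hs] with k hk
        rw [hk]
        simp)
    rwa [integral_zero] at key
  · refine tendsto_integral_of_dominated_convergence _
      (fun k => ((hdm k).pow_const 2).aestronglyMeasurable) hdom (fun k => ?_) ?_
    · refine (ae_restrict_iff' measurableSet_Ioi).2 (Eventually.of_forall fun s hs => ?_)
      rw [Real.norm_of_nonneg (sq_nonneg _)]
      exact hbd k s hs
    · refine (ae_restrict_iff' measurableSet_Ioi).2 (Eventually.of_forall fun s hs => ?_)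
      refine tendsto_const_nhds.congr' ?_
      filter_upwards [hlim s hs] with k hk
      rw [hk]

end Cutoff

/-! ### The extremal profile -/

section Extremal

variable {N : ℕ} {R m n : ℝ}

lemma extremalProfile_pos (hm : m ≠ 0) (s : ℝ) : 0 < extremalProfile N m n s := by
  unfold extremalProfile talenti
  positivity

lemma contDiffAt_extremalProfile (hm : m ≠ 0) {s : ℝ} (hs : 0 < s) :
    ContDiffAt ℝ ∞ (extremalProfile N m n) s := by
  have h1 : ContDiffAt ℝ ∞ (fun s : ℝ => s ^ (-(1 / ((N : ℝ) - 2)))) s :=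
    contDiffAt_id.rpow_const_of_ne hs.ne'
  have h2 : ContDiffAt ℝ ∞ (fun s : ℝ => m ^ 2 + n ^ 2 * (s ^ (-(1 / ((N : ℝ) - 2)))) ^ 2) s :=
    contDiffAt_const.add (contDiffAt_const.mul (h1.pow 2))
  exact h2.rpow_const_of_ne (by positivity)

/-- The extremal profile has a square integrable derivative and realizes equality in Bliss's
inequality. -/
theorem exists_deriv_extremalProfile (hN : 3 ≤ N) (hm : m ≠ 0) (hn : n ≠ 0) :
    ∃ h : ℝ → ℝ, Measurable h ∧ MemLp h 2 volume ∧
      (∀ s > 0, HasDerivAt (extremalProfile N m n) (h s) s) ∧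
      (∀ s > 0, extremalProfile N m n s = ∫ r in (0 : ℝ)..s, h r) ∧
      IntegrableOn (fun s => extremalProfile N m n s ^ 2 / s ^ 2) (Set.Ioi 0) ∧
      sphereArea N * ∫ s in Set.Ioi (0 : ℝ), h s ^ 2 = hsConst N *
        (sphereArea N * profileMass N (extremalProfile N m n)) ^ (((N : ℝ) - 2) / N) ∧
      0 < profileMass N (extremalProfile N m n) := by
  have hN' : (3 : ℝ) ≤ N := by exact_mod_cast hN
  have hk : (0 : ℝ) < N - 2 := by linarith
  have hN0 : (0 : ℝ) < N := by linarith
  set a : ℝ := ((N : ℝ) - 2) / 2 with ha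
  have ha0 : 0 < a := by positivity
  have hσ := sphereArea_pos hN
  set s₁ : ℝ := (n ^ 2 / m ^ 2) ^ a with hs₁d
  have hs₁ : 0 < s₁ := by positivity
  set c : ℝ := (2 * |m * n|) ^ (-a) with hcd
  have hc : 0 < c := by
    have : 0 < |m * n| := abs_pos.2 (mul_ne_zero hm hn)
    positivity
  have hV : ∀ s > 0, extremalProfile N m n s = c * (√s * soliton a s₁ s) := fun s hs =>
    talenti_eq_soliton hN hm hn hs
  obtain ⟨hi1, hi2, hi3⟩ := soliton_integrals ha0 hs₁
  have hQ := solitonMass_pos ha0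
  have hmass : profileMass N (extremalProfile N m n) =
      c ^ (2 * (N : ℝ) / ((N : ℝ) - 2)) * solitonMass a := by
    rw [solitonMass, ← hi2, ← integral_const_mul, profileMass]
    refine setIntegral_congr_fun measurableSet_Ioi fun s hs => ?_
    have hs0 : (0 : ℝ) < s := hs
    have hq := (Real.sqrt_pos.2 hs0).ne'
    have hsol := soliton_pos a s₁ s
    rw [← rpow_div_eq_weight hN _ hs0, hV s hs0, two_add_two_div hN,
      show c * (√s * soliton a s₁ s) / √s = c * soliton a s₁ s by field_simp,
      abs_of_pos (by positivity), Real.mul_rpow hc.le hsol.le]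
    ring
  refine ⟨fun s => c * solitonDeriv a s₁ s, (measurable_solitonDeriv a s₁).const_mul c,
    (memLp_solitonDeriv ha0 hs₁).const_mul c, fun s hs => ?_, fun s hs => ?_, ?_, ?_, ?_⟩
  · have h1 := (hasDerivAt_sqrt_mul_soliton ha0 hs₁ hs).const_mul c
    refine h1.congr_of_eventuallyEq ?_
    filter_upwards [Ioi_mem_nhds hs] with r hr
    exact hV r hr
  · rw [intervalIntegral.integral_const_mul, integral_solitonDeriv ha0 hs₁ hs, hV s hs]
  · refine ((integrableOn_congr_fun (fun s hs => ?_) measurableSet_Ioi).2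
      ((integrableOn_soliton_sq_div ha0 hs₁).const_mul (c ^ 2)))
    have hs0 : (0 : ℝ) < s := hs
    rw [hV s hs0, mul_pow, mul_pow, Real.sq_sqrt hs0.le]
    field_simp
  -- The virial identity makes the energy p/8 times the mass. Equality in Bliss's inequality is then
  -- the splitting of the mass into its powers 2/N and (N-2)/N.
  · have h2 : ∫ s in Set.Ioi (0 : ℝ), (c * solitonDeriv a s₁ s) ^ 2 =
        c ^ 2 * (2 * (N : ℝ) / ((N : ℝ) - 2) / 8 * solitonMass a) := by
      simp only [mul_pow]
      rw [integral_const_mul, hi3, two_add_two_div hN, ← two_add_two_div hN, hi2, solitonMass]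
    have h3 : (c ^ (2 * (N : ℝ) / ((N : ℝ) - 2))) ^ (((N : ℝ) - 2) / N) = c ^ 2 := by
      rw [← Real.rpow_mul hc.le, ← Real.rpow_natCast]
      congr 1
      push_cast
      field_simp
    have h4 : solitonMass a ^ (2 / (N : ℝ)) * solitonMass a ^ (((N : ℝ) - 2) / N) =
        solitonMass a := by
      rw [← Real.rpow_add hQ, show 2 / (N : ℝ) + (N - 2) / N = 1 by field_simp; ring, Real.rpow_one]
    rw [hmass, Real.mul_rpow hσ.le (by positivity), ← mul_assoc, hsConst_mul_sphereArea hN, ← ha,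
      Real.mul_rpow (by positivity) hQ.le, h3, h2]
    linear_combination -sphereArea N * (2 * (N : ℝ) / ((N : ℝ) - 2) / 8) * c ^ 2 * h4
  · rw [hmass]
    positivity

end Extremal

/-! ### The best constant for profiles -/

section BestConstant

variable {N : ℕ} {R m n : ℝ} {V : ℝ → ℝ}

lemma eqOn_mass_of_eqOn {V₁ V₂ : ℝ → ℝ} (h : ∀ s > 0, V₁ s = V₂ s) :
    Set.EqOn (fun s => |V₁ s| ^ (2 * (N : ℝ) / ((N : ℝ) - 2)) *
      s ^ (-(2 * ((N : ℝ) - 1) / ((N : ℝ) - 2)))) (fun s => |V₂ s| ^ (2 * (N : ℝ) / ((N : ℝ) - 2)) *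
      s ^ (-(2 * ((N : ℝ) - 1) / ((N : ℝ) - 2)))) (Set.Ioi 0) := fun s hs => by
  simp only [h s hs]

theorem hsConst_mul_profileMass_le (hN : 3 ≤ N) (hV : IsProfile V) :
    hsConst N * (sphereArea N * profileMass N V) ^ (((N : ℝ) - 2) / (N : ℝ)) ≤
      sphereArea N * profileEnergy V := by
  have hVd : Differentiable ℝ V := hV.1.differentiable (by simp)
  have hVc' : Continuous (deriv V) := hV.1.continuous_deriv (by simp)
  refine (bliss_profile hN (h := deriv V) (V := V)
    (hVc'.memLp_of_hasCompactSupport hV.hasCompactSupport.deriv) fun s => ?_).2.1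
  rw [intervalIntegral.integral_eq_sub_of_hasDerivAt (fun r _ => (hVd r).hasDerivAt)
    (hVc'.intervalIntegrable _ _), hV.eq_zero le_rfl, sub_zero]

lemma integrableOn_extremal_mass (hN : 3 ≤ N) (hm : m ≠ 0) (hn : n ≠ 0) :
    IntegrableOn (fun s => |extremalProfile N m n s| ^ (2 * (N : ℝ) / ((N : ℝ) - 2)) *
      s ^ (-(2 * ((N : ℝ) - 1) / ((N : ℝ) - 2)))) (Set.Ioi 0) := by
  obtain ⟨h, -, hL, -, hV, -⟩ := exists_deriv_extremalProfile hN hm hn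
  exact (integrableOn_congr_fun (eqOn_mass_of_eqOn hV) measurableSet_Ioi).2
    (bliss_profile hN hL fun s => rfl).1

/-- The extremal profile is not compactly supported, so its cutoffs are inserted. As |W k| ≤ |V|,
the masses converge by domination, and the energies converge by construction. -/
theorem le_hsConst_of_forall_profile (hN : 3 ≤ N) {C : ℝ}
    (hC : ∀ V, IsProfile V → C * (sphereArea N * profileMass N V) ^ (((N : ℝ) - 2) / (N : ℝ)) ≤
      sphereArea N * profileEnergy V) : C ≤ hsConst N := by
  have hN' : (3 : ℝ) ≤ N := by exact_mod_cast hN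
  have hk : (0 : ℝ) < N - 2 := by linarith
  have hσ := sphereArea_pos hN
  obtain ⟨h, hhm, hL, hd, -, hVs, hE, hpos⟩ :=
    exists_deriv_extremalProfile hN (one_ne_zero (α := ℝ)) (one_ne_zero (α := ℝ))
  obtain ⟨W, hW, hWle, hWlim, -, -, hWE⟩ := exists_profile_approx
    (fun s hs => contDiffAt_extremalProfile (N := N) (n := 1) (one_ne_zero (α := ℝ)) hs) hd
    hL.integrable_sq.integrableOn hhm hVs
  have hp : 0 ≤ 2 * (N : ℝ) / ((N : ℝ) - 2) := by positivity
  have hM : Tendsto (fun k => profileMass N (W k)) atTop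
      (𝓝 (profileMass N (extremalProfile N 1 1))) := by
    refine tendsto_integral_of_dominated_convergence _ (fun k => ?_)
      (integrableOn_extremal_mass hN one_ne_zero one_ne_zero) (fun k => ?_) ?_
    · have h1 : Measurable fun s => |W k s| ^ (2 * (N : ℝ) / ((N : ℝ) - 2)) *
          s ^ (-(2 * ((N : ℝ) - 1) / ((N : ℝ) - 2))) :=
        ((hW k).1.continuous.measurable.abs.pow_const _).mul (measurable_id.pow_const _)
      exact h1.aestronglyMeasurable
    · refine (ae_restrict_iff' measurableSet_Ioi).2 (Eventually.of_forall fun s hs => ?_)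
      have hs0 : (0 : ℝ) < s := hs
      rw [Real.norm_of_nonneg (by positivity)]
      exact mul_le_mul_of_nonneg_right (Real.rpow_le_rpow (abs_nonneg _) (hWle k s hs0) hp)
        (by positivity)
    · refine (ae_restrict_iff' measurableSet_Ioi).2 (Eventually.of_forall fun s hs => ?_)
      exact (((hWlim s hs).abs).rpow_const (Or.inr hp)).mul_const _
  have hlim1 : Tendsto (fun k => C * (sphereArea N * profileMass N (W k)) ^ (((N : ℝ) - 2) / N))
      atTop (𝓝 (C * (sphereArea N * profileMass N (extremalProfile N 1 1)) ^ (((N : ℝ) - 2) / N))) :=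
    ((hM.const_mul _).rpow_const (Or.inr (by positivity))).const_mul C
  have hlim2 := hWE.const_mul (sphereArea N)
  rw [hE] at hlim2
  have hle := le_of_tendsto_of_tendsto' hlim1 hlim2 fun k => hC _ (hW k)
  exact le_of_mul_le_mul_right hle (by positivity)

end BestConstant

/-! ### The extremals belong to H(B_R) -/

section ExtremalInH

variable {N : ℕ} {R m n : ℝ} {V : ℝ → ℝ}

/-- The function `V(-log (|x|/R))`. -/
noncomputable def logRadial (N : ℕ) (R : ℝ) (V : ℝ → ℝ) (x : Euc N) : ℝ := V (-Real.log (‖x‖ / R))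

lemma isTest_logRadial (hR : 0 < R) (hV : IsProfile V) :
    IsTest (Metric.ball 0 R) (logRadial N R V) := by
  have hW : IsProfile fun s => (R * Real.exp (-s)) ^ (((N : ℝ) - 2) / 2) * V s := by
    obtain ⟨hs, c, hc, d, hd, h⟩ := hV
    refine ⟨?_, c, hc, d, hd, fun s hs => h s (right_ne_zero_of_mul hs)⟩
    have h1 : ContDiff ℝ ∞ fun s : ℝ => R * Real.exp (-s) :=
      contDiff_const.mul (Real.contDiff_exp.comp contDiff_neg)
    exact (h1.rpow_const_of_ne fun s => by positivity).mul hs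
  have h2 : logRadial N R V =
      ballProfile N R fun s => (R * Real.exp (-s)) ^ (((N : ℝ) - 2) / 2) * V s := by
    ext x
    by_cases hx : x = 0
    · rw [logRadial, ballProfile, hx, norm_zero, zero_div, Real.log_zero, neg_zero,
        hV.eq_zero le_rfl, mul_zero, mul_zero]
    · have hx0 : 0 < ‖x‖ := norm_pos_iff.2 hx
      have h1 : R * Real.exp (-(-Real.log (‖x‖ / R))) = ‖x‖ := by
        rw [neg_neg, Real.exp_log (by positivity)]
        field_simp
      rw [logRadial, ballProfile, h1, ← mul_assoc, ← Real.rpow_add hx0, neg_add_cancel,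
        Real.rpow_zero, one_mul]
  rw [h2]
  have h3 := isTest_ballProfile (N := N) hR hW
  exact ⟨h3.1, h3.2.1, h3.2.2.trans Set.sdiff_subset⟩

lemma hForm_logRadial (hN : 3 ≤ N) (hR : 0 < R) (hV : IsProfile V) :
    hForm R (singularMul (logRadial N R V)) = sphereArea N * profileEnergy V := by
  have hVd : Differentiable ℝ V := hV.1.differentiable (by simp)
  have h0 : ∀ᵐ x : Euc N ∂(ballMeasure N R), x ≠ 0 :=
    ae_restrict_of_ae (compl_mem_ae_iff.2 (by
      have := nontrivial_euc hN
      simp : volume ({0} : Set (Euc N)) = 0))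
  set g' : ℝ → ℝ := fun r => deriv V (-Real.log (r / R)) * -(1 / R / (r / R)) with hg'
  have h1 : ∫ x, ‖x‖ ^ (2 - (N : ℝ)) * ‖fderiv ℝ (logRadial N R V) x‖ ^ 2 ∂(ballMeasure N R) =
      ∫ x, (fun r => r ^ (2 - (N : ℝ)) * g' r ^ 2) ‖x‖ ∂(ballMeasure N R) := by
    refine integral_congr_ae (h0.mono fun x hx => ?_)
    have hr := norm_pos_iff.2 hx
    have h2 : HasDerivAt (fun r => -Real.log (r / R)) (-(1 / R / (‖x‖ / R))) ‖x‖ :=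
      (((hasDerivAt_id _).div_const R).log (div_pos hr hR).ne').neg
    have h3 : HasDerivAt (fun r => V (-Real.log (r / R))) (g' ‖x‖) ‖x‖ :=
      (hVd _).hasDerivAt.comp _ h2
    dsimp only
    rw [show logRadial N R V = fun x => (fun r => V (-Real.log (r / R))) ‖x‖ from rfl,
      norm_fderiv_radial hN hx h3, sq_abs]
  rw [hForm_singularMul hN hR (isTest_logRadial hR hV), h1,
    integral_ball_radial hN hR fun r => r ^ (2 - (N : ℝ)) * g' r ^ 2, profileEnergy]
  congr 1
  refine setIntegral_congr_fun measurableSet_Ioi fun s _ => ?_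
  have hr : 0 < R * Real.exp (-s) := by positivity
  simp only [hg', logRadius_div hR]
  rw [← mul_assoc, ← Real.rpow_natCast, ← Real.rpow_add hr,
    show (N : ℝ) + (2 - N) = (2 : ℕ) by push_cast; ring, Real.rpow_natCast]
  field_simp

lemma isProfile_sub {V₁ V₂ : ℝ → ℝ} (h₁ : IsProfile V₁) (h₂ : IsProfile V₂) :
    IsProfile (V₁ - V₂) := by
  obtain ⟨hs, c, hc, d, hd, h⟩ := h₁
  obtain ⟨hs', c', hc', d', hd', h'⟩ := h₂
  refine ⟨hs.sub hs', min c c', lt_min hc hc', max d d', lt_max_of_lt_left hd, fun s hne => ?_⟩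
  by_cases h0 : V₁ s = 0
  · have h1 := h' s fun h1 => hne (by simp [h0, h1])
    exact ⟨(min_le_right _ _).trans h1.1, h1.2.trans (le_max_right _ _)⟩
  · have h1 := h s h0
    exact ⟨(min_le_left _ _).trans h1.1, h1.2.trans (le_max_left _ _)⟩

lemma measurable_extremalProfile (N : ℕ) (m n : ℝ) : Measurable (extremalProfile N m n) := by
  unfold extremalProfile talenti
  exact ((((measurable_id.pow_const _).pow_const 2).const_mul _).const_add _).pow_const _

lemma measurable_ballProfile (hV : Measurable V) : Measurable (ballProfile N R V) :=
  (measurable_norm.pow_const _).mul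
    (hV.comp (Real.measurable_log.comp (measurable_norm.div_const R)).neg)

lemma logVar_pos (hR : 0 < R) {x : Euc N} (hx : x ≠ 0) (hxR : x ∈ Metric.ball 0 R) :
    0 < -Real.log (‖x‖ / R) :=
  neg_pos.2 (Real.log_neg (div_pos (norm_pos_iff.2 hx) hR)
    ((div_lt_one hR).2 (mem_ball_zero_iff.1 hxR)))

lemma ae_ball_ne_zero (hN : 3 ≤ N) (R : ℝ) :
    ∀ᵐ x : Euc N ∂(ballMeasure N R), x ≠ 0 ∧ x ∈ Metric.ball 0 R := by
  have := nontrivial_euc hN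
  filter_upwards [ae_restrict_of_ae (s := Metric.ball (0 : Euc N) R)
    (compl_mem_ae_iff.2 (by simp : volume ({0} : Set (Euc N)) = 0)),
    ae_restrict_mem (μ := volume) (Metric.isOpen_ball (x := (0 : Euc N)) (ε := R)).measurableSet]
    with x h1 h2
  exact ⟨h1, h2⟩

/-- The squared singular factor and r^N combine to r² = R² e^{-2s}, and s e^{-s} ≤ 1 compares this
with R²/s². -/
lemma integrable_sq_ballProfile (hN : 3 ≤ N) (hR : 0 < R) (hVm : Measurable V)
    (hV : IntegrableOn (fun s => V s ^ 2 / s ^ 2) (Set.Ioi 0)) :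
    Integrable (fun x => ballProfile N R V x ^ 2) (ballMeasure N R) := by
  have h := integrable_ball_radial hN hR fun r =>
    (r ^ (-(((N : ℝ) - 2) / 2)) * V (-Real.log (r / R))) ^ 2
  refine h.2 ((hV.const_mul (R ^ 2)).mono' ?_ ?_)
  · have h1 : Measurable fun s => (R * Real.exp (-s)) ^ N *
        ((R * Real.exp (-s)) ^ (-(((N : ℝ) - 2) / 2)) *
          V (-Real.log (R * Real.exp (-s) / R))) ^ 2 := by
      simp only [logRadius_div hR]
      fun_prop
    exact h1.aestronglyMeasurable
  · refine (ae_restrict_iff' measurableSet_Ioi).2 (Eventually.of_forall fun s hs => ?_)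
    have hs0 : (0 : ℝ) < s := hs
    have hr : 0 < R * Real.exp (-s) := by positivity
    rw [Real.norm_of_nonneg (by positivity), logRadius_div hR,
      mul_pow ((R * Real.exp (-s)) ^ (-(((N : ℝ) - 2) / 2))) (V s), ← mul_assoc,
      ← Real.rpow_natCast, ← Real.rpow_natCast (_ ^ _) 2, ← Real.rpow_mul hr.le, ← Real.rpow_add hr,
      show (N : ℝ) + -(((N : ℝ) - 2) / 2) * (2 : ℕ) = (2 : ℕ) by push_cast; ring, Real.rpow_natCast]
    have h2 : s * Real.exp (-s) ≤ 1 := by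
      have h3 := Real.add_one_le_exp s
      have h4 : Real.exp s * Real.exp (-s) = 1 := by rw [← Real.exp_add, add_neg_cancel, Real.exp_zero]
      nlinarith [Real.exp_pos (-s)]
    have h5 : (R * Real.exp (-s)) ^ 2 * V s ^ 2 = R ^ 2 * (V s ^ 2 / s ^ 2) * (s * Real.exp (-s)) ^ 2 := by
      field_simp
    rw [h5]
    exact mul_le_of_le_one_right (by positivity) (pow_le_one₀ (by positivity) h2)

lemma eLpNorm_two_eq_lintegral {α : Type*} [MeasurableSpace α] (μ : Measure α) (f : α → ℝ) :
    eLpNorm f 2 μ = (∫⁻ x, ENNReal.ofReal (f x ^ 2) ∂μ) ^ (1 / 2 : ℝ) := by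
  rw [eLpNorm_eq_lintegral_rpow_enorm_toReal two_ne_zero ENNReal.ofNat_ne_top]
  simp only [ENNReal.toReal_ofNat]
  congr 1
  refine lintegral_congr fun x => ?_
  rw [← ofReal_norm, ENNReal.ofReal_rpow_of_nonneg (norm_nonneg _) two_pos.le,
    Real.norm_eq_abs, Real.rpow_two, sq_abs]

theorem tendsto_eLpNorm_ballProfile (hN : 3 ≤ N) (hR : 0 < R) (hVm : Measurable V)
    (hV : IntegrableOn (fun s => V s ^ 2 / s ^ 2) (Set.Ioi 0)) {W : ℕ → ℝ → ℝ}
    (hWm : ∀ k, Measurable (W k)) (hle : ∀ k, ∀ s > 0, |W k s| ≤ |V s|)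
    (hlim : ∀ s > 0, Tendsto (fun k => W k s) atTop (𝓝 (V s))) :
    Tendsto (fun k => eLpNorm (ballProfile N R (W k) - ballProfile N R V) 2 (ballMeasure N R))
      atTop (𝓝 0) := by
  have h3 : Tendsto (fun k => ∫⁻ x, ENNReal.ofReal
      ((ballProfile N R (W k) x - ballProfile N R V x) ^ 2) ∂(ballMeasure N R)) atTop (𝓝 0) := by
    have h4 := tendsto_lintegral_of_dominated_convergence (μ := ballMeasure N R)
      (F := fun k x => ENNReal.ofReal ((ballProfile N R (W k) x - ballProfile N R V x) ^ 2))
      (f := fun _ => 0) (fun x => ENNReal.ofReal (4 * ballProfile N R V x ^ 2)) (fun k => ?_)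
      (fun k => ?_) ?_ ?_
    · simpa using h4
    · exact (((measurable_ballProfile (hWm k)).sub (measurable_ballProfile hVm)).pow_const
        2).ennreal_ofReal
    · filter_upwards [ae_ball_ne_zero hN R] with x hx
      refine ENNReal.ofReal_le_ofReal ?_
      have h5 : |ballProfile N R (W k) x| ≤ |ballProfile N R V x| := by
        rw [ballProfile, ballProfile, abs_mul, abs_mul]
        exact mul_le_mul_of_nonneg_left (hle k _ (logVar_pos hR hx.1 hx.2)) (abs_nonneg _)
      have h6 := sq_le_sq.2 h5
      nlinarith [sq_nonneg (ballProfile N R (W k) x + ballProfile N R V x)]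
    · exact (((integrable_sq_ballProfile hN hR hVm hV).const_mul 4).lintegral_lt_top).ne
    · filter_upwards [ae_ball_ne_zero hN R] with x hx
      have h5 : Tendsto (fun k => (ballProfile N R (W k) x - ballProfile N R V x) ^ 2) atTop
          (𝓝 ((ballProfile N R V x - ballProfile N R V x) ^ 2)) :=
        (((hlim _ (logVar_pos hR hx.1 hx.2)).const_mul _).sub_const _).pow 2
      rw [sub_self, zero_pow two_ne_zero] at h5
      simpa using ENNReal.tendsto_ofReal h5
  have h5 := (ENNReal.continuous_rpow_const (y := 1 / 2)).tendsto 0 |>.comp h3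
  rw [ENNReal.zero_rpow_of_pos (by norm_num)] at h5
  exact h5.congr fun k => (eLpNorm_two_eq_lintegral _ _).symm

/-- The approximants have φ = W k(-log(|x|/R)), whose squared norm is the sphere area times ∫ (W
k)'². It converges to the energy of the extremal profile, where Bliss's inequality is an equality.
-/
theorem isNonzeroRadialH_hsExtremal (hN : 3 ≤ N) (hR : 0 < R) (hm : m ≠ 0) (hn : n ≠ 0) :
    IsNonzeroRadialH R (hsExtremal N R m n) (hsConst N * hsTerm R (hsExtremal N R m n)) := by
  have hσ := sphereArea_pos hN
  obtain ⟨h, hhm, hL, hd, -, hVs, hE, hpos⟩ := exists_deriv_extremalProfile hN hm hn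
  obtain ⟨W, hW, hWle, hWlim, hWi, hW0, hWE⟩ := exists_profile_approx
    (fun s hs => contDiffAt_extremalProfile (N := N) (n := n) hm hs) hd
    hL.integrable_sq.integrableOn hhm hVs
  have hVm := measurable_extremalProfile N m n
  rw [hsExtremal_eq_ballProfile]
  refine ⟨⟨fun r => r ^ (-(((N : ℝ) - 2) / 2)) * extremalProfile N m n (-Real.log (r / R)),
    Eventually.of_forall fun x => rfl⟩, ⟨(measurable_ballProfile hVm).aestronglyMeasurable,
    fun k => logRadial N R (W k), fun k => isTest_logRadial hR (hW k), ?_, ?_, ?_⟩, ?_⟩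
  · intro ε hε
    have h1 : ∀ᶠ k in atTop, ∫ s in Set.Ioi (0 : ℝ), (deriv (W k) s - h s) ^ 2 <
        ε / (4 * sphereArea N) := hW0.eventually_lt_const (by positivity)
    obtain ⟨K, hK⟩ := eventually_atTop.1 h1
    refine ⟨K, fun k hk l hl => ?_⟩
    have h2 : logRadial N R (W k) - logRadial N R (W l) = logRadial N R (W k - W l) := rfl
    rw [h2, hForm_logRadial hN hR (isProfile_sub (hW k) (hW l)), profileEnergy]
    have h3 : ∀ s, deriv (W k - W l) s = deriv (W k) s - deriv (W l) s := fun s =>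
      deriv_sub ((hW k).1.differentiable (by simp) s) ((hW l).1.differentiable (by simp) s)
    simp only [h3]
    have h4 : ∫ s in Set.Ioi (0 : ℝ), (deriv (W k) s - deriv (W l) s) ^ 2 ≤
        ∫ s in Set.Ioi (0 : ℝ), (2 * (deriv (W k) s - h s) ^ 2 + 2 * (deriv (W l) s - h s) ^ 2) := by
      refine integral_mono_of_nonneg (Eventually.of_forall fun s => sq_nonneg _)
        (((hWi k).const_mul 2).add ((hWi l).const_mul 2)) (Eventually.of_forall fun s => ?_)
      dsimp only
      nlinarith [sq_nonneg ((deriv (W k) s - h s) + (deriv (W l) s - h s))]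
    rw [integral_add ((hWi k).const_mul 2) ((hWi l).const_mul 2), integral_const_mul,
      integral_const_mul] at h4
    have hk' := hK k hk
    have hl' := hK l hl
    have h5 : ∫ s in Set.Ioi (0 : ℝ), (deriv (W k) s - deriv (W l) s) ^ 2 <
        4 * (ε / (4 * sphereArea N)) := by linarith
    calc _ < sphereArea N * (4 * (ε / (4 * sphereArea N))) := mul_lt_mul_of_pos_left h5 hσ
      _ = ε := by field_simp
  · exact tendsto_eLpNorm_ballProfile hN hR hVm hVs (fun k => (hW k).1.continuous.measurable)
      hWle hWlim
  · rw [hsTerm_ballProfile hN hR, ← hE]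
    refine (hWE.const_mul (sphereArea N)).congr fun k => ?_
    rw [hForm_logRadial hN hR (hW k), profileEnergy]
  · intro h0
    have h1 : ∀ᵐ x : Euc N ∂(ballMeasure N R), False := by
      filter_upwards [h0, ae_ball_ne_zero hN R] with x hx hx'
      have : 0 < ballProfile N R (extremalProfile N m n) x :=
        mul_pos (Real.rpow_pos_of_pos (norm_pos_iff.2 hx'.1) _) (extremalProfile_pos hm _)
      rw [hx] at this
      exact lt_irrefl _ this
    rw [eventually_false_iff_eq_bot, ae_eq_bot, ballMeasure, Measure.restrict_eq_zero] at h1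
    exact (Metric.measure_ball_pos volume (0 : Euc N) hR).ne' h1

/-- As |x| → R the variable t tends to infinity, where the Talenti profile decays because n ≠ 0. -/
theorem tendsto_hsExtremal_sphere (hN : 3 ≤ N) (hR : 0 < R) (hn : n ≠ 0)
    {x : Euc N} (hx : x ∈ Metric.sphere (0 : Euc N) R) :
    Tendsto (hsExtremal N R m n) (𝓝[Metric.ball 0 R] x) (𝓝 0) := by
  have hN' : (3 : ℝ) ≤ N := by exact_mod_cast hN
  have hk : (0 : ℝ) < N - 2 := by linarith
  have hxR : ‖x‖ = R := mem_sphere_zero_iff_norm.1 hx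
  have hx0 : x ≠ 0 := norm_pos_iff.1 (by rw [hxR]; exact hR)
  have hnorm : Tendsto (fun y : Euc N => ‖y‖) (𝓝[Metric.ball 0 R] x) (𝓝 R) := by
    have := (continuous_norm.tendsto x).mono_left (nhdsWithin_le_nhds (s := Metric.ball 0 R))
    rwa [hxR] at this
  have hs : Tendsto (fun y : Euc N => -Real.log (‖y‖ / R)) (𝓝[Metric.ball 0 R] x) (𝓝[>] 0) := by
    refine tendsto_nhdsWithin_iff.2 ⟨?_, ?_⟩
    · have h1 := ((hnorm.div_const R).log (by rw [div_self hR.ne']; exact one_ne_zero)).neg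
      rwa [div_self hR.ne', Real.log_one, neg_zero] at h1
    · filter_upwards [self_mem_nhdsWithin, nhdsWithin_le_nhds (isOpen_ne.mem_nhds hx0)] with y hy hy0
      exact logVar_pos hR hy0 hy
  have ht : Tendsto (fun y : Euc N => tVar N R ‖y‖) (𝓝[Metric.ball 0 R] x) atTop :=
    (tendsto_rpow_neg_nhdsGT_zero (neg_lt_zero.2 (by positivity : 0 < 1 / ((N : ℝ) - 2)))).comp hs
  have h2 : Tendsto (fun y : Euc N => m ^ 2 + n ^ 2 * tVar N R ‖y‖ ^ 2) (𝓝[Metric.ball 0 R] x)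
      atTop :=
    tendsto_atTop_add_const_left _ _
      (((tendsto_pow_atTop two_ne_zero).comp ht).const_mul_atTop (by positivity))
  have h3 : Tendsto (fun y : Euc N => talenti N m n (tVar N R ‖y‖)) (𝓝[Metric.ball 0 R] x) (𝓝 0) :=
    (tendsto_rpow_neg_atTop (by positivity : 0 < ((N : ℝ) - 2) / 2)).comp h2
  have h4 := (hnorm.rpow_const (p := -(((N : ℝ) - 2) / 2)) (Or.inl hR.ne')).mul h3
  rw [mul_zero] at h4
  exact h4

end ExtremalInH

/-! ### Radial elements of the completion -/

section Completion

variable {N : ℕ} {R : ℝ} {φ ψ : Euc N → ℝ}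

lemma IsTest.sub {Ω : Set (Euc N)} (hφ : IsTest Ω φ) (hψ : IsTest Ω ψ) : IsTest Ω (φ - ψ) := by
  have hs : Function.support (φ - ψ) ⊆ tsupport φ ∪ tsupport ψ := fun x hx => by
    by_contra h
    rw [Set.mem_union, not_or] at h
    exact hx (by simp [image_eq_zero_of_notMem_tsupport h.1, image_eq_zero_of_notMem_tsupport h.2])
  have ht : tsupport (φ - ψ) ⊆ tsupport φ ∪ tsupport ψ :=
    closure_minimal hs ((isClosed_tsupport φ).union (isClosed_tsupport ψ))
  exact ⟨hφ.1.sub hψ.1, (hφ.2.1.isCompact.union hψ.2.1.isCompact).of_isClosed_subset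
    (isClosed_tsupport _) ht, ht.trans (Set.union_subset hφ.2.2 hψ.2.2)⟩

lemma logMean_sub (hφ : Continuous φ) (hψ : Continuous ψ) (s : ℝ) :
    logMean R (φ - ψ) s = logMean R φ s - logMean R ψ s := by
  have h : ∀ {f : Euc N → ℝ}, Continuous f → Integrable
      (fun θ : Metric.sphere (0 : Euc N) 1 => f ((R * Real.exp (-s)) • (θ : Euc N)))
      (sphereMeasure N) := fun {f} hf => by
    refine integrable_sphere ?_
    fun_prop
  simp only [logMean, average_sphere_eq, Pi.sub_apply]
  rw [integral_sub (h hφ) (h hψ), mul_sub]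

lemma logMeanDeriv_sub {Ω : Set (Euc N)} (hφ : IsTest Ω φ) (hψ : IsTest Ω ψ) (s : ℝ) :
    logMeanDeriv R (φ - ψ) s = logMeanDeriv R φ s - logMeanDeriv R ψ s := by
  have hc : ∀ {f : Euc N → ℝ}, IsTest Ω f → Continuous fun x => -(fderiv ℝ f x x) :=
    fun hf => (hf.continuous_fderiv.clm_apply continuous_id).neg
  rw [logMeanDeriv, logMeanDeriv, logMeanDeriv, ← logMean_sub (hc hφ) (hc hψ)]
  congr 1
  ext x
  rw [Pi.sub_apply, fderiv_sub (hφ.differentiable x) (hψ.differentiable x),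
    sub_apply]
  ring

/-- The derivative of the spherical means, extended by zero. -/
noncomputable def logMeanDerivExt (R : ℝ) (φ : Euc N → ℝ) : ℝ → ℝ :=
  (Set.Ioi 0).indicator (logMeanDeriv R φ)

lemma memLp_logMeanDerivExt (hN : 3 ≤ N) (hR : 0 < R) (hφ : IsTest (Metric.ball 0 R) φ) :
    MemLp (logMeanDerivExt R φ) 2 volume := by
  rw [logMeanDerivExt, memLp_indicator_iff_restrict measurableSet_Ioi,
    memLp_two_iff_integrable_sq (continuous_logMeanDeriv hφ.1).aestronglyMeasurable]
  exact (sphereArea_mul_integral_logMeanDeriv_sq_le hN hR hφ).1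

lemma sphereArea_mul_integral_logMeanDerivExt_sq_le (hN : 3 ≤ N) (hR : 0 < R)
    (hφ : IsTest (Metric.ball 0 R) φ) :
    sphereArea N * ∫ s, logMeanDerivExt R φ s ^ 2 ≤ hForm R (singularMul φ) := by
  have h : (fun s => logMeanDerivExt R φ s ^ 2) =
      (Set.Ioi 0).indicator fun s => logMeanDeriv R φ s ^ 2 := by
    ext s
    by_cases hs : s ∈ Set.Ioi (0 : ℝ)
    · rw [logMeanDerivExt, Set.indicator_of_mem hs, Set.indicator_of_mem hs]
    · rw [logMeanDerivExt, Set.indicator_of_notMem hs, Set.indicator_of_notMem hs,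
        zero_pow two_ne_zero]
  rw [h, integral_indicator measurableSet_Ioi]
  exact (sphereArea_mul_integral_logMeanDeriv_sq_le hN hR hφ).2

lemma logMean_eq_integral_ext (hN : 3 ≤ N) (hR : 0 < R) (hφ : IsTest (Metric.ball 0 R) φ) {s : ℝ}
    (hs : 0 < s) : logMean R φ s = ∫ r in (0 : ℝ)..s, logMeanDerivExt R φ r := by
  rw [logMean_eq_integral hN hR hφ, intervalIntegral.integral_of_le hs.le,
    intervalIntegral.integral_of_le hs.le]
  refine setIntegral_congr_fun measurableSet_Ioc fun r hr => ?_
  rw [logMeanDerivExt, Set.indicator_of_mem (show r ∈ Set.Ioi (0 : ℝ) from hr.1)]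

lemma norm_toLp_sq {f : ℝ → ℝ} (hf : MemLp f 2 volume) : ‖hf.toLp f‖ ^ 2 = ∫ s, f s ^ 2 := by
  rw [Lp.norm_toLp, hf.eLpNorm_eq_integral_rpow_norm two_ne_zero ENNReal.ofNat_ne_top]
  have h0 : 0 ≤ ∫ s, f s ^ 2 := integral_nonneg fun s => sq_nonneg _
  simp only [ENNReal.toReal_ofNat, Real.norm_eq_abs, Real.rpow_two, sq_abs]
  rw [ENNReal.toReal_ofReal (by positivity), ← Real.rpow_natCast, ← Real.rpow_mul h0]
  norm_num

/-- Passing to spherical means does not increase the distance to a radial function. -/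
lemma eLpNorm_ballProfile_logMean_sub_le (hN : 3 ≤ N) (hR : 0 < R)
    (hφ : IsTest (Metric.ball 0 R) φ) {g : ℝ → ℝ}
    (hg : AEStronglyMeasurable (fun x : Euc N => g ‖x‖) (ballMeasure N R)) :
    eLpNorm (ballProfile N R (logMean R φ) - fun x => g ‖x‖) 2 (ballMeasure N R) ≤
      eLpNorm (singularMul φ - fun x => g ‖x‖) 2 (ballMeasure N R) := by
  have hmp := measurePreserving_logPolar (N := N) hN hR
  have hm1 : Measurable (ballProfile N R (logMean R φ)) :=
    measurable_ballProfile (continuous_logMean hφ.continuous).measurable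
  have hm2 : Measurable (singularMul φ) :=
    (measurable_norm.pow_const _).mul hφ.continuous.measurable
  have hpolar : ∀ {f : Euc N → ℝ}, Measurable f →
      ∫⁻ x, ENNReal.ofReal ((f x - g ‖x‖) ^ 2) ∂(ballMeasure N R) =
      ∫⁻ s, (∫⁻ θ, ENNReal.ofReal ((f (logPolar R (s, θ)) - g ‖logPolar R (s, θ)‖) ^ 2)
        ∂(sphereMeasure N)) ∂(logRadialMeasure N R) := by
    intro f hf
    have hm : AEMeasurable (fun x => ENNReal.ofReal ((f x - g ‖x‖) ^ 2)) (ballMeasure N R) :=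
      ((hf.aemeasurable.sub hg.aemeasurable).pow_const 2).ennreal_ofReal
    have h1 : ∫⁻ x, ENNReal.ofReal ((f x - g ‖x‖) ^ 2) ∂(ballMeasure N R) =
        ∫⁻ z, ENNReal.ofReal ((f (logPolar R z) - g ‖logPolar R z‖) ^ 2)
          ∂((logRadialMeasure N R).prod (sphereMeasure N)) := by
      rw [← hmp.map_eq] at hm ⊢
      rw [lintegral_map' hm hmp.aemeasurable]
    rw [h1, lintegral_prod]
    exact hm.comp_quasiMeasurePreserving hmp.quasiMeasurePreserving
  rw [eLpNorm_two_eq_lintegral, eLpNorm_two_eq_lintegral]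
  simp only [Pi.sub_apply]
  rw [hpolar hm1, hpolar hm2]
  refine ENNReal.rpow_le_rpow (lintegral_mono fun s => ?_) (by norm_num)
  set ρ := R * Real.exp (-s) with hρ
  have hρ0 : 0 < ρ := by positivity
  have hn : ∀ θ : Metric.sphere (0 : Euc N) 1, ‖logPolar R (s, θ)‖ = ρ := fun θ =>
    norm_logPolar hR (s, θ)
  have hc : Continuous fun θ : Metric.sphere (0 : Euc N) 1 =>
      ρ ^ (-(((N : ℝ) - 2) / 2)) * φ (ρ • (θ : Euc N)) - g ρ := by
    have := hφ.continuous
    fun_prop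
  have hcφ : Continuous fun θ : Metric.sphere (0 : Euc N) 1 => φ (ρ • (θ : Euc N)) := by
    have := hφ.continuous
    fun_prop
  have hG : ∀ θ : Metric.sphere (0 : Euc N) 1, ballProfile N R (logMean R φ) (logPolar R (s, θ)) -
      g ‖logPolar R (s, θ)‖ = ρ ^ (-(((N : ℝ) - 2) / 2)) * logMean R φ s - g ρ := fun θ => by
    rw [ballProfile, hn, hρ, logRadius_div hR]
  have hF : ∀ θ : Metric.sphere (0 : Euc N) 1, singularMul φ (logPolar R (s, θ)) -
      g ‖logPolar R (s, θ)‖ = ρ ^ (-(((N : ℝ) - 2) / 2)) * φ (ρ • (θ : Euc N)) - g ρ := fun θ => by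
    rw [singularMul, hn]
    rfl
  have havg : ⨍ θ : Metric.sphere (0 : Euc N) 1,
      (ρ ^ (-(((N : ℝ) - 2) / 2)) * φ (ρ • (θ : Euc N)) - g ρ) ∂(sphereMeasure N) =
      ρ ^ (-(((N : ℝ) - 2) / 2)) * logMean R φ s - g ρ := by
    have hi := (integrable_sphere hcφ).const_mul (ρ ^ (-(((N : ℝ) - 2) / 2)))
    rw [average_sphere_eq, integral_sub hi (integrable_const _), integral_const_mul,
      integral_const, sphereMeasure_real_univ, smul_eq_mul, mul_sub,
      inv_mul_cancel_left₀ (sphereArea_pos hN).ne', logMean, average_sphere_eq]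
    ring
  simp only [hG, hF]
  -- Jensen on the sphere of radius ρ, where the radial function g is a constant.
  have hj := sq_average_sphere_le hN hc
  rw [havg] at hj
  have hi2 : Integrable (fun θ : Metric.sphere (0 : Euc N) 1 =>
      (ρ ^ (-(((N : ℝ) - 2) / 2)) * φ (ρ • (θ : Euc N)) - g ρ) ^ 2) (sphereMeasure N) :=
    integrable_sphere (hc.pow 2)
  rw [lintegral_const, ← ofReal_integral_eq_lintegral_ofReal hi2
    (Eventually.of_forall fun θ => sq_nonneg _), ← ofReal_measureReal (measure_ne_top _ _),
    sphereMeasure_real_univ, ← ENNReal.ofReal_mul (sq_nonneg _), mul_comm]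
  exact ENNReal.ofReal_le_ofReal hj

/-- Radial elements of `H(B_R)` have a profile with square integrable derivative. -/
theorem HasHNormSq.exists_profile (hN : 3 ≤ N) (hR : 0 < R) {u : Euc N → ℝ} {e : ℝ}
    (hr : IsRadialAE R u) (hu : HasHNormSq R u e) :
    ∃ h : ℝ → ℝ, MemLp h 2 volume ∧
      u =ᵐ[ballMeasure N R] ballProfile N R (fun s => ∫ r in (0 : ℝ)..s, h r) ∧
      sphereArea N * ∫ s in Set.Ioi (0 : ℝ), h s ^ 2 ≤ e := by
  have hσ := sphereArea_pos hN
  obtain ⟨hum, φ, hφ, hcau, hlim, he⟩ := hu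
  obtain ⟨g, hg⟩ := hr
  have hmem := fun k => memLp_logMeanDerivExt hN hR (hφ k)
  -- The map from φ to the derivative of its spherical mean is linear and bounded by the norm of
  -- H(B_R), so these derivatives form a Cauchy sequence in L²(ℝ).
  set f : ℕ → Lp ℝ 2 (volume : Measure ℝ) := fun k => (hmem k).toLp _ with hf
  have hsub : ∀ k l, ‖f k - f l‖ ^ 2 ≤ (sphereArea N)⁻¹ * hForm R (singularMul (φ k - φ l)) := by
    intro k l
    have h1 : logMeanDerivExt R (φ k - φ l) = logMeanDerivExt R (φ k) - logMeanDerivExt R (φ l) := by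
      rw [logMeanDerivExt, logMeanDerivExt, logMeanDerivExt, ← Set.indicator_sub']
      congr 1
      ext s
      exact logMeanDeriv_sub (hφ k) (hφ l) s
    have h2 := sphereArea_mul_integral_logMeanDerivExt_sq_le hN hR ((hφ k).sub (hφ l))
    rw [h1] at h2
    have h3 := norm_toLp_sq ((hmem k).sub (hmem l))
    simp only [hf]
    rw [← MemLp.toLp_sub, h3, inv_mul_eq_div, le_div_iff₀ hσ, mul_comm]
    exact h2
  have hC : CauchySeq f := by
    rw [Metric.cauchySeq_iff]
    intro ε hε
    obtain ⟨K, hK⟩ := hcau (sphereArea N * ε ^ 2) (by positivity)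
    refine ⟨K, fun k hk l hl => ?_⟩
    rw [dist_eq_norm]
    refine lt_of_pow_lt_pow_left₀ 2 hε.le ((hsub k l).trans_lt ?_)
    rw [inv_mul_eq_div, div_lt_iff₀ hσ, mul_comm]
    exact hK k hk l hl
  obtain ⟨G, hG⟩ := cauchySeq_tendsto_of_complete hC
  have hGm : MemLp (G : ℝ → ℝ) 2 volume := Lp.memLp G
  have hGt : hGm.toLp (G : ℝ → ℝ) = G := Lp.toLp_coeFn G hGm
  refine ⟨G, hGm, ?_, ?_⟩
  -- All means vanish at s = 0, so Cauchy-Schwarz turns L² convergence of the derivatives into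
  -- pointwise convergence of the means.
  · have hV : ∀ s > 0, Tendsto (fun k => logMean R (φ k) s) atTop
        (𝓝 (∫ r in (0 : ℝ)..s, (G : ℝ → ℝ) r)) := by
      intro s hs
      rw [tendsto_iff_norm_sub_tendsto_zero]
      have h1 : ∀ k, ‖logMean R (φ k) s - ∫ r in (0 : ℝ)..s, (G : ℝ → ℝ) r‖ ≤ √s * ‖f k - G‖ := by
        intro k
        have hd : MemLp (logMeanDerivExt R (φ k) - (G : ℝ → ℝ)) 2 volume := (hmem k).sub hGm
        have h2 : ‖f k - G‖ ^ 2 = ∫ r, (logMeanDerivExt R (φ k) - (G : ℝ → ℝ)) r ^ 2 := by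
          have h3 := norm_toLp_sq hd
          rw [MemLp.toLp_sub (hmem k) hGm, hGt] at h3
          exact h3
        have h3 : logMean R (φ k) s - ∫ r in (0 : ℝ)..s, (G : ℝ → ℝ) r =
            ∫ r in (0 : ℝ)..s, (logMeanDerivExt R (φ k) - (G : ℝ → ℝ)) r := by
          rw [logMean_eq_integral_ext hN hR (hφ k) hs]
          exact (intervalIntegral.integral_sub ((hmem k).intervalIntegrable_two _ _)
            (hGm.intervalIntegrable_two _ _)).symm
        have h4 : (∫ r in (0 : ℝ)..s, (logMeanDerivExt R (φ k) - (G : ℝ → ℝ)) r) ^ 2 ≤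
            s * ∫ r, (logMeanDerivExt R (φ k) - (G : ℝ → ℝ)) r ^ 2 := by
          have h5 := sq_intervalIntegral_le hd hs.le
          rw [sub_zero] at h5
          refine h5.trans (mul_le_mul_of_nonneg_left ?_ hs.le)
          rw [intervalIntegral.integral_of_le hs.le]
          exact setIntegral_le_integral hd.integrable_sq (Eventually.of_forall fun r => sq_nonneg _)
        rw [h3, Real.norm_eq_abs]
        refine abs_le_of_sq_le_sq ?_ (by positivity)
        rw [mul_pow, Real.sq_sqrt hs.le, h2]
        exact h4
      refine squeeze_zero (fun k => norm_nonneg _) h1 ?_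
      have h5 := (tendsto_iff_norm_sub_tendsto_zero.1 hG).const_mul √s
      rwa [mul_zero] at h5
    have hgm : AEStronglyMeasurable (fun x : Euc N => g ‖x‖) (ballMeasure N R) := hum.congr hg
    have hbm : ∀ k, Measurable (ballProfile N R (logMean R (φ k))) := fun k =>
      measurable_ballProfile (continuous_logMean (hφ k).continuous).measurable
    have hL : Tendsto (fun k => eLpNorm (ballProfile N R (logMean R (φ k)) - fun x => g ‖x‖) 2
        (ballMeasure N R)) atTop (𝓝 0) := by
      refine tendsto_of_tendsto_of_tendsto_of_le_of_le tendsto_const_nhds hlim (fun k => zero_le)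
        fun k => (eLpNorm_ballProfile_logMean_sub_le hN hR (hφ k) hgm).trans_eq ?_
      exact eLpNorm_congr_ae (hg.mono fun x hx => by
        simp only [Pi.sub_apply]
        rw [hx])
    -- A subsequence converging almost everywhere identifies the L² limit, which is u, with the
    -- pointwise limit.
    obtain ⟨ns, hns, hae⟩ := (tendstoInMeasure_of_tendsto_eLpNorm two_ne_zero
      (fun k => (hbm k).aestronglyMeasurable) hgm hL).exists_seq_tendsto_ae
    filter_upwards [hg, hae, ae_ball_ne_zero hN R] with x hx1 hx2 hx3
    rw [hx1]
    refine tendsto_nhds_unique hx2 ?_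
    exact ((hV _ (logVar_pos hR hx3.1 hx3.2)).comp hns.tendsto_atTop).const_mul _
  · have h1 : Tendsto (fun k => sphereArea N * ‖f k‖ ^ 2) atTop (𝓝 (sphereArea N * ‖G‖ ^ 2)) :=
      (hG.norm.pow 2).const_mul _
    have h2 : sphereArea N * ‖G‖ ^ 2 ≤ e := by
      refine le_of_tendsto_of_tendsto' h1 he fun k => ?_
      simp only [hf]
      rw [norm_toLp_sq]
      exact sphereArea_mul_integral_logMeanDerivExt_sq_le hN hR (hφ k)
    refine le_trans (mul_le_mul_of_nonneg_left ?_ hσ.le) h2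
    have h3 := norm_toLp_sq hGm
    rw [hGt] at h3
    rw [h3]
    exact setIntegral_le_integral hGm.integrable_sq (Eventually.of_forall fun s => sq_nonneg _)

end Completion

/-! ### Conclusion: equivalence, attainment and minimizers -/

section Minimizers

variable {N : ℕ} {R : ℝ}

/-- The equivalence with the full Sobolev inequality passes through the threshold C ≤ `hsConst N`,
which `sobolevIneq_of_le` and `le_hsConst_of_sobolev` give for the other side. -/
theorem hardySobolev_iff_sobolev (hN : 3 ≤ N) (hR : 0 < R) (C : ℝ) :
    (∀ u : Euc N → ℝ, IsRadial u → IsTest (Metric.ball 0 R \ {0}) u → HardySobolevIneq R C u) ↔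
      C ≤ hsConst N := by
  constructor
  · intro h
    refine le_hsConst_of_forall_profile hN fun V hV => ?_
    exact (hardySobolevIneq_ballProfile hN hR hV C).1
      (h _ isRadial_ballProfile (isTest_ballProfile hR hV))
  · intro hC u hr hu
    obtain ⟨V, hV, rfl⟩ := exists_ballProfile_eq hN hR hr hu
    rw [hardySobolevIneq_ballProfile hN hR hV]
    refine le_trans (mul_le_mul_of_nonneg_right hC ?_) (hsConst_mul_profileMass_le hN hV)
    exact Real.rpow_nonneg (mul_nonneg (sphereArea_pos hN).le (profileMass_nonneg N V)) _

lemma rpow_mul_hsConst (hN : 3 ≤ N) :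
    ((N : ℝ) - 2) ^ (2 * ((N : ℝ) - 1) / (N : ℝ)) * hsConst N = sobolevConst N := by
  have hN' : (3 : ℝ) ≤ N := by exact_mod_cast hN
  have hk : (0 : ℝ) < N - 2 := by linarith
  rw [hsConst, mul_left_comm, ← Real.rpow_add hk, add_neg_cancel, Real.rpow_zero, mul_one]

theorem sobolevIneq_of_le (hN : 3 ≤ N) {C : ℝ} (hC : C ≤ hsConst N) {w : Euc N → ℝ}
    (hw : IsTest Set.univ w) : SobolevIneq C w := by
  have hN' : (3 : ℝ) ≤ N := by exact_mod_cast hN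
  have hk : (0 : ℝ) < N - 2 := by linarith
  rw [SobolevIneq]
  refine le_trans (mul_le_mul_of_nonneg_right ?_ ?_)
    (sobolev_inequality hN (hw.1.of_le (by simp)) hw.2.1)
  · rw [← rpow_mul_hsConst hN]
    exact mul_le_mul_of_nonneg_left hC (by positivity)
  · exact Real.rpow_nonneg (integral_nonneg fun y => by positivity) _

theorem le_hsConst_of_sobolev (hN : 3 ≤ N) {C : ℝ}
    (h : ∀ w : Euc N → ℝ, IsTest Set.univ w → SobolevIneq C w) : C ≤ hsConst N := by
  refine le_hsConst_of_forall_profile hN fun V hV => ?_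
  have h1 := isTest_spaceProfile hN hV
  exact (sobolevIneq_spaceProfile hN hV C).1 (h _ ⟨h1.1, h1.2.1, Set.subset_univ _⟩)

lemma hsDensity_congr {u v : Euc N → ℝ} (h : u =ᵐ[ballMeasure N R] v) :
    hsDensity R u =ᵐ[ballMeasure N R] hsDensity R v :=
  h.mono fun x hx => by rw [hsDensity, hsDensity, hx]

lemma hsTerm_congr {u v : Euc N → ℝ} (h : u =ᵐ[ballMeasure N R] v) : hsTerm R u = hsTerm R v := by
  rw [hsTerm, hsTerm, integral_congr_ae (hsDensity_congr h)]

theorem hardySobolev_completion (hN : 3 ≤ N) (hR : 0 < R) {u : Euc N → ℝ} {e : ℝ}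
    (hr : IsRadialAE R u) (hu : HasHNormSq R u e) :
    Integrable (hsDensity R u) (ballMeasure N R) ∧ hsConst N * hsTerm R u ≤ e := by
  obtain ⟨h, hh, hae, he⟩ := hu.exists_profile hN hR hr
  obtain ⟨h1, h2, -⟩ := bliss_profile hN hh fun s => rfl
  refine ⟨((integrable_hsDensity_ballProfile hN hR _).2 h1).congr (hsDensity_congr hae).symm, ?_⟩
  rw [hsTerm_congr hae, hsTerm_ballProfile hN hR]
  exact h2.trans he

lemma hsTerm_hsExtremal_pos (hN : 3 ≤ N) (hR : 0 < R) {m n : ℝ} (hm : m ≠ 0) (hn : n ≠ 0) :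
    0 < hsTerm R (hsExtremal N R m n) := by
  obtain ⟨h, -, -, -, -, -, -, hpos⟩ := exists_deriv_extremalProfile hN hm hn
  rw [hsExtremal_eq_ballProfile, hsTerm_ballProfile hN hR]
  exact Real.rpow_pos_of_pos (mul_pos (sphereArea_pos hN) hpos) _

lemma hsTerm_nonneg (hR : 0 < R) (u : Euc N → ℝ) : 0 ≤ hsTerm R u := by
  refine Real.rpow_nonneg (integral_nonneg_of_ae ?_) _
  filter_upwards [ae_restrict_mem (μ := volume)
    (Metric.isOpen_ball (x := (0 : Euc N)) (ε := R)).measurableSet] with x hx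
  have : 0 ≤ -Real.log (‖x‖ / R) := neg_nonneg.2 (Real.log_nonpos (by positivity)
    ((div_le_one hR).2 (mem_ball_zero_iff.1 hx).le))
  rw [hsDensity]
  positivity

/-- Ensures that the quotient has a positive denominator on nonzero functions. Integrability
excludes that `hsTerm` is 0 merely as the default value of an undefined integral. -/
lemma eq_zero_of_integral_hsDensity_eq_zero (hN : 3 ≤ N) (hR : 0 < R) {u : Euc N → ℝ}
    (hi : Integrable (hsDensity R u) (ballMeasure N R)) (h0 : hsTerm R u = 0) :
    u =ᵐ[ballMeasure N R] 0 := by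
  have hN' : (3 : ℝ) ≤ N := by exact_mod_cast hN
  have hk : (0 : ℝ) < N - 2 := by linarith
  have hnn : 0 ≤ᵐ[ballMeasure N R] hsDensity R u := by
    filter_upwards [ae_ball_ne_zero hN R] with x hx
    have := logVar_pos hR hx.1 hx.2
    rw [Pi.zero_apply, hsDensity]
    positivity
  have h1 : ∫ x, hsDensity R u x ∂(ballMeasure N R) = 0 :=
    ((Real.rpow_eq_zero_iff_of_nonneg (integral_nonneg_of_ae hnn)).1 h0).1
  filter_upwards [(integral_eq_zero_iff_of_nonneg_ae hnn hi).1 h1, ae_ball_ne_zero hN R]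
    with x hx hx'
  have hs := logVar_pos hR hx'.1 hx'.2
  rw [Pi.zero_apply, hsDensity] at hx
  have h2 := (mul_eq_zero.1 hx).resolve_right (Real.rpow_pos_of_pos hs _).ne'
  exact abs_eq_zero.1 ((Real.rpow_eq_zero_iff_of_nonneg (abs_nonneg _)).1 h2).1

lemma HasHNormSq.congr {u v : Euc N → ℝ} {e : ℝ} (hu : HasHNormSq R u e)
    (h : u =ᵐ[ballMeasure N R] v) : HasHNormSq R v e := by
  obtain ⟨hm, φ, h1, h2, h3, h4⟩ := hu
  refine ⟨hm.congr h, φ, h1, h2, h3.congr fun k => eLpNorm_congr_ae ?_, h4⟩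
  exact h.mono fun x hx => by simp only [Pi.sub_apply, hx]

lemma IsNonzeroRadialH.congr {u v : Euc N → ℝ} {e : ℝ} (hu : IsNonzeroRadialH R u e)
    (h : u =ᵐ[ballMeasure N R] v) : IsNonzeroRadialH R v e := by
  obtain ⟨⟨g, hg⟩, h2, h3⟩ := hu
  exact ⟨⟨g, h.symm.trans hg⟩, h2.congr h, fun h' => h3 (h.trans h')⟩

lemma singularMul_neg (φ : Euc N → ℝ) : singularMul (-φ) = -singularMul φ := by
  ext x
  simp [singularMul]

lemma IsTest.neg {Ω : Set (Euc N)} {φ : Euc N → ℝ} (h : IsTest Ω φ) : IsTest Ω (-φ) := by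
  have h0 : tsupport (-φ) = tsupport φ := by rw [tsupport, tsupport, Function.support_neg]
  refine ⟨h.1.neg, ?_, by rw [h0]; exact h.2.2⟩
  rw [HasCompactSupport, h0]
  exact h.2.1

lemma hForm_singularMul_neg (hN : 3 ≤ N) (hR : 0 < R) {φ : Euc N → ℝ}
    (hφ : IsTest (Metric.ball 0 R) φ) :
    hForm R (singularMul (-φ)) = hForm R (singularMul φ) := by
  rw [hForm_singularMul hN hR hφ, hForm_singularMul hN hR hφ.neg]
  congr 1
  ext x
  rw [fderiv_neg, norm_neg]

lemma IsNonzeroRadialH.neg (hN : 3 ≤ N) (hR : 0 < R) {u : Euc N → ℝ} {e : ℝ}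
    (hu : IsNonzeroRadialH R u e) : IsNonzeroRadialH R (-u) e := by
  obtain ⟨⟨g, hg⟩, ⟨hm, φ, h1, h2, h3, h4⟩, h5⟩ := hu
  refine ⟨⟨-g, hg.neg⟩, ⟨hm.neg, fun k => -φ k, fun k => (h1 k).neg, fun ε hε => ?_, ?_, ?_⟩, ?_⟩
  · obtain ⟨K, hK⟩ := h2 ε hε
    refine ⟨K, fun k hk l hl => ?_⟩
    rw [show -φ k - -φ l = -(φ k - φ l) by ring, hForm_singularMul_neg hN hR ((h1 k).sub (h1 l))]
    exact hK k hk l hl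
  · refine h3.congr fun k => ?_
    rw [singularMul_neg, show -singularMul (φ k) - -u = -(singularMul (φ k) - u) by ring,
      eLpNorm_neg]
  · exact h4.congr fun k => (hForm_singularMul_neg hN hR (h1 k)).symm
  · intro h
    refine h5 (h.mono fun x hx => ?_)
    simpa using hx

lemma hsTerm_neg (u : Euc N → ℝ) : hsTerm R (-u) = hsTerm R u := by
  simp only [hsTerm, hsDensity, Pi.neg_apply, abs_neg]

lemma isHSMinimizer_of_eq (hN : 3 ≤ N) (hR : 0 < R) {u : Euc N → ℝ}
    (hu : IsNonzeroRadialH R u (hsConst N * hsTerm R u)) : IsHSMinimizer R u := by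
  refine ⟨_, hu, fun z e' hz => ?_⟩
  have hpos : ∀ {v : Euc N → ℝ} {e : ℝ}, IsNonzeroRadialH R v e → 0 < hsTerm R v := by
    intro v e hv
    refine lt_of_le_of_ne (hsTerm_nonneg hR v) fun h0 => hv.2.2 ?_
    exact eq_zero_of_integral_hsDensity_eq_zero hN hR
      (hardySobolev_completion hN hR hv.1 hv.2.1).1 h0.symm
  rw [mul_div_cancel_right₀ _ (hpos hu).ne', le_div_iff₀ (hpos hz)]
  exact (hardySobolev_completion hN hR hz.1 hz.2.1).2

/-- The minimizers of the Hardy-Sobolev quotient. -/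
theorem isHSMinimizer_iff (hN : 3 ≤ N) (hR : 0 < R) (u : Euc N → ℝ) :
    IsHSMinimizer R u ↔ ∃ m n : ℝ, m ≠ 0 ∧ n ≠ 0 ∧
      (u =ᵐ[ballMeasure N R] hsExtremal N R m n ∨
        u =ᵐ[ballMeasure N R] -hsExtremal N R m n) := by
  constructor
  · rintro ⟨e, hu, hmin⟩
    have hJ : 0 < hsTerm R u := by
      refine lt_of_le_of_ne (hsTerm_nonneg hR u) fun h0 => hu.2.2 ?_
      exact eq_zero_of_integral_hsDensity_eq_zero hN hR
        (hardySobolev_completion hN hR hu.1 hu.2.1).1 h0.symm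
    -- Comparison with u_{1,1}, whose quotient is exactly `hsConst N`.
    have hone := hmin _ _ (isNonzeroRadialH_hsExtremal hN hR (one_ne_zero (α := ℝ))
      (one_ne_zero (α := ℝ)))
    rw [mul_div_cancel_right₀ _ (hsTerm_hsExtremal_pos hN hR one_ne_zero one_ne_zero).ne',
      div_le_iff₀ hJ] at hone
    obtain ⟨h, hh, hae, he⟩ := hu.2.1.exists_profile hN hR hu.1
    obtain ⟨-, -, h3⟩ := bliss_profile hN hh fun s => rfl
    rw [hsTerm_congr hae, hsTerm_ballProfile hN hR] at hone
    have hne : ∃ s > 0, ∫ r in (0 : ℝ)..s, h r ≠ 0 := by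
      by_contra hcon
      push Not at hcon
      refine hu.2.2 (hae.trans ?_)
      filter_upwards [ae_ball_ne_zero hN R] with x hx
      rw [ballProfile, hcon _ (logVar_pos hR hx.1 hx.2), mul_zero, Pi.zero_apply]
    -- The energy of the profile is at most e, and e is at most `hsConst N` times the Hardy-Sobolev
    -- term, so Bliss's inequality is an equality for this profile.
    obtain ⟨m, n, hm, hn, hV⟩ := h3 (he.trans hone) hne
    refine ⟨m, n, hm, hn, ?_⟩
    rcases hV with hV | hV
    · refine Or.inl (hae.trans ?_)
      filter_upwards [ae_ball_ne_zero hN R] with x hx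
      rw [ballProfile, hV _ (logVar_pos hR hx.1 hx.2)]
      rfl
    · refine Or.inr (hae.trans ?_)
      filter_upwards [ae_ball_ne_zero hN R] with x hx
      rw [ballProfile, hV _ (logVar_pos hR hx.1 hx.2), mul_neg]
      rfl
  · rintro ⟨m, n, hm, hn, h | h⟩
    · have h1 := (isNonzeroRadialH_hsExtremal hN hR hm hn).congr h.symm
      rw [← hsTerm_congr h] at h1
      exact isHSMinimizer_of_eq hN hR h1
    · have h1 := ((isNonzeroRadialH_hsExtremal hN hR hm hn).neg hN hR).congr h.symm
      rw [← hsTerm_neg (R := R), ← hsTerm_congr h] at h1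
      exact isHSMinimizer_of_eq hN hR h1

end Minimizers

theorem theorem2 (N : ℕ) (hN : 3 ≤ N) (R : ℝ) (hR : 0 < R) :
    -- The transformation is a bijection between the radial functions of `C_c^∞(B_R \ {0})` and
    -- those of `C_c^∞(ℝ^N \ {0})`, and it turns each inequality into the other.
    (∀ u : Euc N → ℝ, IsRadial u → IsTest (Metric.ball 0 R \ {0}) u →
      ∃! w : Euc N → ℝ, IsRadial w ∧ IsTest {0}ᶜ w ∧ IsTransform R u w) ∧
    (∀ w : Euc N → ℝ, IsRadial w → IsTest {0}ᶜ w →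
      ∃! u : Euc N → ℝ, IsRadial u ∧ IsTest (Metric.ball 0 R \ {0}) u ∧ IsTransform R u w) ∧
    (∀ u w : Euc N → ℝ, IsRadial u → IsTest (Metric.ball 0 R \ {0}) u →
      IsRadial w → IsTest {0}ᶜ w → IsTransform R u w →
      ∀ C : ℝ, HardySobolevIneq R C u ↔ SobolevIneq C w) ∧
    -- With the same `C`, the radial Hardy-Sobolev inequality is equivalent to the Sobolev
    -- inequality for all (not only radial) functions on `ℝ^N`.
    (∀ C : ℝ,
      (∀ u : Euc N → ℝ, IsRadial u → IsTest (Metric.ball 0 R \ {0}) u → HardySobolevIneq R C u) ↔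
      (∀ w : Euc N → ℝ, IsTest Set.univ w → SobolevIneq C w)) ∧
    -- The best constant.
    IsGreatest {C : ℝ | ∀ u : Euc N → ℝ, IsRadial u → IsTest (Metric.ball 0 R \ {0}) u →
      HardySobolevIneq R C u} (hsConst N) ∧
    -- The inequality on the radial functions of `H(B_R)`, with the same constant, which is
    -- attained there.
    (∀ (u : Euc N → ℝ) (e : ℝ), IsRadialAE R u → HasHNormSq R u e →
      Integrable (hsDensity R u) (ballMeasure N R) ∧ hsConst N * hsTerm R u ≤ e) ∧
    (∀ m n : ℝ, m ≠ 0 → n ≠ 0 →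
      IsNonzeroRadialH R (hsExtremal N R m n) (hsConst N * hsTerm R (hsExtremal N R m n)) ∧
      ∀ x ∈ Metric.sphere (0 : Euc N) R,
        Tendsto (hsExtremal N R m n) (𝓝[Metric.ball 0 R] x) (𝓝 0)) ∧
    -- The minimizers.
    (∀ u : Euc N → ℝ, IsHSMinimizer R u ↔
      ∃ m n : ℝ, m ≠ 0 ∧ n ≠ 0 ∧
        (u =ᵐ[ballMeasure N R] hsExtremal N R m n ∨
          u =ᵐ[ballMeasure N R] -hsExtremal N R m n)) := by
  have hEq := hardySobolev_iff_sobolev hN hR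
  refine ⟨fun u hr hu => ?_, fun w hr hw => ?_, fun u w hr hu hrw hw ht C => ?_, fun C => ?_,
    ⟨fun u hr hu => ?_, fun C hC => ?_⟩, fun u e hr hu => hardySobolev_completion hN hR hr hu,
    fun m n hm hn => ⟨isNonzeroRadialH_hsExtremal hN hR hm hn,
      fun x hx => tendsto_hsExtremal_sphere hN hR hn hx⟩,
    isHSMinimizer_iff hN hR⟩
  · obtain ⟨V, hV, rfl⟩ := exists_ballProfile_eq hN hR hr hu
    exact ⟨spaceProfile N V, ⟨isRadial_spaceProfile, isTest_spaceProfile hN hV,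
      isTransform_profile hN hR⟩, fun w hw =>
      eq_spaceProfile_of_isTransform hN hR hV hw.2.1 hw.2.2⟩
  · obtain ⟨V, hV, rfl⟩ := exists_spaceProfile_eq hN hr hw
    exact ⟨ballProfile N R V, ⟨isRadial_ballProfile, isTest_ballProfile hR hV,
      isTransform_profile hN hR⟩, fun u hu =>
      eq_ballProfile_of_isTransform hN hR hV hu.2.1 hu.2.2⟩
  · obtain ⟨V, hV, rfl⟩ := exists_ballProfile_eq hN hR hr hu
    rw [eq_spaceProfile_of_isTransform hN hR hV hw ht, hardySobolevIneq_ballProfile hN hR hV,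
      sobolevIneq_spaceProfile hN hV]
  · rw [hEq]
    exact ⟨fun h w hw => sobolevIneq_of_le hN h hw, fun h => le_hsConst_of_sobolev hN h⟩
  · exact (hEq (hsConst N)).2 le_rfl u hr hu
  · exact (hEq C).1 hC
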